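/- For every \(B>0\), \(M>0\) and \(\kappa_8\in\mathbb{R}\) there is a constant \(C=C_{B,M,\kappa_8}>0\), depending only on \(B,M,\kappa_8\), such that for every \(b>0\) there is \(T_0\) (depending only on \(b,B,M,\kappa_8\)) with the following property. Let \(n\ge 0\) be an integer and let \(\varepsilon_{i,t}\) (\(1\le i\le n\), \(t\in\mathbb{Z}\)) be independent random variables with \(\mathbb{E}[\varepsilon_{i,t}]=0\), \(\mathbb{E}[\varepsilon_{i,t}^2]=1\), \(\mathbb{E}[|\varepsilon_{i,t}|^8]\le\kappa_8\), each having a Lebesgue density whose essential supremum is at most \(M\). Let \(\Psi_0,\Psi_1,\dots\) be diagonal real \(n\times n\) matrices such that, for every \(j\), \[ \Big|\sum_{k=0}^\infty(\Psi_k)_{jj}\Big|\ge b,\qquad \sum_{k=0}^\infty(1+k)\,|(\Psi_k)_{jj}|\le B . \] Put \(e_t=\sum_{k\ge0}\Psi_k\varepsilon_{t-k}\). For an integer \(T\ge T_0\) let \(\boldsymbol e_j=(e_{j,1},\dots,e_{j,T})\) be the \(j\)-th row of \([e_1,\dots,e_T]\), and for \(1\le k\le T-1\) let \[ \sigma_k=\frac{1}{2\sin(\pi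 k/(2T))},\qquad \boldsymbol v_k=(v_{k,1},\dots,v_{k,T})',\quad v_{k,t}=\sqrt{2/T}\,\sin\big(\pi k(t-1)/T\big). \] Then for every \(j\in\{1,\dots,n\}\) and all \(k\ne l\) in \(\{1,\dots,T-1\}\), the denominator \(\sum_{t=1}^{T-1}(\sigma_t/\sigma_1)^2(\boldsymbol e_j\boldsymbol v_t)^2\) is almost surely positive, the two random variables below are integrable, and \[ \Big|\mathbb{E}\Big[\frac{(\boldsymbol e_j\boldsymbol v_k)(\boldsymbol e_j\boldsymbol v_l)}{\sum_{t=1}^{T-1}(\sigma_t/\sigma_1)^2(\boldsymbol e_j\boldsymbol v_t)^2}\Big]\Big|\le C\,T^{-1/2}, \qquad \big|\mathbb{E}[M_{j,kl}]\big|\le C\,(kl)^{-1}, \] where \[ M_{j,kl}=\frac{\sigma_k\sigma_l(\boldsymbol e_j\boldsymbol v_k)(\boldsymbol e_j\boldsymbol v_l)}{\sum_{t=1}^{T-1}\sigma_t^2(\boldsymbol e_j\boldsymbol v_t)^2}. \] -/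

import Mathlib

open MeasureTheory ProbabilityTheory

noncomputable section

/-- The array `ε i t` consists of independent random variables with mean `0`, variance `1`,
a Lebesgue density whose essential supremum is at most `M`, and eighth absolute moments
bounded by `κ`. -/
structure IsNoise {Ω : Type*} [MeasurableSpace Ω] (P : Measure Ω) {n : ℕ}
    (ε : Fin n → ℤ → Ω → ℝ) (M κ : ℝ) : Prop where
  measurable : ∀ i t, Measurable (ε i t)
  indep : iIndepFun (fun p : Fin n × ℤ => ε p.1 p.2) P
  mean_zero : ∀ i t, ∫ ω, ε i t ω ∂P = 0
  var_one : ∀ i t, ∫ ω, (ε i t ω) ^ 2 ∂P = 1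
  hasPDF : ∀ i t, HasPDF (ε i t) P volume
  pdf_le : ∀ i t, essSup (pdf (ε i t) P volume) volume ≤ ENNReal.ofReal M
  memLp : ∀ i t, MemLp (ε i t) 8 P
  moment_le : ∀ i t, ∫ ω, |ε i t ω| ^ 8 ∂P ≤ κ

/-- The coefficients `Ψ k` of the lag polynomial are diagonal, with
`|∑ₖ (Ψₖ)ⱼⱼ| ≥ b` and `∑ₖ (1 + k) |(Ψₖ)ⱼⱼ| ≤ B` (a convergent series) for every `j`. -/
structure IsLagPolynomial {n : ℕ} (Ψ : ℕ → Matrix (Fin n) (Fin n) ℝ) (b B : ℝ) : Prop where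
  isDiag : ∀ k, (Ψ k).IsDiag
  summable : ∀ j, Summable fun k : ℕ => (1 + (k : ℝ)) * |Ψ k j j|
  lower : ∀ j, b ≤ |∑' k : ℕ, Ψ k j j|
  upper : ∀ j, ∑' k : ℕ, (1 + (k : ℝ)) * |Ψ k j j| ≤ B

/-- The `j`-th coordinate of `e_t = Ψ(L) ε_t = ∑ₖ Ψₖ ε_{t-k}`. Under the two assumptions above the
series converges absolutely for almost every `ω`. -/
def linProc {Ω : Type*} {n : ℕ} (Ψ : ℕ → Matrix (Fin n) (Fin n) ℝ) (ε : Fin n → ℤ → Ω → ℝ)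
    (j : Fin n) (t : ℤ) (ω : Ω) : ℝ :=
  ∑' k : ℕ, (Ψ k).mulVec (fun i => ε i (t - k) ω) j

/-- `σ_k = 1 / (2 sin (π k / (2 T)))`. -/
def sigmaCoef (T k : ℕ) : ℝ := (2 * Real.sin (Real.pi * k / (2 * T)))⁻¹

/-- The `t`-th entry `v_{k,t} = √(2/T) sin (π k (t - 1) / T)` of `v_k`, for `1 ≤ t ≤ T`. -/
def vEntry (T k t : ℕ) : ℝ :=
  Real.sqrt (2 / T) * Real.sin (Real.pi * k * ((t : ℝ) - 1) / T)

/-- `e_j v_k = ∑_{t=1}^T e_{j,t} v_{k,t}`, where `e_j` is the `j`-th row of `[e_1, …, e_T]`. -/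
def rowDot {Ω : Type*} {n : ℕ} (Ψ : ℕ → Matrix (Fin n) (Fin n) ℝ) (ε : Fin n → ℤ → Ω → ℝ)
    (T : ℕ) (j : Fin n) (k : ℕ) (ω : Ω) : ℝ :=
  ∑ t ∈ Finset.Icc 1 T, linProc Ψ ε j (t : ℤ) ω * vEntry T k t

/-- `∑_{t=1}^{T-1} (σ_t / σ_1)² (e_j v_t)²`. -/
def crossDenom {Ω : Type*} {n : ℕ} (Ψ : ℕ → Matrix (Fin n) (Fin n) ℝ) (ε : Fin n → ℤ → Ω → ℝ)
    (T : ℕ) (j : Fin n) (ω : Ω) : ℝ :=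
  ∑ t ∈ Finset.Icc 1 (T - 1), (sigmaCoef T t / sigmaCoef T 1) ^ 2 * (rowDot Ψ ε T j t ω) ^ 2

/-- `(e_j v_k)(e_j v_l) / ∑_{t=1}^{T-1} (σ_t / σ_1)² (e_j v_t)²`. -/
def crossRatio {Ω : Type*} {n : ℕ} (Ψ : ℕ → Matrix (Fin n) (Fin n) ℝ) (ε : Fin n → ℤ → Ω → ℝ)
    (T : ℕ) (j : Fin n) (k l : ℕ) (ω : Ω) : ℝ :=
  rowDot Ψ ε T j k ω * rowDot Ψ ε T j l ω / crossDenom Ψ ε T j ω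

/-- `M_{j,kl} = σ_k σ_l (e_j v_k)(e_j v_l) / ∑_{t=1}^{T-1} σ_t² (e_j v_t)²`. -/
def mEntry {Ω : Type*} {n : ℕ} (Ψ : ℕ → Matrix (Fin n) (Fin n) ℝ) (ε : Fin n → ℤ → Ω → ℝ)
    (T : ℕ) (j : Fin n) (k l : ℕ) (ω : Ω) : ℝ :=
  sigmaCoef T k * sigmaCoef T l * rowDot Ψ ε T j k ω * rowDot Ψ ε T j l ω /
    ∑ t ∈ Finset.Icc 1 (T - 1), (sigmaCoef T t) ^ 2 * (rowDot Ψ ε T j t ω) ^ 2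

end

/-! Write `x_t = e_j v_t`, `a_t = σ_t / σ_1` (between `1/(2t)` and `2/t`) and `D = ∑ a_t² x_t²`. The
`v_t` are orthonormal sines and behave almost like eigenvectors of symmetrized shifts. Hence the
`x_t` are linear forms `∑ W_t(u) ε_u` with coefficients of order `T^{-1/2}` and a Gram matrix that
is diagonal up to `O(1/T)`, with diagonal entries bounded below at low frequencies. If the `x_t`
were independent centred Gaussians, `E[x_k x_l / D]` would vanish by the symmetry `x_k → -x_k`. The
proof makes this quantitative.

The quotient is removed by `1/D = ∫_0^S exp(-sD) ds + exp(-SD)/D`. For fixed `s`, `exp(-sD)` is the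
average over a standard Gaussian vector `z` of `cos(√(2s) ∑ a_t z_t x_t)`, and `E[x_k x_l cos(c·ε)]`
is explicit in characteristic functions of single variables (`integral_linear_mul_linear_mul_exp`).
A cumulant expansion replaces it by its Gaussian value with error `O(1/T)` instead of `O(T^{-1/2})`,
because third moments enter at first order only through imaginary quantities
(`abs_integral_mul_mul_cos_sub_le`). The Gaussian value almost changes sign under `z_k → -z_k`, so
its average over `z` is `O(1/T)` as well (`abs_gaussTerm_add_reflection_le`). The price is a power
of `1 + √(2S) ∑ a_t`, that is, of `S` and `log T`.

For the remaining term, `|x_k x_l| / D ≤ 1/(2 a_k a_l) = O(T²)`, while `E exp(-SD)` is at most a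
multiple of `S^{-m/2}` plus a negligible error when `m` low modes are kept
(`integral_exp_neg_mul_sum_le`). With `S = T^{1/100}` and `m = 600` the total is `O(T^{-3/4})`. The
gain over `T^{-1/2}` absorbs all constants once `T ≥ T₀`, so `b` affects only `T₀`. The second bound
follows since `M_{kl}` is `a_k a_l ≤ (2/k)(2/l)` times the first ratio.

All this is done for the process truncated at lag `N`, with bounds independent of `N`; dominated
convergence then gives the full process. The limit of the ratios requires `D > 0` almost surely,
which holds because a linear form containing an independent variable with a density has no atom. -/

/-! ### Characteristic functions of one standardized variable near the origin. -/

/-- Taylor remainder of the exponential on the imaginary axis, with a crude constant. -/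
theorem norm_exp_I_mul_sub_sum_le (y : ℝ) (n : ℕ) :
    ‖Complex.exp (Complex.I * y) - ∑ m ∈ Finset.range n, (Complex.I * y) ^ m / (m.factorial : ℂ)‖
      ≤ 4 * |y| ^ n := by
  have hnorm : ‖Complex.I * (y : ℂ)‖ = |y| := by simp
  have he : Real.exp 1 ≤ 3 := by have := Real.exp_one_lt_d9; linarith
  rcases le_total |y| 1 with h | h
  · have h1 := Complex.norm_exp_sub_sum_le_norm_mul_exp (Complex.I * (y : ℂ)) n
    rw [hnorm] at h1
    refine h1.trans ?_
    have h2 : Real.exp |y| ≤ 3 := (Real.exp_le_exp.2 h).trans he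
    have : 0 ≤ |y| ^ n := by positivity
    nlinarith
  · have h1 : ‖∑ m ∈ Finset.range n, (Complex.I * (y : ℂ)) ^ m / (m.factorial : ℂ)‖
        ≤ 3 * |y| ^ n := by
      calc _ ≤ ∑ m ∈ Finset.range n, |y| ^ n * ((1 : ℝ) ^ m / m.factorial) := by
            refine (norm_sum_le _ _).trans (Finset.sum_le_sum fun m hm => ?_)
            rw [norm_div, norm_pow, hnorm, Complex.norm_natCast, one_pow, mul_one_div]
            gcongr
            exact (Finset.mem_range.1 hm).le
        _ ≤ |y| ^ n * 3 := by
            rw [← Finset.mul_sum]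
            gcongr
            exact (Real.sum_le_exp_of_nonneg zero_le_one n).trans he
        _ = _ := mul_comm _ _
    have h2 : (1 : ℝ) ≤ |y| ^ n := one_le_pow₀ h
    have h3 := norm_sub_le (Complex.exp (Complex.I * y))
      (∑ m ∈ Finset.range n, (Complex.I * (y : ℂ)) ^ m / (m.factorial : ℂ))
    rw [Complex.norm_exp_I_mul_ofReal] at h3
    linarith

/-- `X` has mean `0`, variance `1` and third and fourth absolute moments at most `K`. -/
structure IsStandardized {Ω : Type*} [MeasurableSpace Ω] (P : Measure Ω) (X : Ω → ℝ) (K : ℝ) :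
    Prop where
  measurable : Measurable X
  memLp : MemLp X 4 P
  mean_zero : ∫ ω, X ω ∂P = 0
  var_one : ∫ ω, X ω ^ 2 ∂P = 1
  moment_three : ∫ ω, |X ω| ^ 3 ∂P ≤ K
  moment_four : ∫ ω, |X ω| ^ 4 ∂P ≤ K
  one_le : 1 ≤ K

/-- `E[X ^ j exp (i c X)]`. -/
noncomputable def charMoment {Ω : Type*} [MeasurableSpace Ω] (P : Measure Ω) (X : Ω → ℝ) (j : ℕ)
    (c : ℝ) : ℂ :=
  ∫ ω, (X ω : ℂ) ^ j * Complex.exp (Complex.I * ((c * X ω : ℝ) : ℂ)) ∂P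

namespace IsStandardized

variable {Ω : Type*} [MeasurableSpace Ω] {P : Measure Ω} {X : Ω → ℝ} {K : ℝ}

theorem abs_third_moment_le (hX : IsStandardized P X K) : |∫ ω, X ω ^ 3 ∂P| ≤ K := by
  refine (abs_integral_le_integral_abs).trans ?_
  simpa [abs_pow] using hX.moment_three

variable [IsProbabilityMeasure P]

theorem integrable_abs_pow (hX : IsStandardized P X K) {j : ℕ} (hj : j ≤ 4) :
    Integrable (fun ω => |X ω| ^ j) P := by
  have h : MemLp X j P := hX.memLp.mono_exponent (by exact_mod_cast hj)
  simpa using h.integrable_norm_pow'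

theorem integrable_pow (hX : IsStandardized P X K) {j : ℕ} (hj : j ≤ 4) :
    Integrable (fun ω => X ω ^ j) P := by
  have := hX.measurable
  refine (hX.integrable_abs_pow hj).mono' (by fun_prop) (ae_of_all _ fun ω => ?_)
  simp

/-- Taylor expansion of the exponential under the expectation; the remainder of order `n` costs the
absolute moment of order `n + j`, and four moments are available. The expansions below are its
instances. -/
theorem norm_charMoment_sub_le (hX : IsStandardized P X K) {j n : ℕ} (hj : n + j ≤ 4)
    (c : ℝ) :
    ‖charMoment P X j c - ∑ m ∈ Finset.range n,
        (Complex.I * c) ^ m / (m.factorial : ℂ) * ((∫ ω, X ω ^ (m + j) ∂P : ℝ) : ℂ)‖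
      ≤ 4 * |c| ^ n * ∫ ω, |X ω| ^ (n + j) ∂P := by
  have hm := hX.measurable
  have hint : ∀ m ∈ Finset.range n, Integrable (fun ω => (Complex.I * c) ^ m / (m.factorial : ℂ) *
      ((X ω ^ (m + j) : ℝ) : ℂ)) P := fun m hm' =>
    ((hX.integrable_pow (j := m + j) (by have := Finset.mem_range.1 hm'; omega)).ofReal).const_mul _
  have hexp : Integrable (fun ω => (X ω : ℂ) ^ j *
      Complex.exp (Complex.I * ((c * X ω : ℝ) : ℂ))) P := by
    refine (hX.integrable_abs_pow (j := j) (by omega)).mono' (by fun_prop) (ae_of_all _ fun ω => ?_)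
    rw [norm_mul, Complex.norm_exp_I_mul_ofReal]
    simp
  have heq : charMoment P X j c - ∑ m ∈ Finset.range n,
        (Complex.I * c) ^ m / (m.factorial : ℂ) * ((∫ ω, X ω ^ (m + j) ∂P : ℝ) : ℂ) =
      ∫ ω, (X ω : ℂ) ^ j * (Complex.exp (Complex.I * ((c * X ω : ℝ) : ℂ)) -
        ∑ m ∈ Finset.range n, (Complex.I * ((c * X ω : ℝ) : ℂ)) ^ m / (m.factorial : ℂ)) ∂P := by
    have h1 : ∑ m ∈ Finset.range n, (Complex.I * c) ^ m / (m.factorial : ℂ) *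
        ((∫ ω, X ω ^ (m + j) ∂P : ℝ) : ℂ) = ∫ ω, ∑ m ∈ Finset.range n,
          (Complex.I * c) ^ m / (m.factorial : ℂ) * ((X ω ^ (m + j) : ℝ) : ℂ) ∂P := by
      rw [integral_finsetSum _ hint]
      refine Finset.sum_congr rfl fun m _ => ?_
      rw [integral_const_mul, integral_complex_ofReal]
    rw [h1, charMoment, ← integral_sub hexp (integrable_finsetSum _ hint)]
    congr 1
    ext ω
    rw [mul_sub, Finset.mul_sum]
    congr 1
    refine Finset.sum_congr rfl fun m _ => ?_
    push_cast
    ring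
  rw [heq, ← integral_const_mul]
  refine norm_integral_le_of_norm_le
    ((hX.integrable_abs_pow (j := n + j) hj).const_mul _) (ae_of_all _ fun ω => ?_)
  rw [norm_mul, norm_pow, Complex.norm_real, Real.norm_eq_abs]
  calc |X ω| ^ j * _ ≤ |X ω| ^ j * (4 * |c * X ω| ^ n) := by
        gcongr; exact norm_exp_I_mul_sub_sum_le _ _
    _ = _ := by rw [abs_mul]; ring

theorem norm_char_le_one (X : Ω → ℝ) (c : ℝ) : ‖charMoment P X 0 c‖ ≤ 1 := by
  refine (norm_integral_le_integral_norm _).trans ?_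
  simp [Complex.norm_exp_I_mul_ofReal, -Complex.ofReal_mul]

theorem norm_char_sub_one_le (hX : IsStandardized P X K) (c : ℝ) :
    ‖charMoment P X 0 c - 1‖ ≤ 4 * c ^ 2 := by
  have h := hX.norm_charMoment_sub_le (j := 0) (n := 2) (by norm_num) c
  simpa [Finset.sum_range_succ, hX.mean_zero, hX.var_one] using h

theorem norm_char_sub_two_le (hX : IsStandardized P X K) (c : ℝ) :
    ‖charMoment P X 0 c - (1 - c ^ 2 / 2)‖ ≤ 4 * K * |c| ^ 3 := by
  have h := hX.norm_charMoment_sub_le (j := 0) (n := 3) (by norm_num) c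
  have h3 := hX.moment_three
  have h0 : 0 ≤ |c| ^ 3 := by positivity
  have e : ∑ m ∈ Finset.range 3, (Complex.I * c) ^ m / (m.factorial : ℂ) *
      ((∫ ω, X ω ^ (m + 0) ∂P : ℝ) : ℂ) = 1 - c ^ 2 / 2 := by
    simp [Finset.sum_range_succ, hX.mean_zero, hX.var_one, mul_pow, Nat.factorial]
    ring
  rw [e] at h
  refine h.trans ?_
  simp only [add_zero]
  nlinarith

theorem norm_char_sub_three_le (hX : IsStandardized P X K) (c : ℝ) :
    ‖charMoment P X 0 c - (1 - c ^ 2 / 2 - Complex.I * ((∫ ω, X ω ^ 3 ∂P : ℝ) : ℂ) * c ^ 3 / 6)‖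
      ≤ 4 * K * c ^ 4 := by
  have h := hX.norm_charMoment_sub_le (j := 0) (n := 4) (by norm_num) c
  have h3 := hX.moment_four
  have h0 : 0 ≤ |c| ^ 4 := by positivity
  have e : ∑ m ∈ Finset.range 4, (Complex.I * c) ^ m / (m.factorial : ℂ) *
      ((∫ ω, X ω ^ (m + 0) ∂P : ℝ) : ℂ) =
      1 - c ^ 2 / 2 - Complex.I * ((∫ ω, X ω ^ 3 ∂P : ℝ) : ℂ) * c ^ 3 / 6 := by
    simp [Finset.sum_range_succ, hX.mean_zero, hX.var_one, mul_pow, Nat.factorial]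
    ring
  rw [e] at h
  refine h.trans ?_
  have : |c| ^ 4 = c ^ 4 := by rw [← abs_pow, abs_of_nonneg (by positivity)]
  rw [this] at h0 ⊢
  simp only [add_zero]
  nlinarith

theorem norm_charMoment_one_le (hX : IsStandardized P X K) (c : ℝ) :
    ‖charMoment P X 1 c‖ ≤ 4 * |c| := by
  have h := hX.norm_charMoment_sub_le (j := 1) (n := 1) (by norm_num) c
  simpa [hX.mean_zero, hX.var_one] using h

theorem norm_charMoment_one_sub_le (hX : IsStandardized P X K) (c : ℝ) :
    ‖charMoment P X 1 c - (Complex.I * c - ((∫ ω, X ω ^ 3 ∂P : ℝ) : ℂ) * c ^ 2 / 2)‖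
      ≤ 4 * K * |c| ^ 3 := by
  have h := hX.norm_charMoment_sub_le (j := 1) (n := 3) (by norm_num) c
  have h3 := hX.moment_four
  have h0 : 0 ≤ |c| ^ 3 := by positivity
  have e : ∑ m ∈ Finset.range 3, (Complex.I * c) ^ m / (m.factorial : ℂ) *
      ((∫ ω, X ω ^ (m + 1) ∂P : ℝ) : ℂ) =
      Complex.I * c - ((∫ ω, X ω ^ 3 ∂P : ℝ) : ℂ) * c ^ 2 / 2 := by
    simp [Finset.sum_range_succ, hX.mean_zero, hX.var_one, mul_pow, Nat.factorial]
    ring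
  rw [e] at h
  refine h.trans ?_
  norm_num
  nlinarith

theorem norm_charMoment_two_sub_le (hX : IsStandardized P X K) (c : ℝ) :
    ‖charMoment P X 2 c - (1 + Complex.I * ((∫ ω, X ω ^ 3 ∂P : ℝ) : ℂ) * c)‖ ≤ 4 * K * c ^ 2 := by
  have h := hX.norm_charMoment_sub_le (j := 2) (n := 2) (by norm_num) c
  have h3 := hX.moment_four
  have h0 : 0 ≤ |c| ^ 2 := by positivity
  have e : ∑ m ∈ Finset.range 2, (Complex.I * c) ^ m / (m.factorial : ℂ) *
      ((∫ ω, X ω ^ (m + 2) ∂P : ℝ) : ℂ) = 1 + Complex.I * ((∫ ω, X ω ^ 3 ∂P : ℝ) : ℂ) * c := by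
    simp [Finset.sum_range_succ, hX.var_one]
    ring
  rw [e] at h
  refine h.trans ?_
  norm_num [sq_abs] at *
  nlinarith

/-- Decay of the characteristic function near the origin. -/
theorem norm_char_le_exp (hX : IsStandardized P X K) {c : ℝ} (hc : 16 * K * |c| ≤ 1) :
    ‖charMoment P X 0 c‖ ≤ Real.exp (-(c ^ 2 / 4)) := by
  have h1 := hX.norm_char_sub_two_le c
  have hK := hX.one_le
  have hc0 := abs_nonneg c
  have hc1 : |c| ≤ 1 := by nlinarith
  have hsq : |c| ^ 2 = c ^ 2 := sq_abs c
  have h2 : ‖(1 - c ^ 2 / 2 : ℂ)‖ = 1 - c ^ 2 / 2 := by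
    rw [show (1 - c ^ 2 / 2 : ℂ) = ((1 - c ^ 2 / 2 : ℝ) : ℂ) by push_cast; ring,
      Complex.norm_real, Real.norm_of_nonneg (by nlinarith)]
  have h3 := norm_sub_norm_le (charMoment P X 0 c) (1 - c ^ 2 / 2)
  have h4 : 4 * K * |c| ^ 3 ≤ c ^ 2 / 4 := by
    have : 4 * K * |c| ^ 3 = (16 * K * |c|) * (|c| ^ 2) / 4 := by ring
    rw [this, hsq]
    nlinarith [sq_nonneg c]
  have h5 := Real.add_one_le_exp (-(c ^ 2 / 4))
  linarith

/-- The characteristic function is close to `exp (-c² / 2 - i m c³ / 6)`. -/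
theorem norm_char_sub_exp_le (hX : IsStandardized P X K) {c : ℝ} (hc : 8 * K * c ^ 2 ≤ 1) :
    ‖charMoment P X 0 c - Complex.exp (((-(c ^ 2 / 2) : ℝ) : ℂ) +
      Complex.I * ((-((∫ ω, X ω ^ 3 ∂P) * c ^ 3 / 6) : ℝ) : ℂ))‖ ≤ 5 * K ^ 2 * c ^ 4 := by
  have h1 := hX.norm_char_sub_three_le c
  have hm := hX.abs_third_moment_le
  set m := ∫ ω, X ω ^ 3 ∂P
  have hK := hX.one_le
  have hc1 : |c| ≤ 1 := abs_le_one_iff_mul_self_le_one.2 (by nlinarith)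
  have hsq : |c| ^ 2 = c ^ 2 := sq_abs c
  have hη : ‖((-(c ^ 2 / 2) : ℝ) : ℂ) + Complex.I * ((-(m * c ^ 3 / 6) : ℝ) : ℂ)‖ ≤ K * c ^ 2 := by
    refine (norm_add_le _ _).trans ?_
    rw [norm_mul, Complex.norm_I, one_mul, Complex.norm_real, Complex.norm_real, norm_neg, norm_neg,
      Real.norm_eq_abs, Real.norm_eq_abs, abs_div, abs_div, abs_mul, abs_pow, abs_pow, hsq]
    norm_num
    have : |m| * |c| ^ 3 ≤ K * c ^ 2 := by
      rw [← hsq]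
      have : |c| ^ 3 ≤ |c| ^ 2 := pow_le_pow_of_le_one (abs_nonneg _) hc1 (by norm_num)
      gcongr
    nlinarith [sq_nonneg c]
  have h2 := Complex.norm_exp_sub_one_sub_id_le (hη.trans (by nlinarith))
  have h3 : ‖((-(c ^ 2 / 2) : ℝ) : ℂ) + Complex.I * ((-(m * c ^ 3 / 6) : ℝ) : ℂ)‖ ^ 2
      ≤ (K * c ^ 2) ^ 2 := by gcongr
  set η : ℂ := ((-(c ^ 2 / 2) : ℝ) : ℂ) + Complex.I * ((-(m * c ^ 3 / 6) : ℝ) : ℂ) with hηdef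
  have e : charMoment P X 0 c - Complex.exp η =
      (charMoment P X 0 c - (1 - c ^ 2 / 2 - Complex.I * (m : ℂ) * c ^ 3 / 6)) -
        (Complex.exp η - 1 - η) := by
    rw [hηdef]; push_cast; ring
  rw [e]
  refine (norm_sub_le _ _).trans ((add_le_add h1 (h2.trans h3)).trans ?_)
  have : 0 ≤ c ^ 4 := by positivity
  nlinarith [mul_nonneg this (sub_nonneg.2 hK), mul_nonneg (mul_nonneg this (sub_nonneg.2 hK)) (zero_le_one.trans hK)]

/-- Since `K ≥ 1`, the condition gives `|φ(c) - 1| ≤ 4c² ≤ 1/2`, so dividing by `φ(c)` costs at most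
a factor `2`. -/
theorem half_le_norm_char (hX : IsStandardized P X K) {c : ℝ} (hc : 8 * K * c ^ 2 ≤ 1) :
    1 / 2 ≤ ‖charMoment P X 0 c‖ := by
  have h1 := hX.norm_char_sub_one_le c
  have h2 := norm_sub_norm_le (1 : ℂ) (charMoment P X 0 c)
  rw [norm_sub_rev, norm_one] at h2
  have hK := hX.one_le
  nlinarith [sq_nonneg c]

theorem char_ne_zero (hX : IsStandardized P X K) {c : ℝ} (hc : 8 * K * c ^ 2 ≤ 1) :
    charMoment P X 0 c ≠ 0 := by
  have := hX.half_le_norm_char hc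
  exact norm_pos_iff.1 (by linarith)

theorem norm_div_char_le (hX : IsStandardized P X K) {c : ℝ} (hc : 8 * K * c ^ 2 ≤ 1) (z : ℂ) :
    ‖z / charMoment P X 0 c‖ ≤ 2 * ‖z‖ := by
  have := hX.half_le_norm_char hc
  rw [norm_div, div_le_iff₀ (by linarith)]
  nlinarith [norm_nonneg z]

theorem norm_ratio_one_le (hX : IsStandardized P X K) {c : ℝ} (hc : 8 * K * c ^ 2 ≤ 1) :
    ‖charMoment P X 1 c / charMoment P X 0 c‖ ≤ 8 * |c| := by
  have := hX.norm_div_char_le hc (charMoment P X 1 c)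
  have := hX.norm_charMoment_one_le c
  linarith

/-- The quotient is `-i (log φ)'(c)`, the mean under the tilt by `exp(icX)`; this is its cumulant
expansion. The third moment contributes a real term to an otherwise imaginary leading part, which
matters for the later cancellation. -/
theorem norm_ratio_one_sub_le (hX : IsStandardized P X K) {c : ℝ} (hc : 8 * K * c ^ 2 ≤ 1) :
    ‖charMoment P X 1 c / charMoment P X 0 c -
      (Complex.I * c - ((∫ ω, X ω ^ 3 ∂P : ℝ) : ℂ) * c ^ 2 / 2)‖ ≤ 20 * K * |c| ^ 3 := by
  have h1 := hX.norm_charMoment_one_sub_le c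
  have h2 := hX.norm_char_sub_one_le c
  have hm := hX.abs_third_moment_le
  set m := ∫ ω, X ω ^ 3 ∂P
  have hK := hX.one_le
  have hc1 : |c| ≤ 1 := abs_le_one_iff_mul_self_le_one.2 (by nlinarith)
  have hc0 := abs_nonneg c
  have hsq : |c| ^ 2 = c ^ 2 := sq_abs c
  set z : ℂ := Complex.I * c - (m : ℂ) * c ^ 2 / 2
  have hz : ‖z‖ ≤ |c| + K / 2 * |c| ^ 2 := by
    refine (norm_sub_le _ _).trans ?_
    simp only [norm_mul, Complex.norm_I, one_mul, Complex.norm_real, Real.norm_eq_abs, norm_div,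
      norm_pow, Complex.norm_ofNat]
    have := mul_le_mul_of_nonneg_right hm (sq_nonneg |c|)
    linarith
  have e : charMoment P X 1 c / charMoment P X 0 c - z =
      ((charMoment P X 1 c - z) - z * (charMoment P X 0 c - 1)) / charMoment P X 0 c := by
    have := hX.char_ne_zero hc
    field_simp
    ring
  rw [e]
  refine (hX.norm_div_char_le hc _).trans ?_
  have h3 : ‖(charMoment P X 1 c - z) - z * (charMoment P X 0 c - 1)‖ ≤
      4 * K * |c| ^ 3 + (|c| + K / 2 * |c| ^ 2) * (4 * c ^ 2) := by
    refine (norm_sub_le _ _).trans ?_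
    rw [norm_mul]
    gcongr
  rw [← hsq] at h3
  have h4 : |c| ^ 4 ≤ |c| ^ 3 := pow_le_pow_of_le_one hc0 hc1 (by norm_num)
  have h5 : 0 ≤ |c| ^ 3 := by positivity
  nlinarith [mul_nonneg (sub_nonneg.2 hK) h5, mul_nonneg (sub_nonneg.2 h4) (zero_le_one.trans hK)]

/-- The left side is `-(log φ)''(c)`, the variance under the same tilt; here the third moment
contributes an imaginary term. -/
theorem norm_ratio_two_sub_le (hX : IsStandardized P X K) {c : ℝ} (hc : 8 * K * c ^ 2 ≤ 1) :
    ‖charMoment P X 2 c / charMoment P X 0 c - (charMoment P X 1 c / charMoment P X 0 c) ^ 2 -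
      (1 + Complex.I * ((∫ ω, X ω ^ 3 ∂P : ℝ) : ℂ) * c)‖ ≤ 88 * K * c ^ 2 := by
  have h1 := hX.norm_charMoment_two_sub_le c
  have h2 := hX.norm_char_sub_one_le c
  have h6 := hX.norm_ratio_one_le hc
  have hm := hX.abs_third_moment_le
  set m := ∫ ω, X ω ^ 3 ∂P
  have hK := hX.one_le
  have hc1 : |c| ≤ 1 := abs_le_one_iff_mul_self_le_one.2 (by nlinarith)
  have hc0 := abs_nonneg c
  have hsq : |c| ^ 2 = c ^ 2 := sq_abs c
  set z : ℂ := 1 + Complex.I * (m : ℂ) * c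
  have hz : ‖z‖ ≤ 1 + K := by
    refine (norm_add_le _ _).trans ?_
    simp only [norm_mul, Complex.norm_I, one_mul, Complex.norm_real, Real.norm_eq_abs, norm_one]
    have := mul_le_mul hm hc1 hc0 (zero_le_one.trans hK)
    linarith
  have e : charMoment P X 2 c / charMoment P X 0 c - (charMoment P X 1 c / charMoment P X 0 c) ^ 2
      - z = ((charMoment P X 2 c - z) - z * (charMoment P X 0 c - 1)) / charMoment P X 0 c -
        (charMoment P X 1 c / charMoment P X 0 c) ^ 2 := by
    have := hX.char_ne_zero hc
    field_simp
    ring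
  rw [e]
  refine (norm_sub_le _ _).trans ?_
  have h3 : ‖(charMoment P X 2 c - z) - z * (charMoment P X 0 c - 1)‖ ≤
      4 * K * c ^ 2 + (1 + K) * (4 * c ^ 2) := by
    refine (norm_sub_le _ _).trans ?_
    rw [norm_mul]
    gcongr
  have h4 := hX.norm_div_char_le hc ((charMoment P X 2 c - z) - z * (charMoment P X 0 c - 1))
  have h5 : ‖(charMoment P X 1 c / charMoment P X 0 c) ^ 2‖ ≤ 64 * c ^ 2 := by
    rw [norm_pow, ← hsq]
    calc _ ≤ (8 * |c|) ^ 2 := by gcongr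
      _ = _ := by ring
  nlinarith [mul_nonneg (sub_nonneg.2 hK) (sq_nonneg c)]

end IsStandardized

/-! ### Linear forms in independent variables under an exponential tilt. -/

section IndependentFamily

variable {Ω U : Type*} [MeasurableSpace Ω] {P : Measure Ω} [IsProbabilityMeasure P]
  {ε : U → Ω → ℝ} {K : ℝ}

theorem integrable_mul (hε : ∀ u, IsStandardized P (ε u) K) (u v : U) :
    Integrable (fun ω => ε u ω * ε v ω) P := by
  have h : ∀ u, MemLp (ε u) 2 P := fun u => (hε u).memLp.mono_exponent (by norm_num)
  exact (h u).integrable_mul (h v)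

variable [Fintype U]

theorem integral_prod_pow_mul_exp (hm : ∀ u, Measurable (ε u)) (hind : iIndepFun ε P) (n : U → ℕ)
    (c : U → ℝ) :
    ∫ ω, (∏ u, (ε u ω : ℂ) ^ n u) * Complex.exp (Complex.I * ((∑ u, c u * ε u ω : ℝ) : ℂ)) ∂P =
      ∏ u, charMoment P (ε u) (n u) (c u) := by
  have h := hind.integral_fun_prod_comp (fun u => (hm u).aemeasurable)
    (f := fun u (x : ℝ) => (x : ℂ) ^ n u * Complex.exp (Complex.I * ((c u * x : ℝ) : ℂ)))
    (fun u => by fun_prop)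
  rw [show ∏ u, charMoment P (ε u) (n u) (c u) = _ from h.symm]
  congr 1
  ext ω
  rw [Finset.prod_mul_distrib, ← Complex.exp_sum, Complex.ofReal_sum, Finset.mul_sum]

theorem norm_integral_exp_eq (hm : ∀ u, Measurable (ε u)) (hind : iIndepFun ε P) (c : U → ℝ) :
    ‖∫ ω, Complex.exp (Complex.I * ((∑ u, c u * ε u ω : ℝ) : ℂ)) ∂P‖ =
      ∏ u, ‖charMoment P (ε u) 0 (c u)‖ := by
  have h := integral_prod_pow_mul_exp hm hind (fun _ => 0) c
  simp only [pow_zero, Finset.prod_const_one, one_mul] at h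
  rw [h, norm_prod]

theorem integral_mul_mul_exp [DecidableEq U] (hε : ∀ u, IsStandardized P (ε u) K)
    (hind : iIndepFun ε P) (c : U → ℝ) (hc : ∀ u, charMoment P (ε u) 0 (c u) ≠ 0) (u v : U) :
    ∫ ω, (ε u ω : ℂ) * ε v ω * Complex.exp (Complex.I * ((∑ u, c u * ε u ω : ℝ) : ℂ)) ∂P =
      (∏ u, charMoment P (ε u) 0 (c u)) * if u = v then
        charMoment P (ε u) 2 (c u) / charMoment P (ε u) 0 (c u) else
        charMoment P (ε u) 1 (c u) / charMoment P (ε u) 0 (c u) *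
          (charMoment P (ε v) 1 (c v) / charMoment P (ε v) 0 (c v)) := by
  -- The exponents `1_{w=u} + 1_{w=v}` treat `u = v` and `u ≠ v` at once.
  have h := integral_prod_pow_mul_exp (fun u => (hε u).measurable) hind
    (fun w => (if w = u then 1 else 0) + if w = v then 1 else 0) c
  have h1 : ∀ ω, ∏ w, (ε w ω : ℂ) ^ ((if w = u then 1 else 0) + if w = v then 1 else 0) =
      ε u ω * ε v ω := by
    intro ω
    simp only [pow_add, Finset.prod_mul_distrib, pow_ite, pow_one, pow_zero, Finset.prod_ite_eq',
      Finset.mem_univ, if_true]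
  simp only [h1] at h
  rw [h]
  have h2 : ∀ w, charMoment P (ε w) ((if w = u then 1 else 0) + if w = v then 1 else 0) (c w) =
      charMoment P (ε w) 0 (c w) *
        (charMoment P (ε w) ((if w = u then 1 else 0) + if w = v then 1 else 0) (c w) /
          charMoment P (ε w) 0 (c w)) := fun w => by rw [mul_div_cancel₀ _ (hc w)]
  rw [Finset.prod_congr rfl fun w _ => h2 w, Finset.prod_mul_distrib]
  congr 1
  split_ifs with huv
  · subst huv
    rw [Finset.prod_eq_single u]
    · simp
    · intro w _ hw
      simp [hw, hc w]
    · simp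
  · rw [Finset.prod_eq_mul u v huv]
    · simp [huv, Ne.symm huv]
    · intro w _ hw
      simp [hw.1, hw.2, hc w]
    · simp
    · simp

/-- Under the tilt the variables remain formally independent, so the second moment of two linear
forms is a diagonal covariance plus the product of the tilted means. The tilt has total mass `∏
φ_u(c_u)`, which must not vanish. -/
theorem integral_linear_mul_linear_mul_exp (hε : ∀ u, IsStandardized P (ε u) K)
    (hind : iIndepFun ε P) (w w' c : U → ℝ) (hc : ∀ u, charMoment P (ε u) 0 (c u) ≠ 0) :
    ∫ ω, (((∑ u, w u * ε u ω) * ∑ u, w' u * ε u ω : ℝ) : ℂ) *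
        Complex.exp (Complex.I * ((∑ u, c u * ε u ω : ℝ) : ℂ)) ∂P =
      (∏ u, charMoment P (ε u) 0 (c u)) *
        (∑ u, (w u * w' u : ℂ) * (charMoment P (ε u) 2 (c u) / charMoment P (ε u) 0 (c u) -
            (charMoment P (ε u) 1 (c u) / charMoment P (ε u) 0 (c u)) ^ 2) +
          (∑ u, w u * (charMoment P (ε u) 1 (c u) / charMoment P (ε u) 0 (c u))) *
            ∑ u, w' u * (charMoment P (ε u) 1 (c u) / charMoment P (ε u) 0 (c u))) := by
  classical
  have hm := fun u => (hε u).measurable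
  have hint : ∀ u v, Integrable (fun ω => (w u * w' v : ℂ) * ((ε u ω : ℂ) * ε v ω *
      Complex.exp (Complex.I * ((∑ u, c u * ε u ω : ℝ) : ℂ)))) P := by
    intro u v
    refine Integrable.const_mul ((integrable_mul hε u v).abs.mono' ?_ (ae_of_all _ fun ω => ?_)) _
    · have := hm u
      have := hm v
      fun_prop
    · rw [norm_mul, Complex.norm_exp_I_mul_ofReal]
      simp
  have h1 : ∀ ω, (((∑ u, w u * ε u ω) * ∑ u, w' u * ε u ω : ℝ) : ℂ) *
        Complex.exp (Complex.I * ((∑ u, c u * ε u ω : ℝ) : ℂ)) = ∑ u, ∑ v, (w u * w' v : ℂ) *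
          ((ε u ω : ℂ) * ε v ω * Complex.exp (Complex.I * ((∑ u, c u * ε u ω : ℝ) : ℂ))) := by
    intro ω
    generalize Complex.exp (Complex.I * ((∑ u, c u * ε u ω : ℝ) : ℂ)) = z
    push_cast
    rw [Finset.sum_mul_sum, Finset.sum_mul]
    refine Finset.sum_congr rfl fun u _ => ?_
    rw [Finset.sum_mul]
    exact Finset.sum_congr rfl fun v _ => by ring
  simp only [h1]
  rw [integral_finsetSum _ fun u _ => integrable_finsetSum _ fun v _ => hint u v]
  simp only [integral_finsetSum _ fun v _ => hint _ v, integral_const_mul,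
    integral_mul_mul_exp hε hind c hc]
  rw [Finset.sum_mul_sum, ← Finset.sum_add_distrib, Finset.mul_sum]
  refine Finset.sum_congr rfl fun u _ => ?_
  have h2 : ∀ v, (w u * w' v : ℂ) * ((∏ u, charMoment P (ε u) 0 (c u)) * if u = v then
        charMoment P (ε u) 2 (c u) / charMoment P (ε u) 0 (c u) else
        charMoment P (ε u) 1 (c u) / charMoment P (ε u) 0 (c u) *
          (charMoment P (ε v) 1 (c v) / charMoment P (ε v) 0 (c v))) =
      (∏ u, charMoment P (ε u) 0 (c u)) * ((if u = v then (w u * w' u : ℂ) *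
        (charMoment P (ε u) 2 (c u) / charMoment P (ε u) 0 (c u) -
            (charMoment P (ε u) 1 (c u) / charMoment P (ε u) 0 (c u)) ^ 2) else 0) +
        w u * (charMoment P (ε u) 1 (c u) / charMoment P (ε u) 0 (c u)) *
          (w' v * (charMoment P (ε v) 1 (c v) / charMoment P (ε v) 0 (c v)))) := by
    intro v
    split_ifs with huv
    · subst huv; ring
    · ring
  rw [Finset.sum_congr rfl fun v _ => h2 v, ← Finset.mul_sum, Finset.sum_add_distrib,
    Finset.sum_ite_eq]
  simp

theorem integral_linear_mul_linear (hε : ∀ u, IsStandardized P (ε u) K) (hind : iIndepFun ε P)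
    (w w' : U → ℝ) :
    ∫ ω, (∑ u, w u * ε u ω) * ∑ u, w' u * ε u ω ∂P = ∑ u, w u * w' u := by
  have h0 : ∀ u, charMoment P (ε u) 0 0 = 1 := by intro u; simp [charMoment]
  have h1 : ∀ u, charMoment P (ε u) 1 0 = 0 := by
    intro u
    simp [charMoment, integral_complex_ofReal, (hε u).mean_zero]
  have h2 : ∀ u, charMoment P (ε u) 2 0 = 1 := by
    intro u
    have := (hε u).var_one
    simp only [charMoment, zero_mul, Complex.ofReal_zero, mul_zero, Complex.exp_zero, mul_one,
      ← Complex.ofReal_pow, integral_complex_ofReal, this, Complex.ofReal_one]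
  have h := integral_linear_mul_linear_mul_exp hε hind w w' (fun _ => 0) (by simp [h0])
  simp only [h0, h1, h2, zero_mul, Finset.sum_const_zero, Complex.ofReal_zero, mul_zero,
    Complex.exp_zero, mul_one, integral_complex_ofReal] at h
  simp only [Finset.prod_const_one, one_mul, div_one, ne_eq, OfNat.ofNat_ne_zero,
    not_false_eq_true, zero_pow, sub_zero, mul_one, mul_zero, Finset.sum_const_zero, add_zero] at h
  exact_mod_cast h

theorem memLp_two_linear (hε : ∀ u, IsStandardized P (ε u) K) (w : U → ℝ) :
    MemLp (fun ω => ∑ u, w u * ε u ω) 2 P :=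
  memLp_finsetSum _ fun u _ => ((hε u).memLp.mono_exponent (by norm_num)).const_mul _

theorem integral_abs_linear_mul_linear_le (hε : ∀ u, IsStandardized P (ε u) K)
    (hind : iIndepFun ε P) (w w' : U → ℝ) :
    ∫ ω, |(∑ u, w u * ε u ω) * ∑ u, w' u * ε u ω| ∂P ≤ (∑ u, w u ^ 2 + ∑ u, w' u ^ 2) / 2 := by
  have h1 := integral_linear_mul_linear hε hind w w
  have h2 := integral_linear_mul_linear hε hind w' w'
  have i1 : Integrable (fun ω => (∑ u, w u * ε u ω) * ∑ u, w u * ε u ω) P :=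
    (memLp_two_linear hε w).integrable_mul (memLp_two_linear hε w)
  have i2 : Integrable (fun ω => (∑ u, w' u * ε u ω) * ∑ u, w' u * ε u ω) P :=
    (memLp_two_linear hε w').integrable_mul (memLp_two_linear hε w')
  have i3 : Integrable (fun ω => (∑ u, w u * ε u ω) * ∑ u, w' u * ε u ω) P :=
    (memLp_two_linear hε w).integrable_mul (memLp_two_linear hε w')
  simp only [pow_two, ← h1, ← h2]
  rw [← integral_add i1 i2, ← integral_div]
  refine integral_mono i3.abs ((i1.add i2).div_const 2) fun ω => ?_
  simp only [abs_mul]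
  generalize ∑ u, w u * ε u ω = x
  generalize ∑ u, w' u * ε u ω = y
  nlinarith [sq_nonneg (|x| - |y|), sq_abs x, sq_abs y]

end IndependentFamily

/-! ### Gaussian approximation with a second-order error. -/

/-- If `Φ` is close to a Gaussian times a small phase and `S + L L'` is close to
`g - p p'` up to a small imaginary part, then the real part of the product is close to
`(g - p p') exp (-q)` to second order. -/
theorem abs_re_mul_sub_le {Φ S L L' : ℂ} {R μ g y p p' k k' q r : ℝ} (hR : 1 ≤ R) (hμ : 0 ≤ μ)
    (hμ1 : μ ≤ 1) (hq : 0 ≤ q) (hΦ : ‖Φ‖ ≤ 1)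
    (hE : ‖Φ - Complex.exp (((-q : ℝ) : ℂ) + Complex.I * ((-r : ℝ) : ℂ))‖ ≤ 5 * R ^ 4 * μ ^ 2)
    (hS : ‖S - (g + Complex.I * y)‖ ≤ 88 * R ^ 3 * μ ^ 2)
    (hL : ‖L - (Complex.I * p - k / 2)‖ ≤ 20 * R ^ 3 * μ ^ 2)
    (hL' : ‖L' - (Complex.I * p' - k' / 2)‖ ≤ 20 * R ^ 3 * μ ^ 2) (hL'R : ‖L'‖ ≤ 8 * R ^ 2)
    (hg : |g| ≤ R ^ 2) (hp : |p| ≤ R ^ 2) (hp' : |p'| ≤ R ^ 2) (hk : |k| ≤ R ^ 3 * μ)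
    (hk' : |k'| ≤ R ^ 3 * μ) (hy : |y| ≤ R ^ 3 * μ) (hr : |r| ≤ R ^ 3 * μ) :
    |(Φ * (S + L * L')).re - (g - p * p') * Real.exp (-q)| ≤ 400 * R ^ 10 * μ ^ 2 := by
  have hR0 : 0 ≤ R := zero_le_one.trans hR
  have hpow : ∀ {m n : ℕ}, m ≤ n → R ^ m ≤ R ^ n := fun h => pow_le_pow_right₀ hR h
  set l : ℂ := Complex.I * p - k / 2 with hl
  set l' : ℂ := Complex.I * p' - k' / 2 with hl'
  -- All terms of first order in `μ` in `S + L L'` are collected in `Y`, and they carry the factor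
  -- `i`; the only other correction, `k k' / 4`, is already of order `μ²`.
  set Y : ℝ := y - (p * k' + p' * k) / 2 with hY
  set X : ℝ := g - p * p' with hX
  set E : ℂ := Complex.exp (((-q : ℝ) : ℂ) + Complex.I * ((-r : ℝ) : ℂ)) with hEdef
  have hlR : ‖l‖ ≤ 3 / 2 * R ^ 3 := by
    refine (norm_sub_le _ _).trans ?_
    simp only [norm_mul, Complex.norm_I, one_mul, Complex.norm_real, Real.norm_eq_abs, norm_div,
      Complex.norm_ofNat]
    have h1 : R ^ 3 * μ ≤ R ^ 3 := mul_le_of_le_one_right (by positivity) hμ1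
    have h2 := hpow (show 2 ≤ 3 by norm_num)
    linarith
  have hXR : |X| ≤ 2 * R ^ 4 := by
    have h1 : |p * p'| ≤ R ^ 2 * R ^ 2 := by rw [abs_mul]; gcongr
    have h2 := abs_sub g (p * p')
    have h3 := hpow (show 2 ≤ 4 by norm_num)
    calc |X| ≤ |g| + |p * p'| := h2
      _ ≤ R ^ 4 + R ^ 2 * R ^ 2 := by linarith
      _ = 2 * R ^ 4 := by ring
  have hYR : |Y| ≤ 2 * R ^ 5 * μ := by
    have h1 : |p * k'| ≤ R ^ 2 * (R ^ 3 * μ) := by rw [abs_mul]; gcongr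
    have h2 : |p' * k| ≤ R ^ 2 * (R ^ 3 * μ) := by rw [abs_mul]; gcongr
    have h3 : R ^ 3 * μ ≤ R ^ 5 * μ := by gcongr; norm_num
    have h4 := abs_sub y ((p * k' + p' * k) / 2)
    have h5 : |(p * k' + p' * k) / 2| ≤ (|p * k'| + |p' * k|) / 2 := by
      rw [abs_div, abs_two]; gcongr; exact abs_add_le _ _
    calc |Y| ≤ |y| + |(p * k' + p' * k) / 2| := h4
      _ ≤ R ^ 5 * μ + R ^ 2 * (R ^ 3 * μ) := by linarith
      _ = _ := by ring
  have hT : ‖((X : ℂ) + Complex.I * Y)‖ ≤ 4 * R ^ 5 := by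
    refine (norm_add_le _ _).trans ?_
    simp only [norm_mul, Complex.norm_I, one_mul, Complex.norm_real, Real.norm_eq_abs]
    have h1 : R ^ 5 * μ ≤ R ^ 5 := mul_le_of_le_one_right (by positivity) hμ1
    have h2 := hpow (show 4 ≤ 5 by norm_num)
    linarith
  have h1 : ‖S + L * L' - (X + Complex.I * Y)‖ ≤ 279 * R ^ 6 * μ ^ 2 := by
    have e : S + L * L' - (X + Complex.I * Y) =
        (S - (g + Complex.I * y)) + (L - l) * L' + l * (L' - l') + (k * k' / 4 : ℝ) := by
      have hI := Complex.I_mul_I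
      rw [hX, hY, hl, hl']
      push_cast
      linear_combination (p : ℂ) * p' * hI
    rw [e]
    have h2 : ‖((k * k' / 4 : ℝ) : ℂ)‖ ≤ R ^ 6 * μ ^ 2 / 4 := by
      rw [Complex.norm_real, Real.norm_eq_abs, abs_div, abs_mul]
      norm_num
      have : |k| * |k'| ≤ (R ^ 3 * μ) * (R ^ 3 * μ) := by gcongr
      calc _ ≤ (R ^ 3 * μ) * (R ^ 3 * μ) / 4 := by gcongr
        _ = _ := by ring
    have h3 : ‖(L - l) * L'‖ ≤ 20 * R ^ 3 * μ ^ 2 * (8 * R ^ 2) := by rw [norm_mul]; gcongr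
    have h4 : ‖l * (L' - l')‖ ≤ 3 / 2 * R ^ 3 * (20 * R ^ 3 * μ ^ 2) := by rw [norm_mul]; gcongr
    have h5 : R ^ 3 * μ ^ 2 ≤ R ^ 6 * μ ^ 2 := by gcongr; norm_num
    have h6 : R ^ 5 * μ ^ 2 ≤ R ^ 6 * μ ^ 2 := by gcongr; norm_num
    calc _ ≤ ‖S - (g + Complex.I * y)‖ + ‖(L - l) * L'‖ + ‖l * (L' - l')‖ +
          ‖((k * k' / 4 : ℝ) : ℂ)‖ := norm_add₄_le
      _ ≤ 88 * (R ^ 3 * μ ^ 2) + 160 * (R ^ 5 * μ ^ 2) + 30 * (R ^ 6 * μ ^ 2) +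
          (R ^ 6 * μ ^ 2) / 4 := by linarith
      _ ≤ _ := by have : 0 ≤ R ^ 6 * μ ^ 2 := by positivity
                  linarith
  have h2 : ‖Φ * (S + L * L') - E * (X + Complex.I * Y)‖ ≤ 299 * R ^ 9 * μ ^ 2 := by
    have e : Φ * (S + L * L') - E * (X + Complex.I * Y) =
        Φ * (S + L * L' - (X + Complex.I * Y)) + (Φ - E) * (X + Complex.I * Y) := by ring
    rw [e]
    refine (norm_add_le _ _).trans ?_
    rw [norm_mul, norm_mul]
    have h5 : R ^ 6 * μ ^ 2 ≤ R ^ 9 * μ ^ 2 := by gcongr; norm_num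
    calc _ ≤ 1 * (279 * R ^ 6 * μ ^ 2) + 5 * R ^ 4 * μ ^ 2 * (4 * R ^ 5) := by gcongr
      _ = 279 * (R ^ 6 * μ ^ 2) + 20 * (R ^ 9 * μ ^ 2) := by ring
      _ ≤ _ := by linarith
  -- Taking the real part produces the gain: `Y` meets `sin r`, and both factors are `O(μ)`, while
  -- `X` meets `cos r = 1 + O(μ²)`.
  have hre : (E * (X + Complex.I * Y)).re = Real.exp (-q) * (X * Real.cos r + Y * Real.sin r) := by
    rw [hEdef, Complex.exp_add, mul_comm Complex.I, Complex.exp_mul_I, ← Complex.ofReal_exp,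
      ← Complex.ofReal_cos, ← Complex.ofReal_sin]
    simp only [Complex.mul_re, Complex.mul_im, Complex.add_re, Complex.add_im, Complex.ofReal_re,
      Complex.ofReal_im, Complex.I_re, Complex.I_im, Real.cos_neg, Real.sin_neg]
    ring
  have h3 : |(Φ * (S + L * L')).re - (E * (X + Complex.I * Y)).re| ≤ 299 * R ^ 9 * μ ^ 2 := by
    rw [← Complex.sub_re]
    exact (Complex.abs_re_le_norm _).trans h2
  have hrR : r ^ 2 ≤ R ^ 6 * μ ^ 2 := by
    rw [← sq_abs]
    calc |r| ^ 2 ≤ (R ^ 3 * μ) ^ 2 := by gcongr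
      _ = _ := by ring
  have h4 : |(E * (X + Complex.I * Y)).re - X * Real.exp (-q)| ≤ 3 * R ^ 10 * μ ^ 2 := by
    rw [hre]
    have e : Real.exp (-q) * (X * Real.cos r + Y * Real.sin r) - X * Real.exp (-q) =
        Real.exp (-q) * (X * (Real.cos r - 1) + Y * Real.sin r) := by ring
    rw [e, abs_mul, abs_of_pos (Real.exp_pos _)]
    have hexp : Real.exp (-q) ≤ 1 := Real.exp_le_one_iff.2 (by linarith)
    have hc : |Real.cos r - 1| ≤ r ^ 2 / 2 := by
      rw [abs_le]
      constructor
      · linarith [Real.one_sub_sq_div_two_le_cos (x := r)]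
      · linarith [Real.cos_le_one r, sq_nonneg r]
    have hs : |Real.sin r| ≤ R ^ 3 * μ := Real.abs_sin_le_abs.trans hr
    have h5 : R ^ 8 * μ ^ 2 ≤ R ^ 10 * μ ^ 2 := by gcongr; norm_num
    calc _ ≤ 1 * (|X| * |Real.cos r - 1| + |Y| * |Real.sin r|) := by
          gcongr
          refine (abs_add_le _ _).trans ?_
          rw [abs_mul, abs_mul]
      _ ≤ 1 * (2 * R ^ 4 * (R ^ 6 * μ ^ 2 / 2) + 2 * R ^ 5 * μ * (R ^ 3 * μ)) := by
          gcongr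
          linarith
      _ = R ^ 10 * μ ^ 2 + 2 * (R ^ 8 * μ ^ 2) := by ring
      _ ≤ _ := by linarith
  have h5 : R ^ 9 * μ ^ 2 ≤ R ^ 10 * μ ^ 2 := by gcongr; norm_num
  have h6 : 0 ≤ R ^ 10 * μ ^ 2 := by positivity
  have h7 := abs_sub_le (Φ * (S + L * L')).re (E * (X + Complex.I * Y)).re (X * Real.exp (-q))
  linarith

theorem norm_prod_sub_prod_le {U : Type*} (s : Finset U) {f g : U → ℂ} (hf : ∀ u, ‖f u‖ ≤ 1)
    (hg : ∀ u, ‖g u‖ ≤ 1) : ‖∏ u ∈ s, f u - ∏ u ∈ s, g u‖ ≤ ∑ u ∈ s, ‖f u - g u‖ := by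
  classical
  induction s using Finset.induction_on with
  | empty => simp
  | insert a s ha ih =>
    rw [Finset.prod_insert ha, Finset.prod_insert ha, Finset.sum_insert ha]
    have e : f a * ∏ u ∈ s, f u - g a * ∏ u ∈ s, g u =
        (f a - g a) * ∏ u ∈ s, f u + g a * (∏ u ∈ s, f u - ∏ u ∈ s, g u) := by ring
    have h1 : ‖∏ u ∈ s, f u‖ ≤ 1 := by
      rw [norm_prod]
      exact Finset.prod_le_one (fun _ _ => norm_nonneg _) fun u _ => hf u
    rw [e]
    refine (norm_add_le _ _).trans ?_
    rw [norm_mul, norm_mul]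
    have h2 : ‖f a - g a‖ * ‖∏ u ∈ s, f u‖ ≤ ‖f a - g a‖ :=
      mul_le_of_le_one_right (norm_nonneg _) h1
    have h3 : ‖g a‖ * ‖∏ u ∈ s, f u - ∏ u ∈ s, g u‖ ≤ ‖∏ u ∈ s, f u - ∏ u ∈ s, g u‖ :=
      mul_le_of_le_one_left (norm_nonneg _) (hg a)
    linarith

theorem sum_abs_mul_abs_le {U : Type*} [Fintype U] {w c : U → ℝ} {A : ℝ} (hw : ∑ u, w u ^ 2 ≤ A)
    (hc : ∑ u, c u ^ 2 ≤ A) : ∑ u, |w u| * |c u| ≤ A := by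
  have h : ∑ u, |w u| * |c u| ≤ ∑ u, (w u ^ 2 + c u ^ 2) / 2 := by
    refine Finset.sum_le_sum fun u _ => ?_
    nlinarith [sq_nonneg (|w u| - |c u|), sq_abs (w u), sq_abs (c u)]
  rw [← Finset.sum_div, Finset.sum_add_distrib] at h
  linarith

theorem abs_sum_mul_le {U : Type*} [Fintype U] {w c : U → ℝ} {A : ℝ} (hw : ∑ u, w u ^ 2 ≤ A)
    (hc : ∑ u, c u ^ 2 ≤ A) : |∑ u, w u * c u| ≤ A := by
  refine (Finset.abs_sum_le_sum_abs _ _).trans ?_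
  simp only [abs_mul]
  exact sum_abs_mul_abs_le hw hc

section CosIntegral

variable {Ω U : Type*} [MeasurableSpace Ω] {P : Measure Ω} [IsProbabilityMeasure P] [Fintype U]
  {ε : U → Ω → ℝ} {K : ℝ}

theorem integral_linear_mul_linear_mul_cos (hε : ∀ u, IsStandardized P (ε u) K) (w w' c : U → ℝ) :
    ∫ ω, ((∑ u, w u * ε u ω) * ∑ u, w' u * ε u ω) * Real.cos (∑ u, c u * ε u ω) ∂P =
      (∫ ω, (((∑ u, w u * ε u ω) * ∑ u, w' u * ε u ω : ℝ) : ℂ) *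
        Complex.exp (Complex.I * ((∑ u, c u * ε u ω : ℝ) : ℂ)) ∂P).re := by
  have hm := fun u => (hε u).measurable
  have hi : Integrable (fun ω => (((∑ u, w u * ε u ω) * ∑ u, w' u * ε u ω : ℝ) : ℂ) *
        Complex.exp (Complex.I * ((∑ u, c u * ε u ω : ℝ) : ℂ))) P := by
    refine ((memLp_two_linear hε w).integrable_mul (memLp_two_linear hε w')).abs.mono'
      (by fun_prop) (ae_of_all _ fun ω => ?_)
    rw [norm_mul, Complex.norm_exp_I_mul_ofReal, Complex.norm_real, mul_one]
    rfl
  have h := Complex.reCLM.integral_comp_comm hi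
  simp only [Complex.reCLM_apply] at h
  rw [← h]
  congr 1
  ext ω
  rw [Complex.re_ofReal_mul, mul_comm Complex.I, Complex.exp_ofReal_mul_I_re]

/-- The Gaussian approximation of `E[x x' cos(c · ε)]` for linear forms `x`, `x'` in independent
standardized variables: the error is of second order in the size `μ` of the coefficients. -/
theorem abs_integral_mul_mul_cos_sub_le (hε : ∀ u, IsStandardized P (ε u) K)
    (hind : iIndepFun ε P) {w w' c : U → ℝ} {R μ : ℝ} (hR : 1 ≤ R) (hμ : 0 ≤ μ) (hK : K ≤ R)
    (hwμ : ∀ u, |w u| ≤ μ) (hw'μ : ∀ u, |w' u| ≤ μ) (hcμ : ∀ u, |c u| ≤ μ)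
    (hw : ∑ u, w u ^ 2 ≤ R ^ 2) (hw' : ∑ u, w' u ^ 2 ≤ R ^ 2) (hc : ∑ u, c u ^ 2 ≤ R ^ 2) :
    |∫ ω, ((∑ u, w u * ε u ω) * ∑ u, w' u * ε u ω) * Real.cos (∑ u, c u * ε u ω) ∂P -
      (∑ u, w u * w' u - (∑ u, w u * c u) * ∑ u, w' u * c u) * Real.exp (-((∑ u, c u ^ 2) / 2))|
      ≤ 400 * R ^ 10 * μ ^ 2 := by
  have hR0 : 0 ≤ R := zero_le_one.trans hR
  have hm := fun u => (hε u).measurable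
  have hg := abs_sum_mul_le hw hw'
  have hp := abs_sum_mul_le hw hc
  have hp' := abs_sum_mul_le hw' hc
  have hq : 0 ≤ (∑ u, c u ^ 2) / 2 := by positivity
  -- Small `μ` keeps every factor of the characteristic function away from zero. For large `μ` the
  -- right side already exceeds the trivial bounds on both terms.
  by_cases hsmall : 8 * R * μ ^ 2 ≤ 1
  · rw [integral_linear_mul_linear_mul_cos hε]
    have hμ1 : μ ≤ 1 := by nlinarith
    have hcu : ∀ u, 8 * K * c u ^ 2 ≤ 1 := fun u => by
      have : c u ^ 2 ≤ μ ^ 2 := by rw [← sq_abs]; gcongr; exact hcμ u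
      have hK0 := (hε u).one_le
      calc 8 * K * c u ^ 2 ≤ 8 * R * μ ^ 2 := by gcongr
        _ ≤ 1 := hsmall
    have hcμ2 : ∀ u, |c u| ^ 2 ≤ μ ^ 2 := fun u => by gcongr; exact hcμ u
    rw [integral_linear_mul_linear_mul_exp hε hind w w' c fun u => (hε u).char_ne_zero (hcu u)]
    set m : U → ℝ := fun u => ∫ ω, ε u ω ^ 3 ∂P with hmdef
    have hmK : ∀ u, |m u| ≤ R := fun u => (hε u).abs_third_moment_le.trans hK
    have hsum : ∀ {v : U → ℝ}, ∑ u, v u ^ 2 ≤ R ^ 2 → ∑ u, |v u| * |c u| ≤ R ^ 2 :=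
      fun hv => sum_abs_mul_abs_le hv hc
    have hL : ∀ {v : U → ℝ}, ∑ u, v u ^ 2 ≤ R ^ 2 →
        ‖∑ u, (v u : ℂ) * (charMoment P (ε u) 1 (c u) / charMoment P (ε u) 0 (c u)) -
          (Complex.I * ((∑ u, v u * c u : ℝ) : ℂ) -
            ((∑ u, v u * (m u * c u ^ 2) : ℝ) : ℂ) / 2)‖ ≤ 20 * R ^ 3 * μ ^ 2 := by
      intro v hv
      have e : ∑ u, (v u : ℂ) * (charMoment P (ε u) 1 (c u) / charMoment P (ε u) 0 (c u)) -
          (Complex.I * ((∑ u, v u * c u : ℝ) : ℂ) - ((∑ u, v u * (m u * c u ^ 2) : ℝ) : ℂ) / 2) =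
          ∑ u, (v u : ℂ) * (charMoment P (ε u) 1 (c u) / charMoment P (ε u) 0 (c u) -
            (Complex.I * c u - (m u : ℂ) * c u ^ 2 / 2)) := by
        push_cast
        rw [Finset.mul_sum, Finset.sum_div, ← Finset.sum_sub_distrib, ← Finset.sum_sub_distrib]
        exact Finset.sum_congr rfl fun u _ => by ring
      rw [e]
      refine (norm_sum_le _ _).trans ?_
      calc _ ≤ ∑ u, 20 * R * μ ^ 2 * (|v u| * |c u|) := by
            refine Finset.sum_le_sum fun u _ => ?_
            rw [norm_mul, Complex.norm_real, Real.norm_eq_abs]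
            have h1 := (hε u).norm_ratio_one_sub_le (hcu u)
            have h2 : 20 * K * |c u| ^ 3 ≤ 20 * R * μ ^ 2 * |c u| := by
              have := hcμ2 u
              calc 20 * K * |c u| ^ 3 = 20 * K * (|c u| ^ 2 * |c u|) := by ring
                _ ≤ 20 * R * (μ ^ 2 * |c u|) := by gcongr
                _ = _ := by ring
            calc _ ≤ |v u| * (20 * R * μ ^ 2 * |c u|) := by gcongr; exact h1.trans h2
              _ = _ := by ring
        _ ≤ 20 * R * μ ^ 2 * R ^ 2 := by rw [← Finset.mul_sum]; gcongr; exact hsum hv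
        _ = _ := by ring
    have hk : ∀ {v : U → ℝ}, (∀ u, |v u| ≤ μ) → |∑ u, v u * (m u * c u ^ 2)| ≤ R ^ 3 * μ := by
      intro v hv
      refine (Finset.abs_sum_le_sum_abs _ _).trans ?_
      calc _ ≤ ∑ u, μ * (R * c u ^ 2) := by
            refine Finset.sum_le_sum fun u _ => ?_
            rw [abs_mul, abs_mul, abs_of_nonneg (sq_nonneg (c u))]
            gcongr
            · exact hv u
            · exact hmK u
        _ ≤ μ * (R * R ^ 2) := by rw [← Finset.mul_sum, ← Finset.mul_sum]; gcongr
        _ = _ := by ring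
    -- The sums `k`, `k'`, `y` and `r` are the third-moment contributions, each at most `R³ μ`.
    refine abs_re_mul_sub_le (k := ∑ u, w u * (m u * c u ^ 2)) (k' := ∑ u, w' u * (m u * c u ^ 2))
      (y := ∑ u, w u * w' u * (m u * c u)) (r := ∑ u, m u * c u ^ 3 / 6)
      hR hμ hμ1 hq ?_ ?_ ?_ (hL hw) (hL hw') ?_ hg hp hp' (hk hwμ) (hk hw'μ) ?_ ?_
    · rw [norm_prod]
      exact Finset.prod_le_one (fun _ _ => norm_nonneg _) fun u _ =>
        IsStandardized.norm_char_le_one _ _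
    · have e : Complex.exp (((-((∑ u, c u ^ 2) / 2) : ℝ) : ℂ) +
          Complex.I * ((-(∑ u, m u * c u ^ 3 / 6) : ℝ) : ℂ)) =
          ∏ u, Complex.exp (((-(c u ^ 2 / 2) : ℝ) : ℂ) +
            Complex.I * ((-(m u * c u ^ 3 / 6) : ℝ) : ℂ)) := by
        rw [← Complex.exp_sum, Finset.sum_add_distrib, ← Finset.mul_sum, ← Complex.ofReal_sum,
          ← Complex.ofReal_sum, Finset.sum_neg_distrib, Finset.sum_neg_distrib, Finset.sum_div]
      rw [e]
      refine (norm_prod_sub_prod_le _ (fun u => IsStandardized.norm_char_le_one _ _)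
        fun u => ?_).trans ?_
      · rw [Complex.norm_exp, Complex.add_re, Complex.re_mul_ofReal, Complex.ofReal_re,
          Complex.I_re, zero_mul, add_zero, Real.exp_le_one_iff]
        linarith [sq_nonneg (c u)]
      · calc _ ≤ ∑ u, 5 * R ^ 2 * μ ^ 2 * c u ^ 2 := by
              refine Finset.sum_le_sum fun u _ => ((hε u).norm_char_sub_exp_le (hcu u)).trans ?_
              have h1 := hcμ2 u
              rw [sq_abs] at h1
              have hK0 := (hε u).one_le
              calc 5 * K ^ 2 * c u ^ 4 = 5 * K ^ 2 * (c u ^ 2 * c u ^ 2) := by ring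
                _ ≤ 5 * R ^ 2 * (μ ^ 2 * c u ^ 2) := by gcongr
                _ = _ := by ring
          _ ≤ 5 * R ^ 2 * μ ^ 2 * R ^ 2 := by rw [← Finset.mul_sum]; gcongr
          _ = _ := by ring
    · have e : ∑ u, (w u * w' u : ℂ) * (charMoment P (ε u) 2 (c u) / charMoment P (ε u) 0 (c u) -
            (charMoment P (ε u) 1 (c u) / charMoment P (ε u) 0 (c u)) ^ 2) -
          (((∑ u, w u * w' u : ℝ) : ℂ) +
            Complex.I * ((∑ u, w u * w' u * (m u * c u) : ℝ) : ℂ)) =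
          ∑ u, (w u * w' u : ℂ) * (charMoment P (ε u) 2 (c u) / charMoment P (ε u) 0 (c u) -
            (charMoment P (ε u) 1 (c u) / charMoment P (ε u) 0 (c u)) ^ 2 -
              (1 + Complex.I * (m u : ℂ) * c u)) := by
        push_cast
        rw [Finset.mul_sum, ← Finset.sum_add_distrib, ← Finset.sum_sub_distrib]
        exact Finset.sum_congr rfl fun u _ => by ring
      rw [e]
      refine (norm_sum_le _ _).trans ?_
      calc _ ≤ ∑ u, 88 * R * μ ^ 2 * (|w u| * |w' u|) := by
            refine Finset.sum_le_sum fun u _ => ?_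
            rw [norm_mul, norm_mul, Complex.norm_real, Complex.norm_real, Real.norm_eq_abs,
              Real.norm_eq_abs]
            have h1 := (hε u).norm_ratio_two_sub_le (hcu u)
            have h2 : 88 * K * c u ^ 2 ≤ 88 * R * μ ^ 2 := by
              have := hcμ2 u
              rw [sq_abs] at this
              gcongr
            calc _ ≤ |w u| * |w' u| * (88 * R * μ ^ 2) := by gcongr; exact h1.trans h2
              _ = _ := by ring
        _ ≤ 88 * R * μ ^ 2 * R ^ 2 := by
            rw [← Finset.mul_sum]; gcongr; exact sum_abs_mul_abs_le hw hw'
        _ = _ := by ring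
    · refine (norm_sum_le _ _).trans ?_
      calc _ ≤ ∑ u, 8 * (|w' u| * |c u|) := by
            refine Finset.sum_le_sum fun u _ => ?_
            rw [norm_mul, Complex.norm_real, Real.norm_eq_abs]
            have h1 := (hε u).norm_ratio_one_le (hcu u)
            calc _ ≤ |w' u| * (8 * |c u|) := by gcongr
              _ = _ := by ring
        _ ≤ 8 * R ^ 2 := by rw [← Finset.mul_sum]; gcongr; exact hsum hw'
    · refine (Finset.abs_sum_le_sum_abs _ _).trans ?_
      calc _ ≤ ∑ u, R * μ * (|w u| * |w' u|) := by
            refine Finset.sum_le_sum fun u _ => ?_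
            rw [abs_mul, abs_mul, abs_mul]
            have : |m u| * |c u| ≤ R * μ := mul_le_mul (hmK u) (hcμ u) (abs_nonneg _) hR0
            calc _ ≤ |w u| * |w' u| * (R * μ) := by gcongr
              _ = _ := by ring
        _ ≤ R * μ * R ^ 2 := by rw [← Finset.mul_sum]; gcongr; exact sum_abs_mul_abs_le hw hw'
        _ = _ := by ring
    · refine (Finset.abs_sum_le_sum_abs _ _).trans ?_
      calc _ ≤ ∑ u, R * μ * c u ^ 2 := by
            refine Finset.sum_le_sum fun u _ => ?_
            rw [abs_div, abs_mul, abs_pow]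
            have : |m u| * |c u| ≤ R * μ := mul_le_mul (hmK u) (hcμ u) (abs_nonneg _) hR0
            calc |m u| * |c u| ^ 3 / |6| = |m u| * |c u| * |c u| ^ 2 / 6 := by
                  rw [abs_of_pos (by norm_num : (0 : ℝ) < 6)]; ring
              _ ≤ R * μ * |c u| ^ 2 / 6 := by gcongr
              _ ≤ R * μ * |c u| ^ 2 := by
                have : 0 ≤ R * μ * |c u| ^ 2 := by positivity
                linarith
              _ = _ := by rw [sq_abs]
        _ ≤ R * μ * R ^ 2 := by rw [← Finset.mul_sum]; gcongr
        _ = _ := by ring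
  · have h1 : |∫ ω, ((∑ u, w u * ε u ω) * ∑ u, w' u * ε u ω) * Real.cos (∑ u, c u * ε u ω) ∂P| ≤
        R ^ 2 := by
      refine (abs_integral_le_integral_abs).trans ?_
      have h2 : ∫ ω, |((∑ u, w u * ε u ω) * ∑ u, w' u * ε u ω) * Real.cos (∑ u, c u * ε u ω)| ∂P ≤
          ∫ ω, |(∑ u, w u * ε u ω) * ∑ u, w' u * ε u ω| ∂P := by
        refine integral_mono_of_nonneg (ae_of_all _ fun ω => abs_nonneg _)
          ((memLp_two_linear hε w).integrable_mul (memLp_two_linear hε w')).abs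
          (ae_of_all _ fun ω => ?_)
        simp only [abs_mul (_ * _) (Real.cos _)]
        exact mul_le_of_le_one_right (abs_nonneg _) (Real.abs_cos_le_one _)
      have h3 := integral_abs_linear_mul_linear_le hε hind w w'
      linarith
    have h2 : |(∑ u, w u * w' u - (∑ u, w u * c u) * ∑ u, w' u * c u) *
        Real.exp (-((∑ u, c u ^ 2) / 2))| ≤ R ^ 2 + R ^ 2 * R ^ 2 := by
      rw [abs_mul, abs_of_pos (Real.exp_pos _)]
      have h3 : Real.exp (-((∑ u, c u ^ 2) / 2)) ≤ 1 := Real.exp_le_one_iff.2 (by linarith)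
      refine (mul_le_of_le_one_right (abs_nonneg _) h3).trans ?_
      refine (abs_sub _ _).trans ?_
      rw [abs_mul]
      gcongr
    refine (abs_sub _ _).trans ((add_le_add h1 h2).trans ?_)
    push Not at hsmall
    have h3 : R ^ 2 ≤ R ^ 4 := by gcongr; norm_num
    have h4 : R ^ 5 * μ ^ 2 ≤ R ^ 10 * μ ^ 2 := by gcongr; norm_num
    have h5 : R ^ 4 * 1 ≤ R ^ 4 * (8 * R * μ ^ 2) := by gcongr
    have h6 : 0 ≤ R ^ 10 * μ ^ 2 := by positivity
    nlinarith

end CosIntegral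

/-! ### Gaussian linearization of `exp(-sD)`. -/

/-- The standard Gaussian product measure. -/
noncomputable def stdGaussianPi (τ : Type*) [Fintype τ] : Measure (τ → ℝ) :=
  Measure.pi fun _ => gaussianReal 0 1

section StdGaussianPi

variable {τ : Type*} [Fintype τ]

instance : IsProbabilityMeasure (stdGaussianPi τ) := by
  unfold stdGaussianPi; infer_instance

theorem measurePreserving_eval_stdGaussianPi (t : τ) :
    MeasurePreserving (fun z : τ → ℝ => z t) (stdGaussianPi τ) (gaussianReal 0 1) :=
  measurePreserving_eval (fun _ : τ => gaussianReal 0 1) t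

/-- The twelfth absolute moment of a standard Gaussian. -/
noncomputable def gaussMoment : ℝ := ∫ x, |x| ^ 12 ∂(gaussianReal 0 1)

theorem gaussMoment_nonneg : 0 ≤ gaussMoment := integral_nonneg fun _ => by positivity

theorem integrable_abs_pow_stdGaussianPi (t : τ) :
    Integrable (fun z : τ → ℝ => |z t| ^ 12) (stdGaussianPi τ) := by
  have h : Integrable (fun x : ℝ => |x| ^ 12) (gaussianReal 0 1) := by
    have := (memLp_id_gaussianReal (μ := 0) (v := 1) 12).integrable_norm_pow'
    simpa using this
  exact (measurePreserving_eval_stdGaussianPi t).integrable_comp_of_integrable h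

theorem integral_abs_pow_stdGaussianPi (t : τ) :
    ∫ z, |z t| ^ 12 ∂(stdGaussianPi τ) = gaussMoment := by
  have h := (measurePreserving_eval_stdGaussianPi t).map_eq
  rw [gaussMoment, ← h, integral_map (measurable_pi_apply t).aemeasurable (by fun_prop)]

/-- Jensen for the weights `1/A` and `θ a_t / A`, with `A = 1 + θ ∑ a_t`; the index `none` carries
the constant `1`. The result depends on the modes only through `∑ a_t`, which is logarithmic in `T`,
and not through their number. -/
theorem one_add_sum_pow_le {a y : τ → ℝ} {θ : ℝ} (ha : ∀ t, 0 ≤ a t) (hθ : 0 ≤ θ)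
    (hy : ∀ t, 0 ≤ y t) (n : ℕ) :
    (1 + θ * ∑ t, a t * y t) ^ (n + 1) ≤
      (1 + θ * ∑ t, a t) ^ n * (1 + θ * ∑ t, a t * y t ^ (n + 1)) := by
  set A := 1 + θ * ∑ t, a t with hA
  have hApos : 0 < A := by
    have : 0 ≤ ∑ t, a t := Finset.sum_nonneg fun t _ => ha t
    positivity
  have h := Real.pow_arith_mean_le_arith_mean_pow (Finset.univ : Finset (Option τ))
    (fun o => o.elim (1 / A) fun t => θ * a t / A) (fun o => o.elim 1 y)
    (by
      intro o _
      cases o with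
      | none => simpa using hApos.le
      | some t => have := ha t; simp only [Option.elim]; positivity)
    (by
      rw [Fintype.sum_option]
      simp only [Option.elim]
      rw [← Finset.sum_div, ← add_div, ← Finset.mul_sum, ← hA, div_self hApos.ne'])
    (by
      intro o _
      cases o with
      | none => simp
      | some t => simpa using hy t) (n + 1)
  rw [Fintype.sum_option, Fintype.sum_option] at h
  simp only [Option.elim, one_pow, mul_one] at h
  have e : ∀ x : τ → ℝ, 1 / A + ∑ t, θ * a t / A * x t = (1 + θ * ∑ t, a t * x t) / A := by
    intro x
    rw [add_div, Finset.mul_sum, Finset.sum_div]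
    congr 1
    exact Finset.sum_congr rfl fun t _ => by ring
  rw [e y, e fun t => y t ^ (n + 1), div_pow, div_le_div_iff₀ (by positivity) hApos] at h
  have h2 : (1 + θ * ∑ t, a t * y t) ^ (n + 1) * A ≤
      A ^ n * (1 + θ * ∑ t, a t * y t ^ (n + 1)) * A := by
    refine h.trans (le_of_eq ?_)
    ring
  exact le_of_mul_le_mul_right h2 hApos

theorem integrable_one_add_sum_pow {a : τ → ℝ} {θ : ℝ} (ha : ∀ t, 0 ≤ a t) (hθ : 0 ≤ θ) :
    Integrable (fun z : τ → ℝ => (1 + θ * ∑ t, a t * |z t|) ^ 12) (stdGaussianPi τ) := by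
  refine Integrable.mono' (g := fun z => (1 + θ * ∑ t, a t) ^ 11 *
    (1 + θ * ∑ t, a t * |z t| ^ 12)) ?_
    (Continuous.aestronglyMeasurable (by fun_prop)) (ae_of_all _ fun z => ?_)
  · refine Integrable.const_mul ((integrable_const _).add (Integrable.const_mul ?_ _)) _
    exact integrable_finsetSum _ fun t _ => (integrable_abs_pow_stdGaussianPi t).const_mul _
  · rw [Real.norm_of_nonneg (by positivity)]
    exact one_add_sum_pow_le ha hθ (fun t => abs_nonneg _) 11

/-- The power twelve is the degree in `1 + ∑ |b_t|` of both errors integrated against the Gaussian: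
the approximation error and the remainder in the tail estimate. -/
theorem integral_one_add_sum_pow_le {a : τ → ℝ} {θ : ℝ} (ha : ∀ t, 0 ≤ a t) (hθ : 0 ≤ θ) :
    ∫ z, (1 + θ * ∑ t, a t * |z t|) ^ 12 ∂(stdGaussianPi τ) ≤
      (1 + gaussMoment) * (1 + θ * ∑ t, a t) ^ 12 := by
  have hi : Integrable (fun z : τ → ℝ => ∑ t, a t * |z t| ^ 12) (stdGaussianPi τ) :=
    integrable_finsetSum _ fun t _ => (integrable_abs_pow_stdGaussianPi t).const_mul _
  have h1 : ∫ z, (1 + θ * ∑ t, a t * |z t|) ^ 12 ∂(stdGaussianPi τ) ≤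
      ∫ z, (1 + θ * ∑ t, a t) ^ 11 * (1 + θ * ∑ t, a t * |z t| ^ 12) ∂(stdGaussianPi τ) :=
    integral_mono (integrable_one_add_sum_pow ha hθ)
      (((integrable_const _).add (hi.const_mul _)).const_mul _)
      fun z => one_add_sum_pow_le ha hθ (fun t => abs_nonneg _) 11
  refine h1.trans ?_
  rw [integral_const_mul, integral_add (integrable_const _) (hi.const_mul _), integral_const_mul,
    integral_finsetSum _ fun t _ => (integrable_abs_pow_stdGaussianPi t).const_mul _]
  simp only [integral_const_mul, integral_abs_pow_stdGaussianPi, integral_const, probReal_univ,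
    one_smul, ← Finset.sum_mul]
  have hA : 0 ≤ θ * ∑ t, a t := mul_nonneg hθ (Finset.sum_nonneg fun t _ => ha t)
  have hG := gaussMoment_nonneg
  calc _ ≤ (1 + θ * ∑ t, a t) ^ 11 * ((1 + gaussMoment) * (1 + θ * ∑ t, a t)) := by
        gcongr
        nlinarith
    _ = _ := by ring

theorem integral_exp_stdGaussianPi (b : τ → ℝ) :
    ∫ z, Complex.exp (Complex.I * ((∑ t, b t * z t : ℝ) : ℂ)) ∂(stdGaussianPi τ) =
      ((Real.exp (-((∑ t, b t ^ 2) / 2)) : ℝ) : ℂ) := by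
  have h := integral_fintype_prod_eq_prod (μ := fun _ : τ => gaussianReal 0 1)
    (fun t (x : ℝ) => Complex.exp (b t * x * Complex.I))
  have h2 : ∀ t, ∫ x, Complex.exp (b t * x * Complex.I) ∂(gaussianReal 0 1) =
      Complex.exp (-(b t ^ 2 / 2)) := by
    intro t
    rw [← charFun_apply_real, charFun_gaussianReal]
    simp
  simp only [h2, ← Complex.exp_sum] at h
  rw [stdGaussianPi]
  convert h using 1
  · congr 1
    ext z
    push_cast
    rw [Finset.mul_sum]
    congr 1
    exact Finset.sum_congr rfl fun t _ => by ring
  · rw [Finset.sum_neg_distrib, ← Finset.sum_div]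
    push_cast
    rfl

theorem integral_cos_stdGaussianPi (b : τ → ℝ) :
    ∫ z, Real.cos (∑ t, b t * z t) ∂(stdGaussianPi τ) = Real.exp (-((∑ t, b t ^ 2) / 2)) := by
  have hi : Integrable (fun z : τ → ℝ => Complex.exp (Complex.I * ((∑ t, b t * z t : ℝ) : ℂ)))
      (stdGaussianPi τ) := by
    refine (integrable_const (1 : ℝ)).mono' (Continuous.aestronglyMeasurable (by fun_prop))
      (ae_of_all _ fun z => ?_)
    rw [Complex.norm_exp_I_mul_ofReal]
  have h := Complex.reCLM.integral_comp_comm hi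
  rw [integral_exp_stdGaussianPi, Complex.reCLM_apply, Complex.ofReal_re] at h
  rw [← h]
  congr 1
  ext z
  rw [Complex.reCLM_apply, mul_comm Complex.I, Complex.exp_ofReal_mul_I_re]

/-- Linearization of `exp (-s ∑ a² x²)`. -/
theorem exp_neg_mul_sum_eq (a x : τ → ℝ) {s : ℝ} (hs : 0 ≤ s) :
    Real.exp (-(s * ∑ t, a t ^ 2 * x t ^ 2)) =
      ∫ z, Real.cos (Real.sqrt (2 * s) * ∑ t, a t * z t * x t) ∂(stdGaussianPi τ) := by
  have h := integral_cos_stdGaussianPi fun t => Real.sqrt (2 * s) * a t * x t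
  have e : (∑ t, (Real.sqrt (2 * s) * a t * x t) ^ 2) / 2 = s * ∑ t, a t ^ 2 * x t ^ 2 := by
    rw [Finset.mul_sum, Finset.sum_div]
    refine Finset.sum_congr rfl fun t _ => ?_
    rw [mul_pow, mul_pow, Real.sq_sqrt (by positivity)]
    ring
  rw [e] at h
  rw [← h]
  congr 1
  ext z
  rw [Finset.mul_sum]
  congr 1
  exact Finset.sum_congr rfl fun t _ => by ring

theorem measurePreserving_flip_stdGaussianPi [DecidableEq τ] (k : τ) :
    MeasurePreserving (fun z : τ → ℝ => fun t => if t = k then -z t else z t) (stdGaussianPi τ)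
      (stdGaussianPi τ) := by
  refine measurePreserving_pi (fun _ : τ => gaussianReal 0 1) (fun _ : τ => gaussianReal 0 1)
    (f := fun t x => if t = k then -x else x) fun t => ?_
  by_cases h : t = k
  · simp only [h, if_true]
    refine ⟨measurable_neg, ?_⟩
    have := gaussianReal_map_neg (μ := 0) (v := 1)
    simpa using this
  · simp only [h, if_false]
    exact MeasurePreserving.id _

theorem integral_exp_neg_sq_gaussianReal_le {q : ℝ} (hq : 0 < q) :
    ∫ x, Real.exp (-(q * x ^ 2)) ∂(gaussianReal 0 1) ≤ 1 / Real.sqrt (2 * q) := by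
  rw [integral_gaussianReal_eq_integral_smul (by norm_num)]
  have h1 : ∀ x : ℝ, gaussianPDFReal 0 1 x • Real.exp (-(q * x ^ 2)) ≤
      (Real.sqrt (2 * Real.pi))⁻¹ * Real.exp (-q * x ^ 2) := by
    intro x
    rw [gaussianPDFReal_def, smul_eq_mul]
    have h2 : Real.exp (-(x - 0) ^ 2 / (2 * ((1 : NNReal) : ℝ))) ≤ 1 := by
      rw [Real.exp_le_one_iff]
      have := sq_nonneg (x - 0)
      apply div_nonpos_of_nonpos_of_nonneg <;> [linarith; positivity]
    rw [neg_mul]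
    simp only [NNReal.coe_one, mul_one] at h2 ⊢
    gcongr
    exact mul_le_of_le_one_right (by positivity) h2
  have hi : Integrable fun x : ℝ => (Real.sqrt (2 * Real.pi))⁻¹ * Real.exp (-q * x ^ 2) :=
    (integrable_exp_neg_mul_sq hq).const_mul _
  refine (integral_mono_of_nonneg (ae_of_all _ fun x => ?_) hi (ae_of_all _ h1)).trans ?_
  · exact smul_nonneg (gaussianPDFReal_nonneg _ _ _) (Real.exp_pos _).le
  · rw [integral_const_mul, integral_gaussian, inv_mul_eq_div, ← Real.sqrt_div' _ (by positivity),
      ← Real.sqrt_one, ← Real.sqrt_div' _ (by positivity)]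
    apply Real.sqrt_le_sqrt
    apply le_of_eq
    have := Real.pi_pos
    field_simp

/-- Every mode contributes a factor `(2q₀)^{-1/2}`, so any power of decay is available from
sufficiently many modes. -/
theorem integral_exp_neg_sum_sq_le {q : τ → ℝ} {q₀ : ℝ} (hq₀ : 0 < q₀) (hq : ∀ t, q₀ ≤ q t) :
    ∫ z, Real.exp (-∑ t, q t * z t ^ 2) ∂(stdGaussianPi τ) ≤
      (1 / Real.sqrt (2 * q₀)) ^ Fintype.card τ := by
  have h := integral_fintype_prod_eq_prod (μ := fun _ : τ => gaussianReal 0 1)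
    (fun t (x : ℝ) => Real.exp (-(q t * x ^ 2)))
  simp only [← Real.exp_sum, Finset.sum_neg_distrib] at h
  rw [stdGaussianPi, h, ← Finset.card_univ, ← Finset.prod_const]
  refine Finset.prod_le_prod (fun t _ => integral_nonneg fun x => (Real.exp_pos _).le) fun t _ => ?_
  refine (integral_exp_neg_sq_gaussianReal_le (hq₀.trans_le (hq t))).trans ?_
  have := hq t
  gcongr

end StdGaussianPi

/-! ### Near cancellation under the reflection of one Gaussian coordinate. -/

theorem abs_exp_neg_sub_exp_neg_le {x y : ℝ} (hx : 0 ≤ x) (hy : 0 ≤ y) :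
    |Real.exp (-x) - Real.exp (-y)| ≤ |x - y| := by
  wlog h : x ≤ y generalizing x y
  · rw [abs_sub_comm, abs_sub_comm x]
    exact this hy hx (le_of_not_ge h)
  have h1 : Real.exp (-y) = Real.exp (-x) * Real.exp (x - y) := by rw [← Real.exp_add]; ring_nf
  have h2 := Real.add_one_le_exp (x - y)
  have h3 : Real.exp (-x) ≤ 1 := Real.exp_le_one_iff.2 (by linarith)
  have h4 : Real.exp (x - y) ≤ 1 := Real.exp_le_one_iff.2 (by linarith)
  have h5 := Real.exp_pos (-x)
  rw [abs_of_nonneg (by nlinarith), abs_sub_comm, abs_of_nonneg (by linarith), h1]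
  nlinarith

/-- The values of `(g - p p') exp (-q)` at a point and at its reflection nearly cancel. -/
theorem abs_add_reflection_le {β ν Λ b b' gkk gll gkl dk dl q : ℝ} (hβ : 1 ≤ β) (hν : 0 ≤ ν)
    (hν1 : ν ≤ 1) (hΛ : 0 ≤ Λ) (hb : |b| ≤ Λ) (hb' : |b'| ≤ Λ) (hgkk : |gkk| ≤ β ^ 2)
    (hgll : |gll| ≤ β ^ 2) (hgkl : |gkl| ≤ β * ν ^ 2) (hdk : |dk| ≤ Λ * (β * ν ^ 2))
    (hdl : |dl| ≤ Λ * (β * ν ^ 2)) (hq : 0 ≤ q) (hq' : 0 ≤ q - 2 * b * dk) :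
    |(gkl - (b * gkk + dk) * (b' * gll + dl)) * Real.exp (-q) +
      (gkl - (-(b * gkk) + dk) * (b' * gll + (dl - 2 * b * gkl))) * Real.exp (-(q - 2 * b * dk))|
      ≤ 14 * (β * (1 + Λ)) ^ 5 * ν ^ 2 := by
  set e := Real.exp (-q)
  set e' := Real.exp (-(q - 2 * b * dk))
  have hβ0 : 0 ≤ β := zero_le_one.trans hβ
  have he0 : 0 ≤ e := (Real.exp_pos _).le
  have he0' : 0 ≤ e' := (Real.exp_pos _).le
  have he1 : e ≤ 1 := Real.exp_le_one_iff.2 (by linarith)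
  have he1' : e' ≤ 1 := Real.exp_le_one_iff.2 (by linarith)
  have hee : |e - e'| ≤ 2 * Λ * (Λ * (β * ν ^ 2)) := by
    refine (abs_exp_neg_sub_exp_neg_le hq hq').trans ?_
    rw [show q - (q - 2 * b * dk) = 2 * b * dk by ring, abs_mul, abs_mul, abs_two]
    gcongr
  have hd' : |dl - 2 * b * gkl| ≤ 3 * (Λ * (β * ν ^ 2)) := by
    refine (abs_sub _ _).trans ?_
    rw [abs_mul, abs_mul, abs_two]
    have : 2 * |b| * |gkl| ≤ 2 * Λ * (β * ν ^ 2) := by gcongr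
    linarith
  set dl' := dl - 2 * b * gkl
  set D := Λ * (β * ν ^ 2) with hD
  have hD0 : 0 ≤ D := by positivity
  have hDΛ : D ≤ Λ * β := by
    rw [hD]
    gcongr
    exact mul_le_of_le_one_right hβ0 (pow_le_one₀ hν hν1)
  have hmk : |b * gkk| ≤ Λ * β ^ 2 := by rw [abs_mul]; gcongr
  have hml : |b' * gll| ≤ Λ * β ^ 2 := by rw [abs_mul]; gcongr
  set mk := b * gkk
  set ml := b' * gll
  -- The product `mk * ml` of the diagonal parts survives only against `e - e'`. Every other term
  -- has an off-diagonal factor `gkl`, `dk`, `dl` or `dl'`, of size `ν²`.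
  have key : (gkl - (mk + dk) * (ml + dl)) * e + (gkl - (-mk + dk) * (ml + dl')) * e' =
      gkl * (e + e') - mk * ml * (e - e') - (mk * dl + dk * ml + dk * dl) * e -
        (-(mk * dl') + dk * ml + dk * dl') * e' := by ring
  rw [key]
  have t1 : |gkl * (e + e')| ≤ β * ν ^ 2 * 2 := by
    rw [abs_mul, abs_of_nonneg (add_nonneg he0 he0')]
    gcongr
    linarith
  have t2 : |mk * ml * (e - e')| ≤ (Λ * β ^ 2) * (Λ * β ^ 2) * (2 * Λ * D) := by
    rw [abs_mul, abs_mul]; gcongr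
  have t3 : |(mk * dl + dk * ml + dk * dl) * e| ≤
      ((Λ * β ^ 2) * D + D * (Λ * β ^ 2) + D * (Λ * β)) * 1 := by
    rw [abs_mul, abs_of_nonneg he0]
    gcongr
    refine (abs_add_three _ _ _).trans ?_
    rw [abs_mul mk, abs_mul dk ml, abs_mul dk dl]
    gcongr
    exact hdl.trans hDΛ
  have t4 : |(-(mk * dl') + dk * ml + dk * dl') * e'| ≤
      ((Λ * β ^ 2) * (3 * D) + D * (Λ * β ^ 2) + D * (3 * (Λ * β))) * 1 := by
    rw [abs_mul, abs_of_nonneg he0']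
    gcongr
    refine (abs_add_three _ _ _).trans ?_
    rw [abs_neg, abs_mul mk, abs_mul dk ml, abs_mul dk dl']
    gcongr
    linarith
  have h1 := abs_sub (gkl * (e + e') - mk * ml * (e - e') - (mk * dl + dk * ml + dk * dl) * e)
    ((-(mk * dl') + dk * ml + dk * dl') * e')
  have h2 := abs_sub (gkl * (e + e') - mk * ml * (e - e')) ((mk * dl + dk * ml + dk * dl) * e)
  have h3 := abs_sub (gkl * (e + e')) (mk * ml * (e - e'))
  have hsum : β * ν ^ 2 * 2 + (Λ * β ^ 2) * (Λ * β ^ 2) * (2 * Λ * D) +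
      ((Λ * β ^ 2) * D + D * (Λ * β ^ 2) + D * (Λ * β)) * 1 +
      ((Λ * β ^ 2) * (3 * D) + D * (Λ * β ^ 2) + D * (3 * (Λ * β))) * 1 =
      (2 * β + 2 * (β ^ 5 * Λ ^ 4) + 6 * (β ^ 3 * Λ ^ 2) + 4 * (β ^ 2 * Λ ^ 2)) * ν ^ 2 := by
    rw [hD]; ring
  have hpow : ∀ {m n : ℕ}, m ≤ 5 → n ≤ 5 → β ^ m * Λ ^ n ≤ (β * (1 + Λ)) ^ 5 := by
    intro m n hm hn
    rw [mul_pow]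
    have h1 : β ^ m ≤ β ^ 5 := pow_le_pow_right₀ hβ hm
    have h2 : Λ ^ n ≤ (1 + Λ) ^ 5 :=
      (pow_le_pow_left₀ hΛ (by linarith) n).trans (pow_le_pow_right₀ (by linarith) hn)
    gcongr
  have p1 := hpow (m := 1) (n := 0) (by norm_num) (by norm_num)
  have p2 := hpow (m := 5) (n := 4) (by norm_num) (by norm_num)
  have p3 := hpow (m := 3) (n := 2) (by norm_num) (by norm_num)
  have p4 := hpow (m := 2) (n := 2) (by norm_num) (by norm_num)
  rw [pow_one, pow_zero, mul_one] at p1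
  have : (2 * β + 2 * (β ^ 5 * Λ ^ 4) + 6 * (β ^ 3 * Λ ^ 2) + 4 * (β ^ 2 * Λ ^ 2)) * ν ^ 2 ≤
      14 * (β * (1 + Λ)) ^ 5 * ν ^ 2 := by
    gcongr
    linarith
  linarith

/-- Bounds on the coefficients `W t u` of a finite family of linear forms: they are of size `ν`,
with bounded norms and nearly orthogonal. -/
structure NearlyOrthogonal {τ U : Type*} [Fintype U] (W : τ → U → ℝ) (β ν : ℝ) : Prop where
  one_le : 1 ≤ β
  nonneg : 0 ≤ ν
  le_one : ν ≤ 1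
  abs_le : ∀ t u, |W t u| ≤ β * ν
  sq_le : ∀ t, ∑ u, W t u ^ 2 ≤ β ^ 2
  off_le : ∀ t t', t ≠ t' → |∑ u, W t u * W t' u| ≤ β * ν ^ 2

namespace NearlyOrthogonal

variable {τ U : Type*} [Fintype τ] [Fintype U] {W : τ → U → ℝ} {β ν : ℝ}

theorem abs_comb_le (hW : NearlyOrthogonal W β ν) (b : τ → ℝ) (u : U) :
    |∑ t, b t * W t u| ≤ (∑ t, |b t|) * (β * ν) := by
  refine (Finset.abs_sum_le_sum_abs _ _).trans ?_
  rw [Finset.sum_mul]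
  refine Finset.sum_le_sum fun t _ => ?_
  rw [abs_mul]
  gcongr
  exact hW.abs_le t u

theorem sum_comb_sq_le (hW : NearlyOrthogonal W β ν) (b : τ → ℝ) :
    ∑ u, (∑ t, b t * W t u) ^ 2 ≤ ((∑ t, |b t|) * β) ^ 2 := by
  have h : ∀ u, (∑ t, b t * W t u) ^ 2 ≤ (∑ t, |b t|) * ∑ t, |b t| * W t u ^ 2 := fun u =>
    Finset.sum_sq_le_sum_mul_sum_of_sq_le_mul _ (fun t _ => abs_nonneg _)
      (fun t _ => by positivity) fun t _ => by rw [← mul_assoc, abs_mul_abs_self]; nlinarith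
  calc _ ≤ ∑ u, (∑ t, |b t|) * ∑ t, |b t| * W t u ^ 2 := Finset.sum_le_sum fun u _ => h u
    _ = (∑ t, |b t|) * ∑ t, |b t| * ∑ u, W t u ^ 2 := by
      rw [← Finset.mul_sum, Finset.sum_comm]
      simp only [Finset.mul_sum]
    _ ≤ (∑ t, |b t|) * ∑ t, |b t| * β ^ 2 := by
      gcongr with t
      exact hW.sq_le t
    _ = _ := by rw [← Finset.sum_mul]; ring

theorem sum_mul_comb_eq [DecidableEq τ] (b : τ → ℝ) (k : τ) :
    ∑ u, W k u * ∑ t, b t * W t u =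
      b k * ∑ u, W k u ^ 2 + ∑ t ∈ Finset.univ.erase k, b t * ∑ u, W k u * W t u := by
  have h : ∑ u, W k u * ∑ t, b t * W t u = ∑ t, b t * ∑ u, W k u * W t u := by
    simp only [Finset.mul_sum]
    rw [Finset.sum_comm]
    exact Finset.sum_congr rfl fun t _ => Finset.sum_congr rfl fun u _ => by ring
  rw [h, ← Finset.add_sum_erase _ _ (Finset.mem_univ k)]
  simp only [pow_two]

theorem abs_sum_mul_comb_sub_le (hW : NearlyOrthogonal W β ν) (b : τ → ℝ) (k : τ) :
    |∑ u, W k u * ∑ t, b t * W t u - b k * ∑ u, W k u ^ 2| ≤ (∑ t, |b t|) * (β * ν ^ 2) := by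
  classical
  rw [sum_mul_comb_eq, add_sub_cancel_left]
  refine (Finset.abs_sum_le_sum_abs _ _).trans ?_
  rw [Finset.sum_mul]
  refine (Finset.sum_le_sum fun t ht => ?_).trans
    (Finset.sum_le_sum_of_subset_of_nonneg (Finset.erase_subset k _) fun t _ _ => ?_)
  · rw [abs_mul]
    gcongr
    exact hW.off_le k t (Finset.ne_of_mem_erase ht).symm
  · have := hW.one_le
    positivity

/-- The Gaussian counterpart of `E[x x' cos(c · ε)]` with `c = ∑ b W`. -/
noncomputable def gaussTerm (W : τ → U → ℝ) (k l : τ) (b : τ → ℝ) : ℝ :=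
  (∑ u, W k u * W l u - (∑ u, W k u * ∑ t, b t * W t u) * ∑ u, W l u * ∑ t, b t * W t u) *
    Real.exp (-((∑ u, (∑ t, b t * W t u) ^ 2) / 2))

/-- Flipping `b_k` replaces `c = ∑ b_t W_t` by `c - 2 b_k W_k`. The main part `b_k |W_k|²` of `⟨W_k,
c⟩` changes sign, whereas `⟨W_l, c⟩` and `|c|²` change only through off-diagonal Gram entries. -/
theorem abs_gaussTerm_add_reflection_le [DecidableEq τ] (hW : NearlyOrthogonal W β ν) {k l : τ}
    (hkl : k ≠ l) (b : τ → ℝ) :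
    |gaussTerm W k l b + gaussTerm W k l fun t => if t = k then -b t else b t| ≤
      14 * (β * (1 + ∑ t, |b t|)) ^ 5 * ν ^ 2 := by
  have hc : ∀ u, ∑ t, (if t = k then -b t else b t) * W t u =
      ∑ t, b t * W t u - 2 * b k * W k u := by
    intro u
    rw [← Finset.add_sum_erase _ _ (Finset.mem_univ k), ← Finset.add_sum_erase (a := k)
      (f := fun t => b t * W t u) _ (Finset.mem_univ k)]
    rw [Finset.sum_congr rfl fun t ht => by rw [if_neg (Finset.ne_of_mem_erase ht)]]
    simp
    ring
  simp only [gaussTerm, hc]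
  have hdk := hW.abs_sum_mul_comb_sub_le b k
  have hdl := hW.abs_sum_mul_comb_sub_le b l
  set c : U → ℝ := fun u => ∑ t, b t * W t u with hcdef
  have hΛ : 0 ≤ ∑ t, |b t| := Finset.sum_nonneg fun t _ => abs_nonneg _
  have hbΛ : ∀ t, |b t| ≤ ∑ t, |b t| := fun t =>
    Finset.single_le_sum (f := fun t => |b t|) (fun t _ => abs_nonneg _) (Finset.mem_univ t)
  have hg : ∀ t, |∑ u, W t u ^ 2| ≤ β ^ 2 := fun t => by
    rw [abs_of_nonneg (Finset.sum_nonneg fun u _ => sq_nonneg _)]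
    exact hW.sq_le t
  have e1 : ∑ u, W k u * (c u - 2 * b k * W k u) =
      -(b k * ∑ u, W k u ^ 2) + (∑ u, W k u * c u - b k * ∑ u, W k u ^ 2) := by
    simp only [mul_sub, Finset.sum_sub_distrib, Finset.mul_sum, ← Finset.sum_neg_distrib]
    rw [← sub_eq_zero]
    simp only [← Finset.sum_sub_distrib, ← Finset.sum_add_distrib]
    exact Finset.sum_eq_zero fun u _ => by ring
  have e2 : ∑ u, W l u * (c u - 2 * b k * W k u) =
      b l * ∑ u, W l u ^ 2 + ((∑ u, W l u * c u - b l * ∑ u, W l u ^ 2) -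
        2 * b k * ∑ u, W k u * W l u) := by
    simp only [mul_sub, Finset.sum_sub_distrib, Finset.mul_sum]
    rw [← sub_eq_zero]
    simp only [← Finset.sum_sub_distrib, ← Finset.sum_add_distrib]
    exact Finset.sum_eq_zero fun u _ => by ring
  have e3 : (∑ u, (c u - 2 * b k * W k u) ^ 2) / 2 =
      (∑ u, c u ^ 2) / 2 - 2 * b k * (∑ u, W k u * c u - b k * ∑ u, W k u ^ 2) := by
    have : ∑ u, (c u - 2 * b k * W k u) ^ 2 = ∑ u, c u ^ 2 -
        4 * b k * ∑ u, W k u * c u + 4 * b k ^ 2 * ∑ u, W k u ^ 2 := by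
      rw [Finset.mul_sum, Finset.mul_sum, ← Finset.sum_sub_distrib, ← Finset.sum_add_distrib]
      exact Finset.sum_congr rfl fun u _ => by ring
    rw [this]; ring
  have e4 : 0 ≤ (∑ u, (c u - 2 * b k * W k u) ^ 2) / 2 := by positivity
  rw [e1, e2, e3]
  rw [e3] at e4
  have h := abs_add_reflection_le hW.one_le hW.nonneg hW.le_one hΛ (hbΛ k) (hbΛ l) (hg k) (hg l)
    (hW.off_le k l hkl) hdk hdl (q := (∑ u, c u ^ 2) / 2) (by positivity) e4
  rw [add_sub_cancel, add_sub_cancel] at h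
  exact h

end NearlyOrthogonal

/-! ### The Laplace transform `E[x_k x_l exp(-sD)]`. -/

section LaplaceTransform

variable {Ω τ U : Type*} [MeasurableSpace Ω] {P : Measure Ω} [IsProbabilityMeasure P] [Fintype τ]
  [Fintype U] {ε : U → Ω → ℝ} {W : τ → U → ℝ} {K β ν : ℝ}

theorem comb_swap (b : τ → ℝ) (W : τ → U → ℝ) (x : U → ℝ) :
    ∑ t, b t * ∑ u, W t u * x u = ∑ u, (∑ t, b t * W t u) * x u := by
  simp only [Finset.mul_sum, Finset.sum_mul]
  rw [Finset.sum_comm]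
  exact Finset.sum_congr rfl fun u _ => Finset.sum_congr rfl fun t _ => by ring

theorem abs_integral_cos_sub_gaussTerm_le (hε : ∀ u, IsStandardized P (ε u) K)
    (hind : iIndepFun ε P) (hK : 0 ≤ K) (hW : NearlyOrthogonal W β ν) (k l : τ) (b : τ → ℝ) :
    |∫ ω, ((∑ u, W k u * ε u ω) * ∑ u, W l u * ε u ω) *
        Real.cos (∑ t, b t * ∑ u, W t u * ε u ω) ∂P - NearlyOrthogonal.gaussTerm W k l b| ≤
      400 * ((K + β) * (1 + ∑ t, |b t|)) ^ 12 * ν ^ 2 := by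
  have hβ := hW.one_le
  have hν := hW.nonneg
  have hΛ : 0 ≤ ∑ t, |b t| := Finset.sum_nonneg fun t _ => abs_nonneg _
  set Λ := ∑ t, |b t| with hΛdef
  -- With `μ = R ν` the error `R^10 μ²` becomes `R^12 ν²`, a polynomial of degree twelve in `1 + Λ`.
  set R := (K + β) * (1 + Λ) with hR
  have hβR : β ≤ R := by rw [hR]; nlinarith
  have hβΛR : Λ * β ≤ R := by rw [hR]; nlinarith [mul_nonneg hK hΛ]
  have hKR : K ≤ R := by rw [hR]; nlinarith [mul_nonneg hK hΛ]
  have hR1 : 1 ≤ R := hβ.trans hβR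
  have hWν : ∀ t u, |W t u| ≤ R * ν := fun t u => (hW.abs_le t u).trans (by gcongr)
  have hW2 : ∀ t, ∑ u, W t u ^ 2 ≤ R ^ 2 := fun t => (hW.sq_le t).trans (by gcongr)
  simp only [comb_swap]
  have h := abs_integral_mul_mul_cos_sub_le hε hind (w := W k) (w' := W l)
    (c := fun u => ∑ t, b t * W t u) hR1 (μ := R * ν) (by positivity) hKR (hWν k) (hWν l)
    (fun u => (hW.abs_comb_le b u).trans (by
      rw [← hΛdef, ← mul_assoc]; gcongr)) (hW2 k) (hW2 l)
    ((hW.sum_comb_sq_le b).trans (by rw [← hΛdef]; gcongr))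
  rw [NearlyOrthogonal.gaussTerm]
  refine h.trans (le_of_eq ?_)
  ring

theorem integrable_linear_mul_cos (hε : ∀ u, IsStandardized P (ε u) K) (k l : τ) (a : τ → ℝ)
    (θ : ℝ) :
    Integrable (fun p : Ω × (τ → ℝ) => ((∑ u, W k u * ε u p.1) * ∑ u, W l u * ε u p.1) *
      Real.cos (θ * ∑ t, a t * p.2 t * ∑ u, W t u * ε u p.1)) (P.prod (stdGaussianPi τ)) := by
  have hm := fun u => (hε u).measurable
  have h : Integrable (fun ω => (∑ u, W k u * ε u ω) * ∑ u, W l u * ε u ω) P :=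
    (memLp_two_linear hε (W k)).integrable_mul (memLp_two_linear hε (W l))
  refine (h.abs.comp_fst (stdGaussianPi τ)).mono'
    (Measurable.aestronglyMeasurable (by fun_prop)) (ae_of_all _ fun p => ?_)
  rw [norm_mul, Real.norm_eq_abs, Real.norm_eq_abs]
  exact mul_le_of_le_one_right (abs_nonneg _) (Real.abs_cos_le_one _)

/-- Bound on the Laplace transform `E[x_k x_l exp (-s ∑ a² x²)]`. -/
theorem abs_integral_mul_mul_exp_le (hε : ∀ u, IsStandardized P (ε u) K) (hind : iIndepFun ε P)
    (hK : 0 ≤ K) (hW : NearlyOrthogonal W β ν) {k l : τ} (hkl : k ≠ l) {a : τ → ℝ}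
    (ha : ∀ t, 0 ≤ a t) {s : ℝ} (hs : 0 ≤ s) :
    |∫ ω, ((∑ u, W k u * ε u ω) * ∑ u, W l u * ε u ω) *
        Real.exp (-(s * ∑ t, a t ^ 2 * (∑ u, W t u * ε u ω) ^ 2)) ∂P| ≤
      407 * (K + β) ^ 12 * (1 + gaussMoment) * (1 + Real.sqrt (2 * s) * ∑ t, a t) ^ 12 * ν ^ 2 := by
  classical
  set θ := Real.sqrt (2 * s) with hθdef
  have hθ : 0 ≤ θ := Real.sqrt_nonneg _
  have hβ := hW.one_le
  have hν := hW.nonneg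
  have hint := integrable_linear_mul_cos (W := W) hε k l a θ
  set h : (τ → ℝ) → ℝ := fun z => ∫ ω, ((∑ u, W k u * ε u ω) * ∑ u, W l u * ε u ω) *
    Real.cos (θ * ∑ t, a t * z t * ∑ u, W t u * ε u ω) ∂P with hhdef
  -- Linearize the exponential and exchange the expectation with the Gaussian average.
  have hswap : ∫ ω, ((∑ u, W k u * ε u ω) * ∑ u, W l u * ε u ω) *
      Real.exp (-(s * ∑ t, a t ^ 2 * (∑ u, W t u * ε u ω) ^ 2)) ∂P =
      ∫ z, h z ∂(stdGaussianPi τ) := by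
    rw [hhdef, ← integral_integral_swap hint]
    congr 1
    ext ω
    rw [integral_const_mul, exp_neg_mul_sum_eq a _ hs]
  have hh : Integrable h (stdGaussianPi τ) := hint.integral_prod_right
  set F : (τ → ℝ) → ℝ := fun z => NearlyOrthogonal.gaussTerm W k l fun t => θ * (a t * z t)
    with hFdef
  set r : (τ → ℝ) → ℝ := fun z => (1 + θ * ∑ t, a t * |z t|) ^ 12 with hrdef
  have hr : Integrable r (stdGaussianPi τ) := integrable_one_add_sum_pow ha hθ
  have hΛ : ∀ z : τ → ℝ, ∑ t, |θ * (a t * z t)| = θ * ∑ t, a t * |z t| := by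
    intro z
    rw [Finset.mul_sum]
    refine Finset.sum_congr rfl fun t _ => ?_
    rw [abs_mul, abs_mul, abs_of_nonneg hθ, abs_of_nonneg (ha t)]
  have hhF : ∀ z, |h z - F z| ≤ 400 * (K + β) ^ 12 * ν ^ 2 * r z := by
    intro z
    have h1 := abs_integral_cos_sub_gaussTerm_le hε hind hK hW k l fun t => θ * (a t * z t)
    rw [hΛ] at h1
    have e : ∀ x : τ → ℝ, ∑ t, θ * (a t * z t) * x t = θ * ∑ t, a t * z t * x t := by
      intro x
      rw [Finset.mul_sum]
      exact Finset.sum_congr rfl fun t _ => by ring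
    simp only [e] at h1
    refine h1.trans (le_of_eq ?_)
    rw [hrdef]
    ring
  have hFc : Continuous F := by
    rw [hFdef]
    unfold NearlyOrthogonal.gaussTerm
    fun_prop
  have hF : Integrable F (stdGaussianPi τ) := by
    refine (hh.abs.add (hr.const_mul (400 * (K + β) ^ 12 * ν ^ 2))).mono'
      hFc.aestronglyMeasurable (ae_of_all _ fun z => ?_)
    have h1 := hhF z
    have h2 := abs_sub_abs_le_abs_sub (F z) (h z)
    rw [abs_sub_comm] at h2
    simp only [Pi.add_apply, Real.norm_eq_abs]
    linarith
  set f : (τ → ℝ) → (τ → ℝ) := fun z t => if t = k then -z t else z t with hfdef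
  have hf := measurePreserving_flip_stdGaussianPi k
  have hFf : Integrable (fun z => F (f z)) (stdGaussianPi τ) := hf.integrable_comp_of_integrable hF
  -- By invariance of the Gaussian measure under the flip, `2 ∫ F = ∫ (F + F ∘ f)`, and that
  -- integrand nearly cancels.
  have hFfeq : ∫ z, F (f z) ∂(stdGaussianPi τ) = ∫ z, F z ∂(stdGaussianPi τ) := by
    have h1 := integral_map (μ := stdGaussianPi τ) hf.measurable.aemeasurable
      (f := F) hFc.aestronglyMeasurable
    rw [hf.map_eq] at h1
    exact h1.symm
  have hpair : ∀ z, |F z + F (f z)| ≤ 14 * (K + β) ^ 12 * ν ^ 2 * r z := by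
    intro z
    have h1 := hW.abs_gaussTerm_add_reflection_le hkl fun t => θ * (a t * z t)
    have e : (fun t => if t = k then -(θ * (a t * z t)) else θ * (a t * z t)) =
        fun t => θ * (a t * f z t) := by
      ext t
      simp only [hfdef]
      split_ifs <;> ring
    rw [e, hΛ] at h1
    refine h1.trans ?_
    have hΛ0 : 0 ≤ θ * ∑ t, a t * |z t| :=
      mul_nonneg hθ (Finset.sum_nonneg fun t _ => mul_nonneg (ha t) (abs_nonneg _))
    rw [hrdef]
    set Λ := θ * ∑ t, a t * |z t|
    calc 14 * (β * (1 + Λ)) ^ 5 * ν ^ 2 ≤ 14 * ((K + β) * (1 + Λ)) ^ 12 * ν ^ 2 := by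
          gcongr 14 * ?_ * _
          have h2 : β * (1 + Λ) ≤ (K + β) * (1 + Λ) := by gcongr; linarith
          refine (pow_le_pow_left₀ (by positivity) h2 5).trans
            (pow_le_pow_right₀ ?_ (by norm_num))
          nlinarith
      _ = _ := by ring
  have hrI := integral_one_add_sum_pow_le ha hθ
  have b1 : |∫ z, h z ∂(stdGaussianPi τ) - ∫ z, F z ∂(stdGaussianPi τ)| ≤
      400 * (K + β) ^ 12 * ν ^ 2 * ∫ z, r z ∂(stdGaussianPi τ) := by
    rw [← integral_sub hh hF, ← integral_const_mul]
    exact norm_integral_le_of_norm_le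
      (hr.const_mul _) (ae_of_all _ fun z => (Real.norm_eq_abs _).trans_le (hhF z))
  have b2 : |∫ z, F z ∂(stdGaussianPi τ) + ∫ z, F z ∂(stdGaussianPi τ)| ≤
      14 * (K + β) ^ 12 * ν ^ 2 * ∫ z, r z ∂(stdGaussianPi τ) := by
    nth_rewrite 2 [← hFfeq]
    rw [← integral_add hF hFf, ← integral_const_mul]
    exact norm_integral_le_of_norm_le
      (hr.const_mul _) (ae_of_all _ fun z => (Real.norm_eq_abs _).trans_le (hpair z))
  rw [hswap]
  -- The constant is `400 + 14/2`: approximation error plus half the reflection bound.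
  have b3 : |∫ z, h z ∂(stdGaussianPi τ)| ≤
      407 * (K + β) ^ 12 * ν ^ 2 * ∫ z, r z ∂(stdGaussianPi τ) := by
    rw [← two_mul, abs_mul, abs_two] at b2
    have := abs_sub_abs_le_abs_sub (∫ z, h z ∂(stdGaussianPi τ)) (∫ z, F z ∂(stdGaussianPi τ))
    linarith
  refine b3.trans ?_
  calc _ ≤ 407 * (K + β) ^ 12 * ν ^ 2 * ((1 + gaussMoment) * (1 + θ * ∑ t, a t) ^ 12) := by
        gcongr
    _ = _ := by ring

end LaplaceTransform

/-! ### Decay of `E exp(-sD)`. -/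

namespace NearlyOrthogonal

variable {τ U : Type*} [Fintype τ] [Fintype U] {W : τ → U → ℝ} {β ν : ℝ}

/-- Diagonal dominance: the off-diagonal part is at most `(∑|b_t|)² β ν²`, hence at most `card τ · β
ν² · ∑ b_t²`. Since the number of modes enters here, this is applied only to a fixed number of them.
-/
theorem half_mul_sum_sq_le (hW : NearlyOrthogonal W β ν) {δ : ℝ} (hδ : ∀ t, δ ≤ ∑ u, W t u ^ 2)
    (hsmall : 2 * (Fintype.card τ * (β * ν ^ 2)) ≤ δ) (b : τ → ℝ) :
    δ / 2 * ∑ t, b t ^ 2 ≤ ∑ u, (∑ t, b t * W t u) ^ 2 := by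
  have hβ := hW.one_le
  have e : ∑ u, (∑ t, b t * W t u) ^ 2 = ∑ t, b t * ∑ u, W t u * ∑ t', b t' * W t' u := by
    rw [comb_swap b W fun u => ∑ t', b t' * W t' u]
    simp only [pow_two]
  set Λ := ∑ t, |b t| with hΛ
  have h1 : ∀ t, δ * b t ^ 2 - |b t| * (Λ * (β * ν ^ 2)) ≤
      b t * ∑ u, W t u * ∑ t', b t' * W t' u := by
    intro t
    have h2 := hW.abs_sum_mul_comb_sub_le b t
    have h3 : |b t * (∑ u, W t u * ∑ t', b t' * W t' u - b t * ∑ u, W t u ^ 2)| ≤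
        |b t| * (Λ * (β * ν ^ 2)) := by rw [abs_mul]; gcongr
    have h4 := (_root_.abs_le.1 h3).1
    have h5 := mul_le_mul_of_nonneg_right (hδ t) (sq_nonneg (b t))
    nlinarith
  have h2 := Finset.sum_le_sum fun t (_ : t ∈ Finset.univ) => h1 t
  rw [Finset.sum_sub_distrib, ← Finset.mul_sum, ← Finset.sum_mul, ← hΛ, ← e] at h2
  have h3 : Λ ^ 2 ≤ Fintype.card τ * ∑ t, b t ^ 2 := by
    have := sq_sum_le_card_mul_sum_sq (s := Finset.univ) (f := fun t => |b t|)
    simpa only [sq_abs, Finset.card_univ] using this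
  have h4 : Λ ^ 2 * (β * ν ^ 2) ≤ Fintype.card τ * (∑ t, b t ^ 2) * (β * ν ^ 2) := by
    gcongr
  have h5 : 0 ≤ ∑ t, b t ^ 2 := Finset.sum_nonneg fun t _ => sq_nonneg _
  nlinarith

end NearlyOrthogonal

section Tail

variable {Ω τ U : Type*} [MeasurableSpace Ω] {P : Measure Ω} [IsProbabilityMeasure P] [Fintype τ]
  [Fintype U] {ε : U → Ω → ℝ} {W : τ → U → ℝ} {K β ν : ℝ}

theorem integral_cos_le_prod_norm (hm : ∀ u, Measurable (ε u)) (hind : iIndepFun ε P) (c : U → ℝ) :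
    ∫ ω, Real.cos (∑ u, c u * ε u ω) ∂P ≤ ∏ u, ‖charMoment P (ε u) 0 (c u)‖ := by
  have hi : Integrable (fun ω => Complex.exp (Complex.I * ((∑ u, c u * ε u ω : ℝ) : ℂ))) P := by
    refine (integrable_const (1 : ℝ)).mono' (by fun_prop) (ae_of_all _ fun z => ?_)
    rw [Complex.norm_exp_I_mul_ofReal]
  have h := Complex.reCLM.integral_comp_comm hi
  rw [← norm_integral_exp_eq hm hind]
  refine le_trans (le_of_eq ?_) (Complex.re_le_norm _)
  rw [Complex.reCLM_apply] at h
  rw [← h]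
  congr 1
  ext z
  rw [Complex.reCLM_apply, mul_comm Complex.I, Complex.exp_ofReal_mul_I_re]

/-- Either all coefficients lie where the characteristic functions have Gaussian decay, or one is so
large that `μ^12 ≥ 1` and the bound is trivial. No decay of characteristic functions away from the
origin is needed. -/
theorem prod_norm_char_le (hε : ∀ u, IsStandardized P (ε u) K) {c : U → ℝ} {μ : ℝ}
    (hc : ∀ u, 16 * K * |c u| ≤ μ) :
    ∏ u, ‖charMoment P (ε u) 0 (c u)‖ ≤ Real.exp (-((∑ u, c u ^ 2) / 4)) + μ ^ 12 := by
  by_cases h : ∀ u, 16 * K * |c u| ≤ 1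
  · have h1 : ∏ u, ‖charMoment P (ε u) 0 (c u)‖ ≤ ∏ u, Real.exp (-(c u ^ 2 / 4)) :=
      Finset.prod_le_prod (fun u _ => norm_nonneg _) fun u _ => (hε u).norm_char_le_exp (h u)
    rw [← Real.exp_sum, Finset.sum_neg_distrib, ← Finset.sum_div] at h1
    have : 0 ≤ μ ^ 12 := by positivity
    linarith
  · push Not at h
    obtain ⟨u, hu⟩ := h
    have h1 : 1 ≤ μ ^ 12 := one_le_pow₀ (hu.le.trans (hc u))
    have h2 : ∏ u, ‖charMoment P (ε u) 0 (c u)‖ ≤ 1 :=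
      Finset.prod_le_one (fun _ _ => norm_nonneg _) fun u _ => IsStandardized.norm_char_le_one _ _
    have := Real.exp_pos (-((∑ u, c u ^ 2) / 4))
    linarith

/-- After linearization, the characteristic function at `∑ b_t W_t` is dominated by a Gaussian in
`z`, by diagonal dominance. Integrating over `z` gives a factor of order `s^{-1/2}` per mode; large
coefficients cost only `ν^12`. -/
theorem integral_exp_neg_mul_sum_le (hε : ∀ u, IsStandardized P (ε u) K) (hind : iIndepFun ε P)
    (hK : 0 ≤ K) (hW : NearlyOrthogonal W β ν) {δ : ℝ} (hδ0 : 0 < δ)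
    (hδ : ∀ t, δ ≤ ∑ u, W t u ^ 2) (hsmall : 2 * (Fintype.card τ * (β * ν ^ 2)) ≤ δ) {a : τ → ℝ}
    {α : ℝ} (hα : 0 < α) (ha : ∀ t, α ≤ a t) {s : ℝ} (hs : 0 < s) :
    ∫ ω, Real.exp (-(s * ∑ t, a t ^ 2 * (∑ u, W t u * ε u ω) ^ 2)) ∂P ≤
      (1 / Real.sqrt (s * δ * α ^ 2 / 2)) ^ Fintype.card τ +
        (16 * K * (β * ν)) ^ 12 * ((1 + gaussMoment) * (1 + Real.sqrt (2 * s) * ∑ t, a t) ^ 12) := by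
  set θ := Real.sqrt (2 * s) with hθdef
  have hθ : 0 ≤ θ := Real.sqrt_nonneg _
  have hβ := hW.one_le
  have hν := hW.nonneg
  have ha0 : ∀ t, 0 ≤ a t := fun t => hα.le.trans (ha t)
  have hm := fun u => (hε u).measurable
  have hint : Integrable (fun p : Ω × (τ → ℝ) =>
      Real.cos (θ * ∑ t, a t * p.2 t * ∑ u, W t u * ε u p.1)) (P.prod (stdGaussianPi τ)) := by
    refine (integrable_const (1 : ℝ)).mono' (Measurable.aestronglyMeasurable (by fun_prop))
      (ae_of_all _ fun p => ?_)
    exact Real.abs_cos_le_one _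
  have hswap : ∫ ω, Real.exp (-(s * ∑ t, a t ^ 2 * (∑ u, W t u * ε u ω) ^ 2)) ∂P =
      ∫ z, ∫ ω, Real.cos (θ * ∑ t, a t * z t * ∑ u, W t u * ε u ω) ∂P ∂(stdGaussianPi τ) := by
    rw [← integral_integral_swap hint]
    congr 1
    ext ω
    rw [exp_neg_mul_sum_eq a _ hs.le]
  set r : (τ → ℝ) → ℝ := fun z => (1 + θ * ∑ t, a t * |z t|) ^ 12 with hrdef
  have hr : Integrable r (stdGaussianPi τ) := integrable_one_add_sum_pow ha0 hθ
  have hq : Integrable (fun z : τ → ℝ => Real.exp (-∑ t, (s * δ / 4 * a t ^ 2) * z t ^ 2))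
      (stdGaussianPi τ) := by
    refine (integrable_const (1 : ℝ)).mono' (Continuous.aestronglyMeasurable (by fun_prop))
      (ae_of_all _ fun z => ?_)
    rw [Real.norm_of_nonneg (Real.exp_pos _).le, Real.exp_le_one_iff, neg_nonpos]
    exact Finset.sum_nonneg fun t _ => by positivity
  have hpt : ∀ z : τ → ℝ, ∫ ω, Real.cos (θ * ∑ t, a t * z t * ∑ u, W t u * ε u ω) ∂P ≤
      Real.exp (-∑ t, (s * δ / 4 * a t ^ 2) * z t ^ 2) + (16 * K * (β * ν)) ^ 12 * r z := by
    intro z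
    set b : τ → ℝ := fun t => θ * (a t * z t) with hb
    have e : ∀ ω, θ * ∑ t, a t * z t * ∑ u, W t u * ε u ω =
        ∑ u, (∑ t, b t * W t u) * ε u ω := by
      intro ω
      rw [← comb_swap b W fun u => ε u ω, Finset.mul_sum]
      exact Finset.sum_congr rfl fun t _ => by rw [hb]; ring
    have hΛ : ∑ t, |b t| = θ * ∑ t, a t * |z t| := by
      rw [Finset.mul_sum]
      refine Finset.sum_congr rfl fun t _ => ?_
      rw [hb, abs_mul, abs_mul, abs_of_nonneg hθ, abs_of_nonneg (ha0 t)]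
    have hΛ0 : 0 ≤ ∑ t, |b t| := Finset.sum_nonneg fun t _ => abs_nonneg _
    simp only [e]
    -- Using `1 + ∑ |b_t|` in place of `∑ |b_t|` turns `μ^12` into a constant times `r z`.
    refine (integral_cos_le_prod_norm hm hind _).trans ((prod_norm_char_le hε
      (μ := 16 * K * (β * ν) * (1 + ∑ t, |b t|)) fun u => ?_).trans ?_)
    · have := hW.abs_comb_le b u
      calc _ ≤ 16 * K * ((∑ t, |b t|) * (β * ν)) := by gcongr
        _ ≤ 16 * K * ((1 + ∑ t, |b t|) * (β * ν)) := by gcongr; linarith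
        _ = _ := by ring
    · have h1 := hW.half_mul_sum_sq_le hδ hsmall b
      have h2 : δ / 2 * ∑ t, b t ^ 2 = 4 * ∑ t, (s * δ / 4 * a t ^ 2) * z t ^ 2 := by
        rw [Finset.mul_sum, Finset.mul_sum]
        refine Finset.sum_congr rfl fun t _ => ?_
        rw [hb]
        simp only [mul_pow, hθdef]
        rw [Real.sq_sqrt (by positivity)]
        ring
      rw [mul_pow, hΛ]
      gcongr
      linarith
  rw [hswap]
  refine (integral_mono hint.integral_prod_right (hq.add (hr.const_mul _)) hpt).trans ?_
  have h1 := integral_exp_neg_sum_sq_le (τ := τ) (q := fun t => s * δ / 4 * a t ^ 2)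
    (q₀ := s * δ / 4 * α ^ 2) (by positivity) fun t => by
      have := ha t
      gcongr
  have h2 := integral_one_add_sum_pow_le ha0 hθ
  simp only [Pi.add_apply]
  rw [integral_add hq (hr.const_mul _), integral_const_mul]
  rw [show 2 * (s * δ / 4 * α ^ 2) = s * δ * α ^ 2 / 2 by ring] at h1
  gcongr

end Tail

/-! ### From Laplace transforms to the expectation of the ratio. -/

section Ratio

/-- AM-GM applied to the two terms `k` and `l` of the denominator. If the denominator vanishes the
quotient is `0` by convention, so the bound holds at every point. -/
theorem abs_mul_div_sum_le {τ : Type*} {s : Finset τ} {k l : τ} (hk : k ∈ s) (hl : l ∈ s)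
    (hkl : k ≠ l) {a : τ → ℝ} (hak : 0 < a k) (hal : 0 < a l) (x : τ → ℝ) :
    |x k * x l / ∑ t ∈ s, a t ^ 2 * x t ^ 2| ≤ 1 / (2 * a k * a l) := by
  classical
  have hD : 0 ≤ ∑ t ∈ s, a t ^ 2 * x t ^ 2 := Finset.sum_nonneg fun t _ => by positivity
  rcases hD.eq_or_lt with h | h
  · rw [← h, div_zero, abs_zero]; positivity
  rw [abs_div, abs_of_pos h, div_le_div_iff₀ h (by positivity), one_mul]
  have h1 : a k ^ 2 * x k ^ 2 + a l ^ 2 * x l ^ 2 ≤ ∑ t ∈ s, a t ^ 2 * x t ^ 2 := by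
    rw [← Finset.sum_pair (f := fun t => a t ^ 2 * x t ^ 2) hkl]
    refine Finset.sum_le_sum_of_subset_of_nonneg ?_ fun t _ _ => by positivity
    intro t ht
    rcases Finset.mem_insert.1 ht with rfl | ht
    · exact hk
    · rwa [Finset.mem_singleton.1 ht]
  refine le_trans ?_ h1
  rw [abs_mul]
  nlinarith [sq_nonneg (a k * |x k| - a l * |x l|), sq_abs (x k), sq_abs (x l)]

/-- Integrates `X exp(-sD)` exactly. The hypothesis makes the identity survive at `D = 0`, where `X
/ D` is `0` by convention but the integral would be `S X`. -/
theorem div_eq_integral_add {X D : ℝ} (hX : D = 0 → X = 0) (S : ℝ) :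
    X / D = (∫ s in (0 : ℝ)..S, X * Real.exp (-(s * D))) + X / D * Real.exp (-(S * D)) := by
  rcases eq_or_ne D 0 with h | h
  · simp [hX h]
  have h1 : ∫ s in (0 : ℝ)..S, X * Real.exp (-(s * D)) =
      -(X / D * Real.exp (-(S * D))) - -(X / D * Real.exp (-(0 * D))) := by
    refine intervalIntegral.integral_eq_sub_of_hasDerivAt
      (f := fun s => -(X / D * Real.exp (-(s * D)))) (fun s _ => ?_)
      (Continuous.intervalIntegrable (by fun_prop) _ _)
    have h2 : HasDerivAt (fun s : ℝ => -(s * D)) (-(1 * D)) s :=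
      ((hasDerivAt_id s).mul_const D).neg
    have h3 := ((h2.exp).const_mul (X / D)).neg
    refine h3.congr_deriv ?_
    field_simp
  rw [h1]
  simp

variable {Ω τ τ' U : Type*} [MeasurableSpace Ω] {P : Measure Ω} [IsProbabilityMeasure P]
  [Fintype U] {ε : U → Ω → ℝ} {W : τ → U → ℝ} {K β ν : ℝ}

theorem NearlyOrthogonal.comp (hW : NearlyOrthogonal W β ν) {ι : τ' → τ}
    (hι : Function.Injective ι) : NearlyOrthogonal (W ∘ ι) β ν where
  one_le := hW.one_le
  nonneg := hW.nonneg
  le_one := hW.le_one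
  abs_le _ u := hW.abs_le _ u
  sq_le _ := hW.sq_le _
  off_le _ _ h := hW.off_le _ _ (hι.ne h)

variable [Fintype τ] [Fintype τ']

/-- Bound on `E[x_k x_l / ∑ a² x²]` in which `S` is the point where the Laplace integral is cut;
the modes in the range of `ι` control the tail. -/
theorem abs_integral_ratio_le (hε : ∀ u, IsStandardized P (ε u) K) (hind : iIndepFun ε P)
    (hK : 0 ≤ K) (hW : NearlyOrthogonal W β ν) {k l : τ} (hkl : k ≠ l) {a : τ → ℝ}
    (ha : ∀ t, 0 < a t) {ι : τ' → τ} (hι : Function.Injective ι) {δ : ℝ} (hδ0 : 0 < δ)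
    (hδ : ∀ t, δ ≤ ∑ u, W (ι t) u ^ 2) (hsmall : 2 * (Fintype.card τ' * (β * ν ^ 2)) ≤ δ)
    {α : ℝ} (hα : 0 < α) (haα : ∀ t, α ≤ a (ι t)) {S : ℝ} (hS : 0 < S) :
    |∫ ω, (∑ u, W k u * ε u ω) * (∑ u, W l u * ε u ω) /
        ∑ t, a t ^ 2 * (∑ u, W t u * ε u ω) ^ 2 ∂P| ≤
      407 * (K + β) ^ 12 * (1 + gaussMoment) * (1 + Real.sqrt (2 * S) * ∑ t, a t) ^ 12 * ν ^ 2 * S +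
      1 / (2 * a k * a l) * ((1 / Real.sqrt (S * δ * α ^ 2 / 2)) ^ Fintype.card τ' +
        (16 * K * (β * ν)) ^ 12 *
          ((1 + gaussMoment) * (1 + Real.sqrt (2 * S) * ∑ t, a t) ^ 12)) := by
  classical
  have hm := fun u => (hε u).measurable
  set x : τ → Ω → ℝ := fun t ω => ∑ u, W t u * ε u ω with hx
  set D : Ω → ℝ := fun ω => ∑ t, a t ^ 2 * x t ω ^ 2 with hD
  have hD0 : ∀ ω, 0 ≤ D ω := fun ω => Finset.sum_nonneg fun t _ => by positivity
  have hxm : ∀ t, Measurable (x t) := fun t => by rw [hx]; fun_prop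
  have hDm : Measurable D := by rw [hD]; fun_prop
  have hA : 0 ≤ ∑ t, a t := Finset.sum_nonneg fun t _ => (ha t).le
  have hG := gaussMoment_nonneg
  have hβ := hW.one_le
  have hXi : Integrable (fun ω => x k ω * x l ω) P :=
    (memLp_two_linear hε (W k)).integrable_mul (memLp_two_linear hε (W l))
  have hzero : ∀ ω, D ω = 0 → x k ω * x l ω = 0 := by
    intro ω h
    have h1 := (Finset.sum_eq_zero_iff_of_nonneg fun t _ => by positivity).1 h k
      (Finset.mem_univ k)
    have : x k ω = 0 := by
      rcases mul_eq_zero.1 h1 with h2 | h2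
      · exact absurd h2 (pow_ne_zero 2 (ha k).ne')
      · exact pow_eq_zero_iff (two_ne_zero) |>.1 h2
    rw [this, zero_mul]
  have hexp1 : ∀ s : ℝ, 0 ≤ s → ∀ ω, Real.exp (-(s * D ω)) ≤ 1 := fun s hs ω =>
    Real.exp_le_one_iff.2 (neg_nonpos.2 (mul_nonneg hs (hD0 ω)))
  have hint : Integrable (fun p : Ω × ℝ => x k p.1 * x l p.1 * Real.exp (-(p.2 * D p.1)))
      (P.prod (volume.restrict (Set.Ioc 0 S))) := by
    refine (hXi.abs.comp_fst (volume.restrict (Set.Ioc 0 S))).mono'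
      (Measurable.aestronglyMeasurable (by fun_prop)) ?_
    have h1 : ∀ᵐ p : Ω × ℝ ∂(P.prod (volume.restrict (Set.Ioc 0 S))), p.2 ∈ Set.Ioc 0 S :=
      Measure.quasiMeasurePreserving_snd.ae (ae_restrict_mem measurableSet_Ioc)
    filter_upwards [h1] with p hp
    rw [norm_mul, Real.norm_eq_abs, Real.norm_of_nonneg (Real.exp_pos _).le]
    exact mul_le_of_le_one_right (abs_nonneg _) (hexp1 _ hp.1.le _)
  have hswap : ∫ ω, (∫ s in (0 : ℝ)..S, x k ω * x l ω * Real.exp (-(s * D ω))) ∂P =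
      ∫ s in (0 : ℝ)..S, ∫ ω, x k ω * x l ω * Real.exp (-(s * D ω)) ∂P := by
    simp only [intervalIntegral.integral_of_le hS.le]
    exact integral_integral_swap hint
  have hi1 : Integrable (fun ω => ∫ s in (0 : ℝ)..S, x k ω * x l ω * Real.exp (-(s * D ω))) P := by
    simp only [intervalIntegral.integral_of_le hS.le]
    exact hint.integral_prod_left
  have hratio : ∀ ω, |x k ω * x l ω / D ω| ≤ 1 / (2 * a k * a l) := fun ω =>
    abs_mul_div_sum_le (Finset.mem_univ k) (Finset.mem_univ l) hkl (ha k) (ha l) fun t => x t ω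
  have hEi : Integrable (fun ω => Real.exp (-(S * D ω))) P :=
    (integrable_const (1 : ℝ)).mono' (by fun_prop) (ae_of_all _ fun ω => by
      rw [Real.norm_of_nonneg (Real.exp_pos _).le]; exact hexp1 S hS.le ω)
  have hbd : ∀ ω, ‖x k ω * x l ω / D ω * Real.exp (-(S * D ω))‖ ≤
      1 / (2 * a k * a l) * Real.exp (-(S * D ω)) := by
    intro ω
    rw [norm_mul, Real.norm_of_nonneg (Real.exp_pos _).le]
    gcongr
    exact hratio ω
  have hi2 : Integrable (fun ω => x k ω * x l ω / D ω * Real.exp (-(S * D ω))) P :=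
    (hEi.const_mul _).mono' (Measurable.aestronglyMeasurable (by fun_prop)) (ae_of_all _ hbd)
  have hsplit : ∫ ω, x k ω * x l ω / D ω ∂P =
      (∫ s in (0 : ℝ)..S, ∫ ω, x k ω * x l ω * Real.exp (-(s * D ω)) ∂P) +
        ∫ ω, x k ω * x l ω / D ω * Real.exp (-(S * D ω)) ∂P := by
    rw [← hswap, ← integral_add hi1 hi2]
    congr 1
    ext ω
    exact div_eq_integral_add (hzero ω) S
  rw [hsplit]
  -- On `[0, S]` the Laplace bound is used at each `s`; the cut-off term is the uniform bound on the
  -- ratio times `E exp(-SD)`.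
  refine (abs_add_le _ _).trans (add_le_add ?_ ?_)
  · have h1 := intervalIntegral.norm_integral_le_of_norm_le_const (a := 0) (b := S)
      (f := fun s => ∫ ω, x k ω * x l ω * Real.exp (-(s * D ω)) ∂P)
      (C := 407 * (K + β) ^ 12 * (1 + gaussMoment) * (1 + Real.sqrt (2 * S) * ∑ t, a t) ^ 12 *
        ν ^ 2) fun s hs => by
      rw [Set.uIoc_of_le hS.le] at hs
      refine (abs_integral_mul_mul_exp_le hε hind hK hW hkl (fun t => (ha t).le) hs.1.le).trans ?_
      have := hs.2
      gcongr
    rwa [sub_zero, abs_of_pos hS, Real.norm_eq_abs] at h1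
  · refine (norm_integral_le_of_norm_le (hEi.const_mul _) (ae_of_all _ hbd)).trans ?_
    rw [integral_const_mul]
    have := ha k
    have := ha l
    gcongr
    -- Dropping modes decreases `D` and so increases `exp(-SD)`; lower bounds on the Gram diagonal
    -- are thus needed only for the modes kept.
    have hD' : ∀ ω, ∑ t, a (ι t) ^ 2 * x (ι t) ω ^ 2 ≤ D ω := by
      intro ω
      rw [← Finset.sum_image (f := fun t => a t ^ 2 * x t ω ^ 2) (s := Finset.univ)
        (hι.injOn)]
      exact Finset.sum_le_sum_of_subset_of_nonneg (Finset.subset_univ _) fun t _ _ => by positivity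
    have hA' : ∑ t, a (ι t) ≤ ∑ t, a t := by
      rw [← Finset.sum_image (f := a) (s := Finset.univ) (hι.injOn)]
      exact Finset.sum_le_sum_of_subset_of_nonneg (Finset.subset_univ _) fun t _ _ => (ha t).le
    have h1 : ∫ ω, Real.exp (-(S * D ω)) ∂P ≤
        ∫ ω, Real.exp (-(S * ∑ t, a (ι t) ^ 2 * x (ι t) ω ^ 2)) ∂P := by
      refine integral_mono hEi ?_ fun ω => ?_
      · refine (integrable_const (1 : ℝ)).mono' (by fun_prop) (ae_of_all _ fun ω => ?_)
        rw [Real.norm_of_nonneg (Real.exp_pos _).le, Real.exp_le_one_iff, neg_nonpos]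
        exact mul_nonneg hS.le (Finset.sum_nonneg fun t _ => by positivity)
      · simp only
        gcongr
        exact hD' ω
    have h2 := integral_exp_neg_mul_sum_le hε hind hK (hW.comp hι) hδ0 hδ hsmall
      (a := fun t => a (ι t)) hα haα hS
    refine h1.trans (h2.trans ?_)
    have hA'0 : 0 ≤ ∑ t, a (ι t) := Finset.sum_nonneg fun t _ => (ha _).le
    gcongr

end Ratio

/-! ### Choice of the parameters. -/

theorem sum_le_one_add_log {T : ℕ} (hT : 1 ≤ T) {a : ℕ → ℝ}
    (ha : ∀ t ∈ Finset.Icc 1 (T - 1), a t ≤ 2 / t) :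
    ∑ t ∈ Finset.Icc 1 (T - 1), a t ≤ 2 * (1 + Real.log T) := by
  have h1 : ∑ t ∈ Finset.Icc 1 (T - 1), a t ≤ ∑ t ∈ Finset.Icc 1 T, 2 * ((t : ℝ))⁻¹ := by
    refine (Finset.sum_le_sum ha).trans ?_
    simp only [div_eq_mul_inv]
    exact Finset.sum_le_sum_of_subset_of_nonneg (Finset.Icc_subset_Icc_right (by omega))
      fun t _ _ => by positivity
  have h2 := harmonic_le_one_add_log T
  rw [harmonic_eq_sum_Icc] at h2
  push_cast at h2
  rw [← Finset.mul_sum] at h1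
  linarith

/-- The error terms, expressed through `S` with `S ^ 100 = T`, are at most `S⁻¹ ^ 50`. -/
theorem error_terms_le {c₁ c₂ c₃ S A r h ν : ℝ} (hc₁ : 0 ≤ c₁) (hc₂ : 0 ≤ c₂) (hc₃ : 0 ≤ c₃)
    (hS : 1 ≤ S) (hA0 : 0 ≤ A) (hA : A ≤ 405 * S ^ 2) (hν : ν ^ 2 = (S⁻¹) ^ 100) (hrS : r ≤ 2 * S ^ 200) (hh : h ≤ c₂ * (S⁻¹) ^ 300) (hh0 : 0 ≤ h)
    (hSc : c₁ * 405 ^ 12 + 2 * c₂ + 2 * (c₃ * 405 ^ 12) ≤ S) :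
    c₁ * A ^ 12 * ν ^ 2 * S + r * (h + c₃ * ν ^ 12 * A ^ 12) ≤ (S⁻¹) ^ 50 := by
  have hS0 : 0 < S := by linarith
  have hi0 : 0 ≤ S⁻¹ := by positivity
  have hi1 : S⁻¹ ≤ 1 := inv_le_one_of_one_le₀ hS
  have hSi : ∀ n : ℕ, S ^ n * (S⁻¹) ^ n = 1 := fun n => by
    rw [← mul_pow, mul_inv_cancel₀ hS0.ne', one_pow]
  have hA12 : A ^ 12 ≤ 405 ^ 12 * S ^ 24 := by
    calc A ^ 12 ≤ (405 * S ^ 2) ^ 12 := by gcongr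
      _ = _ := by ring
  have hν12 : ν ^ 12 = (S⁻¹) ^ 600 := by
    rw [show ν ^ 12 = (ν ^ 2) ^ 6 by ring, hν, ← pow_mul]
  -- In powers of `S` the three terms have exponents `24 - 100 + 1 = -75`, `200 - 300 = -100` and
  -- `200 - 600 + 24 = -376`. Weakening each to `-51` leaves one factor `S` to absorb the constants.
  have t1 : c₁ * A ^ 12 * ν ^ 2 * S ≤ c₁ * 405 ^ 12 * (S⁻¹) ^ 51 := by
    rw [hν]
    calc _ ≤ c₁ * (405 ^ 12 * S ^ 24) * (S⁻¹) ^ 100 * S := by gcongr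
      _ = c₁ * 405 ^ 12 * (S ^ 25 * (S⁻¹) ^ 25) * ((S⁻¹) ^ 75) := by ring
      _ ≤ c₁ * 405 ^ 12 * 1 * ((S⁻¹) ^ 51) := by
          rw [hSi]
          gcongr ?_ * ?_
          exact pow_le_pow_of_le_one hi0 hi1 (by norm_num)
      _ = _ := by ring
  have t2 : r * h ≤ 2 * c₂ * (S⁻¹) ^ 51 := by
    calc r * h ≤ (2 * S ^ 200) * (c₂ * (S⁻¹) ^ 300) := by gcongr
      _ = 2 * c₂ * (S ^ 200 * (S⁻¹) ^ 200) * (S⁻¹) ^ 100 := by ring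
      _ ≤ 2 * c₂ * 1 * (S⁻¹) ^ 51 := by
          rw [hSi]
          gcongr ?_ * ?_
          exact pow_le_pow_of_le_one hi0 hi1 (by norm_num)
      _ = _ := by ring
  have t3 : r * (c₃ * ν ^ 12 * A ^ 12) ≤ 2 * (c₃ * 405 ^ 12) * (S⁻¹) ^ 51 := by
    rw [hν12]
    calc _ ≤ (2 * S ^ 200) * (c₃ * (S⁻¹) ^ 600 * (405 ^ 12 * S ^ 24)) := by gcongr
      _ = 2 * (c₃ * 405 ^ 12) * (S ^ 224 * (S⁻¹) ^ 224) * (S⁻¹) ^ 376 := by ring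
      _ ≤ 2 * (c₃ * 405 ^ 12) * 1 * (S⁻¹) ^ 51 := by
          rw [hSi]
          gcongr ?_ * ?_
          exact pow_le_pow_of_le_one hi0 hi1 (by norm_num)
      _ = _ := by ring
  calc _ = c₁ * A ^ 12 * ν ^ 2 * S + r * h + r * (c₃ * ν ^ 12 * A ^ 12) := by ring
    _ ≤ (c₁ * 405 ^ 12 + 2 * c₂ + 2 * (c₃ * 405 ^ 12)) * (S⁻¹) ^ 51 := by linarith
    _ ≤ S * (S⁻¹) ^ 51 := by gcongr
    _ = S ^ 1 * (S⁻¹) ^ 1 * (S⁻¹) ^ 50 := by ring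
    _ = _ := by rw [hSi, one_mul]

theorem one_div_sqrt_pow {x : ℝ} (hx : 0 ≤ x) (n : ℕ) :
    (1 / Real.sqrt x) ^ (2 * n) = (1 / x) ^ n := by
  rw [pow_mul, div_pow, Real.sq_sqrt hx, one_pow]

/-- The cut is at `S = T^{1/100}` and the first 600 modes control the tail. The threshold depends
neither on the index type `U` nor on `W`, which allows the truncation lag to tend to infinity later.
-/
theorem exists_forall_abs_integral_ratio_le {K β δ₀ : ℝ} (hK : 0 ≤ K) (hβ : 1 ≤ β) (hδ₀ : 0 < δ₀) :
    ∃ T₀ : ℕ, 2 ≤ T₀ ∧ ∀ T : ℕ, T₀ ≤ T → ∀ (Ω U : Type*) [MeasurableSpace Ω] (P : Measure Ω)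
      [IsProbabilityMeasure P] [Fintype U] (ε : U → Ω → ℝ) (W : ℕ → U → ℝ) (a : ℕ → ℝ),
      (∀ u, IsStandardized P (ε u) K) → iIndepFun ε P →
      NearlyOrthogonal (fun t : Finset.Icc 1 (T - 1) => W t) β (1 / Real.sqrt T) →
      (∀ t ∈ Finset.Icc 1 (T - 1), δ₀ - β * t / T ≤ ∑ u, W t u ^ 2) →
      (∀ t ∈ Finset.Icc 1 (T - 1), a t ≤ 2 / t) → (∀ t ∈ Finset.Icc 1 (T - 1), 1 / (2 * t) ≤ a t) →
      ∀ k ∈ Finset.Icc 1 (T - 1), ∀ l ∈ Finset.Icc 1 (T - 1), k ≠ l →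
        |∫ ω, (∑ u, W k u * ε u ω) * (∑ u, W l u * ε u ω) /
          ∑ t ∈ Finset.Icc 1 (T - 1), a t ^ 2 * (∑ u, W t u * ε u ω) ^ 2 ∂P| ≤
            (T : ℝ) ^ (-(1 / 2) : ℝ) := by
  obtain ⟨c₁, hc₁⟩ : ∃ x : ℝ, x = 407 * (K + β) ^ 12 * (1 + gaussMoment) := ⟨_, rfl⟩
  obtain ⟨c₂, hc₂⟩ : ∃ x : ℝ, x = (1 / (δ₀ / 2 * (1 / 1200) ^ 2 / 2)) ^ 300 := ⟨_, rfl⟩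
  obtain ⟨c₃, hc₃⟩ : ∃ x : ℝ, x = (16 * K * β) ^ 12 * (1 + gaussMoment) := ⟨_, rfl⟩
  have hG := gaussMoment_nonneg
  have hc₁0 : 0 ≤ c₁ := by rw [hc₁]; positivity
  have hc₂0 : 0 ≤ c₂ := by rw [hc₂]; positivity
  have hc₃0 : 0 ≤ c₃ := by rw [hc₃]; positivity
  obtain ⟨c, hc⟩ : ∃ x : ℝ, x = c₁ * 405 ^ 12 + 2 * c₂ + 2 * (c₃ * 405 ^ 12) := ⟨_, rfl⟩
  have hc0 : 0 ≤ c := by rw [hc]; positivity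
  -- The first summand gives `c ≤ S`. The second gives `1200 β / T ≤ δ₀ / 2`, which serves both the
  -- diagonal bound `δ₀ / 2` for modes up to 600 and diagonal dominance. The third makes 600 modes
  -- available.
  refine ⟨⌈c ^ 100⌉₊ + ⌈2400 * β / δ₀⌉₊ + 1000, by omega, ?_⟩
  intro T hT Ω U _ P _ _ ε W a hε hind hW hdiag ha ha' k hk l hl hkl
  have hT1000 : 1000 ≤ T := by omega
  have hTpos : (0 : ℝ) < T := by exact_mod_cast (by omega : 0 < T)
  have hT1 : (1 : ℝ) ≤ T := by exact_mod_cast (by omega : 1 ≤ T)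
  have hTc : c ^ 100 ≤ T := (Nat.le_ceil _).trans (by exact_mod_cast (by omega))
  have hTδ : 2400 * β / δ₀ ≤ T := (Nat.le_ceil _).trans (by exact_mod_cast (by omega))
  obtain ⟨S, hSdef⟩ : ∃ x : ℝ, x = (T : ℝ) ^ ((1 : ℝ) / 100) := ⟨_, rfl⟩
  have hS1 : 1 ≤ S := hSdef ▸ Real.one_le_rpow hT1 (by norm_num)
  have hS0 : 0 < S := by linarith
  have hS100 : S ^ 100 = T := by
    rw [hSdef, ← Real.rpow_natCast, ← Real.rpow_mul hTpos.le]
    norm_num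
  have hcS : c ≤ S := by
    rw [← hS100] at hTc
    exact (pow_le_pow_iff_left₀ hc0 hS0.le (n := 100) (by norm_num)).1 hTc
  have hlog : Real.log T ≤ 100 * S := by
    have := Real.log_le_rpow_div hTpos.le (show (0 : ℝ) < 1 / 100 by norm_num)
    rw [← hSdef] at this
    linarith
  have hν2 : (1 / Real.sqrt T) ^ 2 = (S⁻¹) ^ 100 := by
    rw [div_pow, Real.sq_sqrt hTpos.le, one_pow, inv_pow, hS100, one_div]
  have hν2' : (1 / Real.sqrt T) ^ 2 = 1 / T := by
    rw [div_pow, Real.sq_sqrt hTpos.le, one_pow]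
  have hgoal : (T : ℝ) ^ (-(1 / 2) : ℝ) = (S⁻¹) ^ 50 := by
    rw [hSdef, ← Real.rpow_neg hTpos.le, ← Real.rpow_natCast, ← Real.rpow_mul hTpos.le]
    norm_num
  have hpos : ∀ t ∈ Finset.Icc 1 (T - 1), (0 : ℝ) < t := fun t ht => by
    exact_mod_cast (Finset.mem_Icc.1 ht).1
  have ha0 : ∀ t ∈ Finset.Icc 1 (T - 1), 0 < a t := fun t ht =>
    lt_of_lt_of_le (by have := hpos t ht; positivity) (ha' t ht)
  -- The logarithm is absorbed by `log T ≤ 100 S`: `∑ a_t ≤ 202 S` and `√(2S) ≤ 2S` give `404 S²`,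
  -- plus `1`.
  have hA : 1 + Real.sqrt (2 * S) * ∑ t : Finset.Icc 1 (T - 1), a t ≤ 405 * S ^ 2 := by
    rw [Finset.sum_coe_sort (Finset.Icc 1 (T - 1)) a]
    have h1 := sum_le_one_add_log (by omega : 1 ≤ T) ha
    have h2 : Real.sqrt (2 * S) ≤ 2 * S := by
      rw [Real.sqrt_le_left (by positivity), mul_pow]
      have : S ≤ S ^ 2 := le_self_pow₀ hS1 (by norm_num)
      linarith
    have h3 : ∑ t ∈ Finset.Icc 1 (T - 1), a t ≤ 202 * S := by linarith
    have h4 : 0 ≤ ∑ t ∈ Finset.Icc 1 (T - 1), a t := Finset.sum_nonneg fun t ht => (ha0 t ht).le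
    have h5 : Real.sqrt (2 * S) * ∑ t ∈ Finset.Icc 1 (T - 1), a t ≤ 2 * S * (202 * S) := by
      gcongr
    have h6 : 1 ≤ S ^ 2 := one_le_pow₀ hS1
    linarith
  have hA0 : 0 ≤ 1 + Real.sqrt (2 * S) * ∑ t : Finset.Icc 1 (T - 1), a t := by
    rw [Finset.sum_coe_sort (Finset.Icc 1 (T - 1)) a]
    have h4 : 0 ≤ ∑ t ∈ Finset.Icc 1 (T - 1), a t := Finset.sum_nonneg fun t ht => (ha0 t ht).le
    positivity
  have hβT : 1200 * β / T ≤ δ₀ / 2 := by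
    rw [div_le_div_iff₀ hTpos (by norm_num)]
    rw [div_le_iff₀ hδ₀] at hTδ
    linarith
  have hιmem : ∀ i : Fin 600, (i : ℕ) + 1 ∈ Finset.Icc 1 (T - 1) := fun i => by
    rw [Finset.mem_Icc]
    have := i.2
    omega
  have hi600 : ∀ i : Fin 600, (((i : ℕ) + 1 : ℕ) : ℝ) ≤ 600 := fun i => by
    exact_mod_cast (by omega : (i : ℕ) + 1 ≤ 600)
  have h := abs_integral_ratio_le (τ := Finset.Icc 1 (T - 1)) (τ' := Fin 600) hε hind hK hW
    (k := ⟨k, hk⟩) (l := ⟨l, hl⟩) (fun h => hkl (congrArg Subtype.val h))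
    (a := fun t => a t) (fun t => ha0 t t.2) (ι := fun i => ⟨(i : ℕ) + 1, hιmem i⟩)
    (fun i j hij => by
      have := congrArg Subtype.val hij
      simp only at this
      exact Fin.ext (by omega))
    (δ := δ₀ / 2) (by positivity)
    (fun i => by
      refine le_trans ?_ (hdiag _ (hιmem i))
      have h1 : β * (((i : ℕ) + 1 : ℕ) : ℝ) / T ≤ 1200 * β / T := by
        have h2 : β * (((i : ℕ) + 1 : ℕ) : ℝ) ≤ β * 600 := by gcongr; exact hi600 i
        gcongr ?_ / _
        linarith
      linarith)
    (by
      rw [hν2', Fintype.card_fin]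
      refine le_trans (le_of_eq ?_) hβT
      push_cast
      ring)
    (α := 1 / 1200) (by norm_num)
    (fun i => by
      refine le_trans ?_ (ha' _ (hιmem i))
      have h1 := hi600 i
      have h2 := hpos _ (hιmem i)
      rw [div_le_div_iff₀ (by norm_num) (by positivity)]
      linarith)
    hS0
  simp only at h
  have hsum : ∀ f : ℕ → ℝ, ∑ t : Finset.Icc 1 (T - 1), f t = ∑ t ∈ Finset.Icc 1 (T - 1), f t :=
    fun f => Finset.sum_coe_sort (Finset.Icc 1 (T - 1)) f
  have hD : ∀ ω, ∑ t : Finset.Icc 1 (T - 1), a t ^ 2 * (∑ u, W t u * ε u ω) ^ 2 =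
      ∑ t ∈ Finset.Icc 1 (T - 1), a t ^ 2 * (∑ u, W t u * ε u ω) ^ 2 := fun ω =>
    hsum fun t => a t ^ 2 * (∑ u, W t u * ε u ω) ^ 2
  simp only [hD] at h
  refine h.trans ?_
  rw [hgoal]
  -- The crude bound `a_t ≥ 1/(2T)` gives `2T² = 2 S^200`.
  have hr : 1 / (2 * a k * a l) ≤ 2 * S ^ 200 := by
    have hb : ∀ t ∈ Finset.Icc 1 (T - 1), 1 / (2 * (T : ℝ)) ≤ a t := fun t ht => by
      refine le_trans ?_ (ha' t ht)
      have h1 := hpos t ht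
      have h2 : (t : ℝ) ≤ T := by
        exact_mod_cast ((Finset.mem_Icc.1 ht).2.trans (Nat.sub_le _ _))
      gcongr
    have h1 : (1 / (2 * (T : ℝ))) * (1 / (2 * (T : ℝ))) ≤ a k * a l :=
      mul_le_mul (hb k hk) (hb l hl) (by positivity) (ha0 k hk).le
    rw [show S ^ 200 = (S ^ 100) ^ 2 by ring, hS100]
    have h2 := ha0 k hk
    have h3 := ha0 l hl
    rw [div_le_iff₀ (by positivity)]
    have h4 : (1 / (2 * (T : ℝ))) * (1 / (2 * (T : ℝ))) * (4 * T ^ 2) = 1 := by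
      field_simp
      norm_num
    have h5 := mul_le_mul_of_nonneg_right h1 (by positivity : (0 : ℝ) ≤ 4 * T ^ 2)
    rw [h4] at h5
    linarith
  -- The 600 modes yield `S^{-300} = T^{-3}`, which beats the prefactor `T²`.
  have hh : (1 / Real.sqrt (S * (δ₀ / 2) * (1 / 1200) ^ 2 / 2)) ^ Fintype.card (Fin 600) =
      c₂ * (S⁻¹) ^ 300 := by
    rw [Fintype.card_fin, one_div_sqrt_pow (by positivity) 300, hc₂, ← mul_pow]
    refine congrArg (fun x : ℝ => x ^ 300) ?_
    field_simp
  rw [hh]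
  have h2 := error_terms_le hc₁0 hc₂0 hc₃0 hS1 hA0 hA hν2
    (r := 1 / (2 * a k * a l))
    hr
    (le_refl (c₂ * (S⁻¹) ^ 300)) (mul_nonneg hc₂0 (pow_nonneg (inv_nonneg.2 hS0.le) _)) (hc.ge.trans hcS)
  refine le_trans (le_of_eq ?_) h2
  rw [hc₁, hc₃]
  ring

/-! ### Orthogonality of the sine vectors and of their shifts. -/

section Sine

theorem sum_range_cos_mul {x : ℝ} (hx : Real.sin (x / 2) ≠ 0) (T : ℕ) :
    ∑ r ∈ Finset.range T, Real.cos (r * x) =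
      (Real.sin (T * x - x / 2) + Real.sin (x / 2)) / (2 * Real.sin (x / 2)) := by
  rw [eq_div_iff (by simpa using hx)]
  induction T with
  | zero => simp [Real.sin_neg]
  | succ n ih =>
    rw [Finset.sum_range_succ, add_mul, ih]
    have e1 : ((n + 1 : ℕ) : ℝ) * x - x / 2 = n * x + x / 2 := by push_cast; ring
    rw [e1, Real.sin_add, Real.sin_sub]
    ring

/-- The sum depends only on the parity of `m`; as `k + l` and `k - l` have the same parity, their
contributions to a sine product cancel. -/
theorem sum_range_cos_pi_mul {T : ℕ} (hT : 0 < T) {m : ℤ} (hm : m ≠ 0) (hm' : |m| < 2 * T) :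
    ∑ r ∈ Finset.range T, Real.cos (r * (Real.pi * m / T)) = (1 - (-1) ^ m) / 2 := by
  have hT0 : (T : ℝ) ≠ 0 := by exact_mod_cast hT.ne'
  have hsin : Real.sin (Real.pi * m / T / 2) ≠ 0 := by
    rw [Ne, Real.sin_eq_zero_iff]
    rintro ⟨n, hn⟩
    have hpi := Real.pi_ne_zero
    field_simp at hn
    have h1 : m = 2 * T * n := by
      have : (m : ℝ) = 2 * T * n := by linarith
      exact_mod_cast this
    rcases eq_or_ne n 0 with h0 | h0
    · exact hm (by simp [h1, h0])
    · have h2 : 1 ≤ |n| := Int.one_le_abs h0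
      rw [h1, abs_mul, abs_of_nonneg (by positivity)] at hm'
      have : (0 : ℤ) ≤ 2 * T := by positivity
      nlinarith
  rw [sum_range_cos_mul hsin]
  have e : (T : ℝ) * (Real.pi * m / T) = m * Real.pi := by field_simp
  rw [e, Real.sin_sub, Real.sin_int_mul_pi, Real.cos_int_mul_pi]
  generalize Real.sin (Real.pi * m / T / 2) = y at hsin
  field_simp
  ring

/-- The sine function whose restriction to `1, …, T` is `v_k`. -/
noncomputable def sineWave (T k : ℕ) (r : ℤ) : ℝ :=
  Real.sqrt (2 / T) * Real.sin (Real.pi * k * ((r : ℝ) - 1) / T)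

/-- `v_k`, extended by zero to `ℤ`. -/
noncomputable def vExt (T k : ℕ) (r : ℤ) : ℝ :=
  if r ∈ Finset.Icc (1 : ℤ) T then sineWave T k r else 0

theorem abs_sineWave_le (T k : ℕ) (r : ℤ) : |sineWave T k r| ≤ Real.sqrt (2 / T) := by
  rw [sineWave, abs_mul, abs_of_nonneg (Real.sqrt_nonneg _)]
  exact mul_le_of_le_one_right (Real.sqrt_nonneg _) (Real.abs_sin_le_one _)

theorem abs_vExt_le (T k : ℕ) (r : ℤ) : |vExt T k r| ≤ Real.sqrt (2 / T) := by
  rw [vExt]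
  split_ifs
  · exact abs_sineWave_le T k r
  · rw [abs_zero]
    exact Real.sqrt_nonneg _

/-- A sine is an eigenfunction of the symmetrized shift, though not of a single shift. For this
reason the shifts by `h` and `-h` are always paired below. -/
theorem sineWave_add_add_sub (T k : ℕ) (r h : ℤ) :
    sineWave T k (r + h) + sineWave T k (r - h) =
      2 * Real.cos (Real.pi * k * h / T) * sineWave T k r := by
  simp only [sineWave]
  push_cast
  have e1 : Real.pi * k * ((r : ℝ) + h - 1) / T =
    Real.pi * k * ((r : ℝ) - 1) / T + Real.pi * k * h / T := by ring
  have e2 : Real.pi * k * ((r : ℝ) - h - 1) / T =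
    Real.pi * k * ((r : ℝ) - 1) / T - Real.pi * k * h / T := by ring
  rw [e1, e2, Real.sin_add, Real.sin_sub]
  ring

theorem sum_Icc_int_eq_sum_range (T : ℕ) (f : ℤ → ℝ) :
    ∑ s ∈ Finset.Icc (1 : ℤ) T, f s = ∑ r ∈ Finset.range T, f (r + 1) := by
  refine Finset.sum_nbij' (fun s => (s - 1).toNat) (fun r => (r : ℤ) + 1) ?_ ?_ ?_ ?_ ?_
  · intro s hs
    rw [Finset.mem_Icc] at hs
    rw [Finset.mem_range]
    omega
  · intro r hr
    rw [Finset.mem_range] at hr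
    rw [Finset.mem_Icc]
    omega
  · intro s hs
    rw [Finset.mem_Icc] at hs
    omega
  · intro r hr
    omega
  · intro s hs
    rw [Finset.mem_Icc] at hs
    congr 1
    omega

/-- Orthonormality of the sine vectors. -/
theorem sum_sineWave_mul_sineWave {T k l : ℕ} (hk : k ∈ Finset.Icc 1 (T - 1))
    (hl : l ∈ Finset.Icc 1 (T - 1)) :
    ∑ s ∈ Finset.Icc (1 : ℤ) T, sineWave T k s * sineWave T l s = if k = l then 1 else 0 := by
  rw [Finset.mem_Icc] at hk hl
  have hT : 0 < T := by omega
  have hT0 : (0 : ℝ) < T := by exact_mod_cast hT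
  rw [sum_Icc_int_eq_sum_range]
  have h1 : ∀ r : ℕ, sineWave T k (r + 1) * sineWave T l (r + 1) =
      1 / T * (Real.cos (r * (Real.pi * ((k - l : ℤ) : ℝ) / T)) -
        Real.cos (r * (Real.pi * ((k + l : ℤ) : ℝ) / T))) := by
    intro r
    have hs : Real.sqrt (2 / T) * Real.sqrt (2 / T) = 2 / T := Real.mul_self_sqrt (by positivity)
    simp only [sineWave]
    push_cast
    have e1 : (r : ℝ) * (Real.pi * ((k : ℝ) - l) / T) =
      Real.pi * k * ((r : ℝ) + 1 - 1) / T - Real.pi * l * ((r : ℝ) + 1 - 1) / T := by ring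
    have e2 : (r : ℝ) * (Real.pi * ((k : ℝ) + l) / T) =
      Real.pi * k * ((r : ℝ) + 1 - 1) / T + Real.pi * l * ((r : ℝ) + 1 - 1) / T := by ring
    rw [e1, e2, Real.cos_sub, Real.cos_add]
    linear_combination Real.sin (Real.pi * k * ((r : ℝ) + 1 - 1) / T) *
      Real.sin (Real.pi * l * ((r : ℝ) + 1 - 1) / T) * hs
  rw [Finset.sum_congr rfl fun r _ => h1 r, ← Finset.mul_sum, Finset.sum_sub_distrib]
  have h2 : ∑ r ∈ Finset.range T, Real.cos (r * (Real.pi * ((k + l : ℤ) : ℝ) / T)) =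
      (1 - (-1) ^ (k + l : ℤ)) / 2 :=
    sum_range_cos_pi_mul hT (by omega) (by rw [abs_of_nonneg (by positivity)]; omega)
  rw [h2]
  split_ifs with hkl
  · subst hkl
    have h3 : ((-1 : ℝ)) ^ (k + k : ℤ) = 1 := Even.neg_one_zpow ⟨(k : ℤ), rfl⟩
    rw [h3]
    simp
    field_simp
  · rw [sum_range_cos_pi_mul hT (by omega) (by rw [abs_lt]; constructor <;> omega)]
    have h3 : ((-1 : ℝ)) ^ (k + l : ℤ) = (-1) ^ (k - l : ℤ) := by
      rw [show (k + l : ℤ) = (k - l) + (l + l) by ring, zpow_add₀ (by norm_num),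
        Even.neg_one_zpow (⟨(l : ℤ), rfl⟩ : Even ((l : ℤ) + l)), mul_one]
    rw [h3]
    simp

theorem card_filter_add_notMem_le (T : ℕ) (h : ℤ) :
    ((Finset.Icc (1 : ℤ) T).filter fun s => s + h ∉ Finset.Icc (1 : ℤ) T).card ≤ h.natAbs := by
  rcases le_total 0 h with h0 | h0
  · refine (Finset.card_le_card (t := Finset.Icc (T - h + 1) (T : ℤ)) fun s hs => ?_).trans ?_
    · simp only [Finset.mem_filter, Finset.mem_Icc] at hs ⊢
      omega
    · rw [Int.card_Icc]
      omega
  · refine (Finset.card_le_card (t := Finset.Icc 1 (-h)) fun s hs => ?_).trans ?_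
    · simp only [Finset.mem_filter, Finset.mem_Icc] at hs ⊢
      omega
    · rw [Int.card_Icc]
      omega

/-- Truncation to `1, …, T` affects at most `|h|` summands, each of size at most `2/T`. -/
theorem abs_sum_sineWave_mul_vExt_sub_le (T k l : ℕ) (h : ℤ) :
    |∑ s ∈ Finset.Icc (1 : ℤ) T, sineWave T k s * vExt T l (s + h) -
      ∑ s ∈ Finset.Icc (1 : ℤ) T, sineWave T k s * sineWave T l (s + h)| ≤ 2 / T * |(h : ℝ)| := by
  rw [← Finset.sum_sub_distrib]
  refine (Finset.abs_sum_le_sum_abs _ _).trans ?_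
  have h1 : ∀ s ∈ Finset.Icc (1 : ℤ) T, |sineWave T k s * vExt T l (s + h) -
      sineWave T k s * sineWave T l (s + h)| ≤
        if s + h ∉ Finset.Icc (1 : ℤ) T then (2 / T : ℝ) else 0 := by
    intro s _
    rw [vExt]
    by_cases hs : s + h ∈ Finset.Icc (1 : ℤ) T
    · rw [if_pos hs, if_neg (not_not.2 hs), sub_self, abs_zero]
    · rw [if_neg hs, if_pos hs, mul_zero, zero_sub, abs_neg, abs_mul]
      calc _ ≤ Real.sqrt (2 / T) * Real.sqrt (2 / T) :=
            mul_le_mul (abs_sineWave_le _ _ _) (abs_sineWave_le _ _ _) (abs_nonneg _)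
              (Real.sqrt_nonneg _)
        _ = 2 / T := Real.mul_self_sqrt (by positivity)
  refine (Finset.sum_le_sum h1).trans ?_
  rw [← Finset.sum_filter, Finset.sum_const, nsmul_eq_mul, mul_comm]
  gcongr
  have := card_filter_add_notMem_le T h
  rw [← Int.cast_abs, Int.abs_eq_natAbs]
  exact_mod_cast this

theorem abs_sum_shift_sub_cos_le {T k l : ℕ} (hk : k ∈ Finset.Icc 1 (T - 1))
    (hl : l ∈ Finset.Icc 1 (T - 1)) (h : ℤ) :
    |∑ s ∈ Finset.Icc (1 : ℤ) T, sineWave T k s * vExt T l (s + h) +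
      ∑ s ∈ Finset.Icc (1 : ℤ) T, sineWave T k s * vExt T l (s - h) -
        if k = l then 2 * Real.cos (Real.pi * k * h / T) else 0| ≤ 4 / T * |(h : ℝ)| := by
  have h1 := abs_sum_sineWave_mul_vExt_sub_le T k l h
  have h2 := abs_sum_sineWave_mul_vExt_sub_le T k l (-h)
  simp only [← sub_eq_add_neg] at h2
  push_cast at h2
  rw [abs_neg] at h2
  have h3 : ∑ s ∈ Finset.Icc (1 : ℤ) T, sineWave T k s * sineWave T l (s + h) +
      ∑ s ∈ Finset.Icc (1 : ℤ) T, sineWave T k s * sineWave T l (s - h) =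
        if k = l then 2 * Real.cos (Real.pi * k * h / T) else 0 := by
    have e : ∀ s : ℤ, sineWave T k s * sineWave T l (s + h) +
        sineWave T k s * sineWave T l (s - h) =
        2 * Real.cos (Real.pi * l * h / T) * (sineWave T k s * sineWave T l s) := by
      intro s
      rw [← mul_add, sineWave_add_add_sub]
      ring
    rw [← Finset.sum_add_distrib, Finset.sum_congr rfl fun s _ => e s, ← Finset.mul_sum,
      sum_sineWave_mul_sineWave hk hl]
    split_ifs with hkl
    · rw [hkl, mul_one]
    · rw [mul_zero]
  rw [← h3]
  have h4 := abs_add_le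
    (∑ s ∈ Finset.Icc (1 : ℤ) T, sineWave T k s * vExt T l (s + h) -
      ∑ s ∈ Finset.Icc (1 : ℤ) T, sineWave T k s * sineWave T l (s + h))
    (∑ s ∈ Finset.Icc (1 : ℤ) T, sineWave T k s * vExt T l (s - h) -
      ∑ s ∈ Finset.Icc (1 : ℤ) T, sineWave T k s * sineWave T l (s - h))
  rw [add_sub_add_comm]
  refine h4.trans ((add_le_add h1 h2).trans (le_of_eq ?_))
  ring

end Sine

/-! ### The Gram matrix of the truncated linear forms. -/

section Gram

/-- The coefficient of `ε u` in `e_j v_k` when the lag polynomial has the coefficients `ψ i`,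
`i < N`. -/
noncomputable def lagCoef (ψ : ℕ → ℝ) (N T k : ℕ) (u : ℤ) : ℝ :=
  ∑ i ∈ Finset.range N, ψ i * vExt T k (u + i)

variable {ψ : ℕ → ℝ} {N T k l : ℕ} {B : ℝ}

theorem sum_shift_eq {i : ℕ} (hi : i < N) (f : ℤ → ℝ) :
    ∑ u ∈ Finset.Icc (1 - N : ℤ) T, vExt T k (u + i) * f u =
      ∑ s ∈ Finset.Icc (1 : ℤ) T, sineWave T k s * f (s - i) := by
  have h1 : ∑ u ∈ Finset.Icc (1 - N : ℤ) T, vExt T k (u + i) * f u =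
      ∑ u ∈ Finset.Icc (1 - i : ℤ) (T - i), vExt T k (u + i) * f u := by
    refine (Finset.sum_subset (fun u hu => ?_) fun u _ hu => ?_).symm
    · rw [Finset.mem_Icc] at hu ⊢
      omega
    · rw [vExt, if_neg, zero_mul]
      rw [Finset.mem_Icc] at hu ⊢
      omega
  rw [h1]
  refine Finset.sum_nbij' (fun u => u + i) (fun s => s - i) ?_ ?_ ?_ ?_ ?_
  · intro u hu
    rw [Finset.mem_Icc] at hu ⊢
    omega
  · intro u hu
    rw [Finset.mem_Icc] at hu ⊢
    omega
  · intro u _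
    ring
  · intro u _
    ring
  · intro u hu
    rw [vExt, if_pos (by rw [Finset.mem_Icc] at hu ⊢; omega), add_sub_cancel_right]

/-- The doubling comes from adding the expression with `i` and `j` exchanged, which pairs each shift
`j - i` with its negative. -/
theorem sum_lagCoef_mul_lagCoef :
    2 * ∑ u ∈ Finset.Icc (1 - N : ℤ) T, lagCoef ψ N T k u * lagCoef ψ N T l u =
      ∑ i ∈ Finset.range N, ∑ j ∈ Finset.range N, ψ i * ψ j *
        (∑ s ∈ Finset.Icc (1 : ℤ) T, sineWave T k s * vExt T l (s + (j - i : ℤ)) +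
          ∑ s ∈ Finset.Icc (1 : ℤ) T, sineWave T k s * vExt T l (s - (j - i : ℤ))) := by
  have h1 : ∑ u ∈ Finset.Icc (1 - N : ℤ) T, lagCoef ψ N T k u * lagCoef ψ N T l u =
      ∑ i ∈ Finset.range N, ∑ j ∈ Finset.range N, ψ i * ψ j *
        ∑ s ∈ Finset.Icc (1 : ℤ) T, sineWave T k s * vExt T l (s + (j - i : ℤ)) := by
    simp only [lagCoef, Finset.sum_mul_sum]
    rw [Finset.sum_comm]
    refine Finset.sum_congr rfl fun i hi => ?_
    rw [Finset.sum_comm]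
    refine Finset.sum_congr rfl fun j _ => ?_
    have h2 := sum_shift_eq (k := k) (T := T) (Finset.mem_range.1 hi) fun u => vExt T l (u + j)
    have e : ∀ s : ℤ, s - (i : ℤ) + j = s + (j - i : ℤ) := fun s => by ring
    simp only [e] at h2
    rw [← h2, Finset.mul_sum]
    exact Finset.sum_congr rfl fun u _ => by ring
  have h3 : ∑ i ∈ Finset.range N, ∑ j ∈ Finset.range N, ψ i * ψ j *
        ∑ s ∈ Finset.Icc (1 : ℤ) T, sineWave T k s * vExt T l (s + (j - i : ℤ)) =
      ∑ i ∈ Finset.range N, ∑ j ∈ Finset.range N, ψ i * ψ j *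
        ∑ s ∈ Finset.Icc (1 : ℤ) T, sineWave T k s * vExt T l (s - (j - i : ℤ)) := by
    rw [Finset.sum_comm]
    refine Finset.sum_congr rfl fun i _ => Finset.sum_congr rfl fun j _ => ?_
    rw [mul_comm (ψ j)]
    congr 1
    refine Finset.sum_congr rfl fun s _ => ?_
    congr 2
    ring
  rw [two_mul]
  nth_rewrite 2 [h1]
  rw [h3, h1, ← Finset.sum_add_distrib]
  refine Finset.sum_congr rfl fun i _ => ?_
  rw [← Finset.sum_add_distrib]
  exact Finset.sum_congr rfl fun j _ => by ring

/-- Uses `|j - i| ≤ (1 + i)(1 + j)`; the weight `1 + k` in the summability condition pays for the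
boundary effects of the shifts. -/
theorem sum_sum_abs_mul_le (hB : ∑ i ∈ Finset.range N, (1 + (i : ℝ)) * |ψ i| ≤ B) :
    ∑ i ∈ Finset.range N, ∑ j ∈ Finset.range N, |ψ i| * |ψ j| * |((j - i : ℤ) : ℝ)| ≤ B ^ 2 := by
  have h0 : 0 ≤ ∑ i ∈ Finset.range N, (1 + (i : ℝ)) * |ψ i| :=
    Finset.sum_nonneg fun i _ => by positivity
  calc _ ≤ ∑ i ∈ Finset.range N, ∑ j ∈ Finset.range N,
        ((1 + (i : ℝ)) * |ψ i|) * ((1 + (j : ℝ)) * |ψ j|) := by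
        refine Finset.sum_le_sum fun i _ => Finset.sum_le_sum fun j _ => ?_
        have h1 : |((j - i : ℤ) : ℝ)| ≤ (1 + (i : ℝ)) * (1 + (j : ℝ)) := by
          push_cast
          have hi : (0 : ℝ) ≤ i := by positivity
          have hj : (0 : ℝ) ≤ j := by positivity
          rw [abs_le]
          constructor <;> nlinarith
        calc _ ≤ |ψ i| * |ψ j| * ((1 + (i : ℝ)) * (1 + (j : ℝ))) := by gcongr
          _ = _ := by ring
    _ = (∑ i ∈ Finset.range N, (1 + (i : ℝ)) * |ψ i|) ^ 2 := by
        rw [pow_two, Finset.sum_mul_sum]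
    _ ≤ B ^ 2 := by gcongr

/-- The diagonal value is `|∑ ψ_j exp(iπkj/T)|²`, the transfer function at frequency `πk/T`; the
error comes only from shifts across the ends of `1, …, T`. -/
theorem abs_sum_lagCoef_sub_le (hB : ∑ i ∈ Finset.range N, (1 + (i : ℝ)) * |ψ i| ≤ B)
    (hk : k ∈ Finset.Icc 1 (T - 1)) (hl : l ∈ Finset.Icc 1 (T - 1)) :
    |∑ u ∈ Finset.Icc (1 - N : ℤ) T, lagCoef ψ N T k u * lagCoef ψ N T l u -
      if k = l then ∑ i ∈ Finset.range N, ∑ j ∈ Finset.range N,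
        ψ i * ψ j * Real.cos (Real.pi * k * ((j - i : ℤ) : ℝ) / T) else 0| ≤ 2 * B ^ 2 / T := by
  have h1 : 2 * (∑ u ∈ Finset.Icc (1 - N : ℤ) T, lagCoef ψ N T k u * lagCoef ψ N T l u -
      if k = l then ∑ i ∈ Finset.range N, ∑ j ∈ Finset.range N,
        ψ i * ψ j * Real.cos (Real.pi * k * ((j - i : ℤ) : ℝ) / T) else 0) =
      ∑ i ∈ Finset.range N, ∑ j ∈ Finset.range N, ψ i * ψ j *
        (∑ s ∈ Finset.Icc (1 : ℤ) T, sineWave T k s * vExt T l (s + (j - i : ℤ)) +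
          ∑ s ∈ Finset.Icc (1 : ℤ) T, sineWave T k s * vExt T l (s - (j - i : ℤ)) -
            if k = l then 2 * Real.cos (Real.pi * k * ((j - i : ℤ) : ℝ) / T) else 0) := by
    rw [mul_sub, sum_lagCoef_mul_lagCoef]
    simp only [mul_sub, Finset.sum_sub_distrib]
    congr 1
    split_ifs
    · rw [Finset.mul_sum]
      refine Finset.sum_congr rfl fun i _ => ?_
      rw [Finset.mul_sum]
      exact Finset.sum_congr rfl fun j _ => by ring
    · simp
  have h2 := sum_sum_abs_mul_le hB
  have h3 : |2 * (∑ u ∈ Finset.Icc (1 - N : ℤ) T, lagCoef ψ N T k u * lagCoef ψ N T l u -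
      if k = l then ∑ i ∈ Finset.range N, ∑ j ∈ Finset.range N,
        ψ i * ψ j * Real.cos (Real.pi * k * ((j - i : ℤ) : ℝ) / T) else 0)| ≤ 4 / T * B ^ 2 := by
    rw [h1]
    refine le_trans ?_ (mul_le_mul_of_nonneg_left h2 (by positivity : (0 : ℝ) ≤ 4 / T))
    refine (Finset.abs_sum_le_sum_abs _ _).trans ?_
    rw [Finset.mul_sum]
    refine Finset.sum_le_sum fun i _ => (Finset.abs_sum_le_sum_abs _ _).trans ?_
    rw [Finset.mul_sum]
    refine Finset.sum_le_sum fun j _ => ?_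
    rw [abs_mul, abs_mul]
    calc _ ≤ |ψ i| * |ψ j| * (4 / T * |((j - i : ℤ) : ℝ)|) := by
          gcongr
          exact abs_sum_shift_sub_cos_le hk hl _
      _ = _ := by ring
  rw [abs_mul, abs_two] at h3
  have e : 4 / (T : ℝ) * B ^ 2 = 2 * (2 * B ^ 2 / T) := by ring
  linarith

theorem sum_abs_le_of_sum_weighted_le (hB : ∑ i ∈ Finset.range N, (1 + (i : ℝ)) * |ψ i| ≤ B) :
    ∑ i ∈ Finset.range N, |ψ i| ≤ B := by
  refine le_trans (Finset.sum_le_sum fun i _ => ?_) hB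
  have : (0 : ℝ) ≤ i := by positivity
  nlinarith [abs_nonneg (ψ i)]

theorem abs_lagCoef_le (hB : ∑ i ∈ Finset.range N, (1 + (i : ℝ)) * |ψ i| ≤ B) (u : ℤ) :
    |lagCoef ψ N T k u| ≤ 2 * B * (1 / Real.sqrt T) := by
  have h0 := sum_abs_le_of_sum_weighted_le hB
  have hB0 : 0 ≤ B := (Finset.sum_nonneg fun i _ => abs_nonneg _).trans h0
  have h2 : Real.sqrt (2 / T) ≤ 2 * (1 / Real.sqrt T) := by
    rw [Real.sqrt_div (by norm_num), mul_one_div]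
    gcongr
    rw [Real.sqrt_le_left (by norm_num)]
    norm_num
  refine (Finset.abs_sum_le_sum_abs _ _).trans ?_
  calc _ ≤ ∑ i ∈ Finset.range N, |ψ i| * Real.sqrt (2 / T) := by
        refine Finset.sum_le_sum fun i _ => ?_
        rw [abs_mul]
        gcongr
        exact abs_vExt_le _ _ _
    _ = (∑ i ∈ Finset.range N, |ψ i|) * Real.sqrt (2 / T) := by rw [Finset.sum_mul]
    _ ≤ B * (2 * (1 / Real.sqrt T)) := by gcongr
    _ = _ := by ring

/-- At frequency zero the transfer function is `(∑ ψ_i)²`, and it is Lipschitz in the frequency; `π`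
is bounded by `4`. -/
theorem le_sum_cos (hB : ∑ i ∈ Finset.range N, (1 + (i : ℝ)) * |ψ i| ≤ B) :
    (∑ i ∈ Finset.range N, ψ i) ^ 2 - 4 * B ^ 2 * k / T ≤
      ∑ i ∈ Finset.range N, ∑ j ∈ Finset.range N,
        ψ i * ψ j * Real.cos (Real.pi * k * ((j - i : ℤ) : ℝ) / T) := by
  have h1 := sum_sum_abs_mul_le hB
  have h2 : (∑ i ∈ Finset.range N, ψ i) ^ 2 - ∑ i ∈ Finset.range N, ∑ j ∈ Finset.range N,
        ψ i * ψ j * Real.cos (Real.pi * k * ((j - i : ℤ) : ℝ) / T) ≤ 4 * k / T *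
      ∑ i ∈ Finset.range N, ∑ j ∈ Finset.range N, |ψ i| * |ψ j| * |((j - i : ℤ) : ℝ)| := by
    rw [pow_two, Finset.sum_mul_sum, ← Finset.sum_sub_distrib, Finset.mul_sum]
    refine Finset.sum_le_sum fun i _ => ?_
    rw [← Finset.sum_sub_distrib, Finset.mul_sum]
    refine Finset.sum_le_sum fun j _ => ?_
    set x := Real.pi * k * ((j - i : ℤ) : ℝ) / T with hx
    have h3 : |1 - Real.cos x| ≤ |x| := by
      have := Real.abs_cos_sub_cos_le 0 x
      simpa using this
    have h4 : |x| ≤ 4 * k / T * |((j - i : ℤ) : ℝ)| := by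
      rw [hx, abs_div, abs_mul, abs_mul, abs_of_pos Real.pi_pos, Nat.abs_cast, Nat.abs_cast]
      have := Real.pi_le_four
      calc _ ≤ 4 * k * |((j - i : ℤ) : ℝ)| / T := by gcongr
        _ = _ := by ring
    calc _ = ψ i * ψ j * (1 - Real.cos x) := by ring
      _ ≤ |ψ i * ψ j * (1 - Real.cos x)| := le_abs_self _
      _ = |ψ i| * |ψ j| * |1 - Real.cos x| := by rw [abs_mul, abs_mul]
      _ ≤ |ψ i| * |ψ j| * (4 * k / T * |((j - i : ℤ) : ℝ)|) := by gcongr; exact h3.trans h4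
      _ = _ := by ring
  have h3 : 4 * k / T * ∑ i ∈ Finset.range N, ∑ j ∈ Finset.range N,
      |ψ i| * |ψ j| * |((j - i : ℤ) : ℝ)| ≤ 4 * k / T * B ^ 2 := by gcongr
  have e : 4 * (k : ℝ) / T * B ^ 2 = 4 * B ^ 2 * k / T := by ring
  linarith

theorem sum_cos_le (hB : ∑ i ∈ Finset.range N, (1 + (i : ℝ)) * |ψ i| ≤ B) (x : ℕ → ℕ → ℝ) :
    ∑ i ∈ Finset.range N, ∑ j ∈ Finset.range N, ψ i * ψ j * Real.cos (x i j) ≤ B ^ 2 := by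
  have h0 := sum_abs_le_of_sum_weighted_le hB
  calc _ ≤ ∑ i ∈ Finset.range N, ∑ j ∈ Finset.range N, |ψ i| * |ψ j| := by
        refine Finset.sum_le_sum fun i _ => Finset.sum_le_sum fun j _ => ?_
        refine (le_abs_self _).trans ?_
        rw [abs_mul, abs_mul]
        exact mul_le_of_le_one_right (by positivity) (Real.abs_cos_le_one _)
    _ = (∑ i ∈ Finset.range N, |ψ i|) ^ 2 := by rw [pow_two, Finset.sum_mul_sum]
    _ ≤ B ^ 2 := by
        have : 0 ≤ ∑ i ∈ Finset.range N, |ψ i| := Finset.sum_nonneg fun i _ => abs_nonneg _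
        gcongr

theorem le_sum_lagCoef_sq (hB : ∑ i ∈ Finset.range N, (1 + (i : ℝ)) * |ψ i| ≤ B)
    (hk : k ∈ Finset.Icc 1 (T - 1)) :
    (∑ i ∈ Finset.range N, ψ i) ^ 2 - (1 + 6 * B ^ 2 + 2 * B) * k / T ≤
      ∑ u : Finset.Icc (1 - N : ℤ) T, lagCoef ψ N T k u ^ 2 := by
  rw [Finset.sum_coe_sort (Finset.Icc (1 - N : ℤ) T) fun u => lagCoef ψ N T k u ^ 2]
  have h1 := abs_sum_lagCoef_sub_le hB hk hk
  have h0 := sum_abs_le_of_sum_weighted_le hB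
  have hB0 : 0 ≤ B := (Finset.sum_nonneg fun i _ => abs_nonneg _).trans h0
  have h2 := le_sum_cos (k := k) (T := T) hB
  rw [if_pos rfl] at h1
  simp only [← pow_two] at h1
  have h3 := (abs_le.1 h1).1
  have hk1 : (1 : ℝ) ≤ k := by exact_mod_cast (Finset.mem_Icc.1 hk).1
  have h4 : 2 * B ^ 2 / T + 4 * B ^ 2 * k / T ≤ (1 + 6 * B ^ 2 + 2 * B) * k / T := by
    rw [← add_div]
    gcongr
    nlinarith [mul_nonneg (sub_nonneg.2 hk1) (sq_nonneg B), mul_nonneg hB0 (zero_le_one.trans hk1)]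
  linarith

/-- A single `β = 1 + 6B² + 2B` covers all requirements: `2B` for the coefficients, `B² + 2B²` for
the squared norms, `2B²` off the diagonal, and `2B² + 4B²` for the loss in the diagonal lower bound.
-/
theorem nearlyOrthogonal_lagCoef (hB : ∑ i ∈ Finset.range N, (1 + (i : ℝ)) * |ψ i| ≤ B)
    (hT : 1 ≤ T) :
    NearlyOrthogonal (fun (t : Finset.Icc 1 (T - 1)) (u : Finset.Icc (1 - N : ℤ) T) =>
      lagCoef ψ N T t u) (1 + 6 * B ^ 2 + 2 * B) (1 / Real.sqrt T) := by
  have h0 := sum_abs_le_of_sum_weighted_le hB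
  have hB0 : 0 ≤ B := (Finset.sum_nonneg fun i _ => abs_nonneg _).trans h0
  have hT1 : (1 : ℝ) ≤ T := by exact_mod_cast hT
  have hν2 : (1 / Real.sqrt T) ^ 2 = 1 / T := by
    rw [div_pow, Real.sq_sqrt (by positivity), one_pow]
  refine ⟨by nlinarith [sq_nonneg B], by positivity, ?_, fun t u => ?_, fun t => ?_,
    fun t t' htt' => ?_⟩
  · rw [div_le_one (by positivity)]
    exact Real.one_le_sqrt.2 hT1
  · refine (abs_lagCoef_le hB _).trans ?_
    gcongr
    nlinarith [sq_nonneg B]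
  · rw [Finset.sum_coe_sort (Finset.Icc (1 - N : ℤ) T) fun u => lagCoef ψ N T t u ^ 2]
    have h1 := abs_sum_lagCoef_sub_le hB t.2 t.2
    rw [if_pos rfl] at h1
    simp only [← pow_two] at h1
    have h2 := (abs_le.1 h1).2
    have h3 := sum_cos_le hB fun i j => Real.pi * (t : ℕ) * ((j - i : ℤ) : ℝ) / T
    have h4 : 2 * B ^ 2 / T ≤ 2 * B ^ 2 := div_le_self (by positivity) hT1
    nlinarith [sq_nonneg B, mul_nonneg hB0 (sq_nonneg B)]
  · rw [Finset.sum_coe_sort (Finset.Icc (1 - N : ℤ) T) fun u =>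
      lagCoef ψ N T t u * lagCoef ψ N T t' u]
    have h1 := abs_sum_lagCoef_sub_le hB t.2 t'.2
    rw [if_neg (fun h => htt' (Subtype.ext h)), sub_zero] at h1
    refine h1.trans ?_
    rw [hν2, ← div_eq_mul_one_div]
    gcongr
    nlinarith [sq_nonneg B]

end Gram

/-! ### The weights `σ_t / σ_1`. -/

section Sigma

theorem sigmaCoef_div_sigmaCoef_one (T t : ℕ) :
    sigmaCoef T t / sigmaCoef T 1 =
      Real.sin (Real.pi / (2 * T)) / Real.sin (Real.pi * t / (2 * T)) := by
  simp only [sigmaCoef, Nat.cast_one, mul_one, mul_inv, div_eq_mul_inv, inv_inv]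
  ring

/-- Jordan's inequality from below, `sin x ≤ x` with `π ≤ 4` from above. -/
theorem sin_mode_bounds {T t : ℕ} (ht : t ∈ Finset.Icc 1 T) :
    (t : ℝ) / T ≤ Real.sin (Real.pi * t / (2 * T)) ∧
      Real.sin (Real.pi * t / (2 * T)) ≤ 2 * t / T ∧ 0 < Real.sin (Real.pi * t / (2 * T)) := by
  rw [Finset.mem_Icc] at ht
  have hT0 : (0 : ℝ) < T := by exact_mod_cast (by omega : 0 < T)
  have ht0 : (0 : ℝ) < t := by exact_mod_cast (by omega : 0 < t)
  have htT : (t : ℝ) ≤ T := by exact_mod_cast ht.2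
  have hpi := Real.pi_pos
  have hpi4 := Real.pi_le_four
  have h1 : (t : ℝ) / T ≤ Real.sin (Real.pi * t / (2 * T)) := by
    have h := Real.mul_le_sin (x := Real.pi * t / (2 * T)) (by positivity) (by
      rw [div_le_div_iff₀ (by positivity) (by norm_num)]
      nlinarith)
    refine le_trans (le_of_eq ?_) h
    field_simp
  refine ⟨h1, ?_, lt_of_lt_of_le (by positivity) h1⟩
  refine (Real.sin_le (by positivity)).trans ?_
  rw [div_le_div_iff₀ (by positivity) hT0]
  nlinarith [mul_pos ht0 hT0]

theorem sigmaCoef_pos {T t : ℕ} (ht : t ∈ Finset.Icc 1 T) : 0 < sigmaCoef T t := by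
  have := (sin_mode_bounds ht).2.2
  rw [sigmaCoef]
  positivity

theorem sigmaRatio_le {T t : ℕ} (ht : t ∈ Finset.Icc 1 T) :
    sigmaCoef T t / sigmaCoef T 1 ≤ 2 / t := by
  have h1 := sin_mode_bounds ht
  rw [Finset.mem_Icc] at ht
  have h2 := sin_mode_bounds (T := T) (t := 1) (by rw [Finset.mem_Icc]; omega)
  have hT0 : (0 : ℝ) < T := by exact_mod_cast (by omega : 0 < T)
  have ht0 : (0 : ℝ) < t := by exact_mod_cast (by omega : 0 < t)
  rw [Nat.cast_one, mul_one, mul_one] at h2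
  rw [sigmaCoef_div_sigmaCoef_one]
  calc _ ≤ (2 / (T : ℝ)) / (t / T) := by
        have := h2.2.2
        gcongr
        · exact h2.2.1
        · exact h1.1
    _ = 2 / t := by field_simp

theorem le_sigmaRatio {T t : ℕ} (ht : t ∈ Finset.Icc 1 T) :
    1 / (2 * t) ≤ sigmaCoef T t / sigmaCoef T 1 := by
  have h1 := sin_mode_bounds ht
  rw [Finset.mem_Icc] at ht
  have h2 := sin_mode_bounds (T := T) (t := 1) (by rw [Finset.mem_Icc]; omega)
  have hT0 : (0 : ℝ) < T := by exact_mod_cast (by omega : 0 < T)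
  have ht0 : (0 : ℝ) < t := by exact_mod_cast (by omega : 0 < t)
  rw [Nat.cast_one, mul_one, mul_one] at h2
  rw [sigmaCoef_div_sigmaCoef_one]
  calc 1 / (2 * (t : ℝ)) = (1 / (T : ℝ)) / (2 * t / T) := by field_simp
    _ ≤ _ := by
        have := h1.2.2
        gcongr
        · exact h2.2.2.le
        · exact h2.1
        · exact h1.2.1

end Sigma

/-! ### Convergence of the linear process and absence of atoms. -/

section LinearProcess

variable {Ω : Type*} [MeasurableSpace Ω] {P : Measure Ω} {ε : ℤ → Ω → ℝ} {ψ : ℕ → ℝ}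

/-- Since `|x| ≤ 1 + x²`, each term has first absolute moment at most `2|ψ_k|`; Tonelli makes the
sum of absolute values integrable. -/
theorem ae_summable_mul [IsProbabilityMeasure P] {K : ℝ} (hε : ∀ t, IsStandardized P (ε t) K)
    (hψ : Summable fun k => |ψ k|) :
    ∀ᵐ ω ∂P, ∀ t : ℤ, Summable fun k : ℕ => ψ k * ε (t - k) ω := by
  rw [ae_all_iff]
  intro t
  have hm : ∀ s, Measurable (ε s) := fun s => (hε s).measurable
  have hbd : ∀ k : ℕ, ∫⁻ ω, ‖ψ k * ε (t - k) ω‖ₑ ∂P ≤ ENNReal.ofReal (2 * |ψ k|) := by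
    intro k
    have h1 := hε (t - k)
    have hi : Integrable (fun ω => ψ k * ε (t - k) ω) P := by
      have := h1.integrable_pow (j := 1) (by norm_num)
      simp only [pow_one] at this
      exact this.const_mul _
    rw [← ofReal_integral_norm_eq_lintegral_enorm hi]
    refine ENNReal.ofReal_le_ofReal ?_
    have h2 : Integrable (fun ω => ε (t - k) ω ^ 2) P := h1.integrable_pow (by norm_num)
    have h3 : ∫ ω, ‖ψ k * ε (t - k) ω‖ ∂P ≤ ∫ ω, |ψ k| * (1 + ε (t - k) ω ^ 2) ∂P := by
      refine integral_mono hi.norm (((integrable_const 1).add h2).const_mul _) fun ω => ?_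
      simp only [norm_mul, Real.norm_eq_abs]
      gcongr
      nlinarith [sq_nonneg (|ε (t - k) ω| - 1), sq_abs (ε (t - k) ω), abs_nonneg (ε (t - k) ω)]
    rw [integral_const_mul, integral_add (integrable_const 1) h2, h1.var_one] at h3
    simp only [integral_const, probReal_univ, one_smul] at h3
    linarith
  have hfin : ∫⁻ ω, ∑' k : ℕ, ‖ψ k * ε (t - k) ω‖ₑ ∂P ≠ ⊤ := by
    rw [lintegral_tsum fun k => by have := hm (t - k); fun_prop]
    exact ne_top_of_le_ne_top (hψ.mul_left 2).tsum_ofReal_ne_top (ENNReal.tsum_le_tsum hbd)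
  have hae := ae_lt_top (Measurable.tsum fun k => by have := hm (t - k); fun_prop) hfin
  filter_upwards [hae] with ω hω
  have h1 := ENNReal.summable_toReal hω.ne
  simp only [toReal_enorm] at h1
  exact summable_norm_iff.1 h1

theorem sum_lag_mul_vEntry (ψ : ℕ → ℝ) (x : ℤ → ℝ) (N T k : ℕ) :
    ∑ t ∈ Finset.Icc 1 T, (∑ i ∈ Finset.range N, ψ i * x ((t : ℤ) - i)) * vEntry T k t =
      ∑ u ∈ Finset.Icc (1 - N : ℤ) T, lagCoef ψ N T k u * x u := by
  have h1 : ∑ t ∈ Finset.Icc 1 T, (∑ i ∈ Finset.range N, ψ i * x ((t : ℤ) - i)) * vEntry T k t =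
      ∑ s ∈ Finset.Icc (1 : ℤ) T, (∑ i ∈ Finset.range N, ψ i * x (s - i)) * sineWave T k s := by
    refine Finset.sum_nbij' (fun t => (t : ℤ)) (fun s => s.toNat) ?_ ?_ ?_ ?_ ?_
    · intro t ht
      rw [Finset.mem_Icc] at ht ⊢
      omega
    · intro s hs
      rw [Finset.mem_Icc] at hs ⊢
      omega
    · intro t _
      simp
    · intro s hs
      rw [Finset.mem_Icc] at hs
      omega
    · intro t _
      simp [vEntry, sineWave]
  rw [h1]
  simp only [lagCoef, Finset.sum_mul]
  rw [Finset.sum_comm]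
  conv_rhs => rw [Finset.sum_comm]
  refine Finset.sum_congr rfl fun i hi => ?_
  have h2 := sum_shift_eq (k := k) (T := T) (Finset.mem_range.1 hi) x
  calc _ = ψ i * ∑ s ∈ Finset.Icc (1 : ℤ) T, sineWave T k s * x (s - i) := by
        rw [Finset.mul_sum]
        exact Finset.sum_congr rfl fun s _ => by ring
    _ = _ := by
        rw [← h2, Finset.mul_sum]
        exact Finset.sum_congr rfl fun u _ => by ring

/-- A linear form in a variable with a density and an independent variable has no atom. -/
theorem ae_ne_zero_of_indepFun [IsFiniteMeasure P] {X R : Ω → ℝ} (hX : Measurable X)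
    (hR : Measurable R)
    (hind : IndepFun R X P) (hac : P.map X ≪ volume) {q : ℝ} (hq : q ≠ 0) :
    ∀ᵐ ω ∂P, q * X ω + R ω ≠ 0 := by
  have hmap := (indepFun_iff_map_prod_eq_prod_map_map hR.aemeasurable hX.aemeasurable).1 hind
  have hs : MeasurableSet {p : ℝ × ℝ | q * p.2 + p.1 = 0} :=
    measurableSet_eq_fun (by fun_prop) measurable_const
  have h0 : ((P.map R).prod (P.map X)) {p : ℝ × ℝ | q * p.2 + p.1 = 0} = 0 := by
    rw [Measure.measure_prod_null hs]
    refine Filter.Eventually.of_forall fun r => ?_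
    refine hac ?_
    refine measure_mono_null (t := {-r / q}) (fun x hx => ?_) (by simp)
    have hx' : q * x + r = 0 := hx
    rw [Set.mem_singleton_iff, eq_div_iff hq]
    linarith
  rw [← hmap, Measure.map_apply (hR.prodMk hX) hs] at h0
  exact measure_eq_zero_iff_ae_notMem.1 h0

/-- An almost sure limit of linear forms in independent variables with densities is almost surely
nonzero, provided that the coefficient of one variable is eventually a nonzero constant. -/
theorem ae_limit_ne_zero [IsFiniteMeasure P] (hm : ∀ u, Measurable (ε u)) (hind : iIndepFun ε P)
    {u₀ : ℤ} (hac : P.map (ε u₀) ≪ volume) {q : ℝ} (hq : q ≠ 0) {s : ℕ → Finset ℤ}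
    {w : ℕ → ℤ → ℝ} (hs : ∀ N, u₀ ∈ s N) (hw : ∀ N, w N u₀ = q) {x : Ω → ℝ}
    (hx : ∀ᵐ ω ∂P, Filter.Tendsto (fun N => ∑ u ∈ s N, w N u * ε u ω) Filter.atTop (nhds (x ω))) :
    ∀ᵐ ω ∂P, x ω ≠ 0 := by
  -- The limit exists only almost surely. The `limsup` is defined everywhere and is exactly
  -- measurable for the variables other than `ε u₀`, which gives independence from `ε u₀`.
  set R : Ω → ℝ := fun ω =>
    Filter.limsup (fun N => ∑ u ∈ (s N).erase u₀, w N u * ε u ω) Filter.atTop with hR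
  set m : ℤ → MeasurableSpace Ω := fun u => MeasurableSpace.comap (ε u) inferInstance with hmdef
  have hmle : ∀ u, m u ≤ ‹MeasurableSpace Ω› := fun u => (hm u).comap_le
  have hRm : Measurable[⨆ u ∈ ({u₀}ᶜ : Set ℤ), m u] R := by
    refine @Measurable.limsup ℝ Ω _ _ _ (⨆ u ∈ ({u₀}ᶜ : Set ℤ), m u) _ _ _ _ fun N => ?_
    refine @Finset.measurable_fun_sum _ _ _ _ _ _ (⨆ u ∈ ({u₀}ᶜ : Set ℤ), m u) _ _ fun u hu => ?_
    have h1 : Measurable[⨆ u ∈ ({u₀}ᶜ : Set ℤ), m u] (ε u) := by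
      rw [measurable_iff_comap_le]
      exact le_iSup₂ (f := fun u (_ : u ∈ ({u₀}ᶜ : Set ℤ)) => m u) u
        (by simpa using Finset.ne_of_mem_erase hu)
    exact h1.const_mul _
  have hle : (⨆ u ∈ ({u₀}ᶜ : Set ℤ), m u) ≤ ‹MeasurableSpace Ω› := iSup₂_le fun u _ => hmle u
  have hRX : IndepFun R (ε u₀) P := by
    rw [IndepFun_iff_Indep]
    have h1 := indep_iSup_of_disjoint hmle hind.iIndep
      (disjoint_compl_left : Disjoint ({u₀}ᶜ : Set ℤ) {u₀})
    refine indep_of_indep_of_le_left (indep_of_indep_of_le_right h1 ?_) ?_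
    · exact le_iSup₂ (f := fun u (_ : u ∈ ({u₀} : Set ℤ)) => m u) u₀ (by simp)
    · exact measurable_iff_comap_le.1 hRm
  have h2 := ae_ne_zero_of_indepFun (hm u₀) (hRm.mono hle le_rfl) hRX hac hq
  filter_upwards [h2, hx] with ω h3 h4
  have e : ∀ N, ∑ u ∈ (s N).erase u₀, w N u * ε u ω =
      ∑ u ∈ s N, w N u * ε u ω - q * ε u₀ ω := by
    intro N
    rw [← Finset.add_sum_erase _ _ (hs N), hw N]
    ring
  have h5 : R ω = x ω - q * ε u₀ ω := by
    rw [hR]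
    simp only [e]
    exact (h4.sub_const _).limsup_eq
  rw [h5] at h3
  simpa using h3

end LinearProcess

/-! ### Truncation of the given process and passage to the limit. -/

section Noise

variable {Ω : Type*} {n : ℕ} {Ψ : ℕ → Matrix (Fin n) (Fin n) ℝ}
  {ε : Fin n → ℤ → Ω → ℝ} {M κ b B : ℝ} {j : Fin n} {T : ℕ}

theorem IsLagPolynomial.linProc_eq (h : IsLagPolynomial Ψ b B) (ε : Fin n → ℤ → Ω → ℝ) (j : Fin n)
    (t : ℤ) (ω : Ω) : linProc Ψ ε j t ω = ∑' k : ℕ, Ψ k j j * ε j (t - k) ω := by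
  refine tsum_congr fun k => ?_
  rw [Matrix.mulVec, dotProduct, Finset.sum_eq_single j]
  · intro i _ hij
    rw [h.isDiag k hij.symm, zero_mul]
  · intro hj
    exact absurd (Finset.mem_univ j) hj

theorem mEntry_eq (hT : 1 ≤ T) (Ψ : ℕ → Matrix (Fin n) (Fin n) ℝ) (ε : Fin n → ℤ → Ω → ℝ)
    (j : Fin n) (k l : ℕ) (ω : Ω) :
    mEntry Ψ ε T j k l ω =
      sigmaCoef T k / sigmaCoef T 1 * (sigmaCoef T l / sigmaCoef T 1) * crossRatio Ψ ε T j k l ω := by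
  have h1 : 0 < sigmaCoef T 1 := sigmaCoef_pos (by rw [Finset.mem_Icc]; omega)
  have hD : ∑ t ∈ Finset.Icc 1 (T - 1), (sigmaCoef T t) ^ 2 * (rowDot Ψ ε T j t ω) ^ 2 =
      sigmaCoef T 1 ^ 2 * crossDenom Ψ ε T j ω := by
    rw [crossDenom, Finset.mul_sum]
    refine Finset.sum_congr rfl fun t _ => ?_
    field_simp
  rw [mEntry, crossRatio, hD]
  field_simp

theorem mem_Icc_of_mem_Icc_pred {t : ℕ} (ht : t ∈ Finset.Icc 1 (T - 1)) : t ∈ Finset.Icc 1 T :=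
  Finset.Icc_subset_Icc_right (Nat.sub_le _ _) ht

theorem sigmaRatio_pos {t : ℕ} (ht : t ∈ Finset.Icc 1 (T - 1)) :
    0 < sigmaCoef T t / sigmaCoef T 1 := by
  refine div_pos (sigmaCoef_pos (mem_Icc_of_mem_Icc_pred ht)) (sigmaCoef_pos ?_)
  rw [Finset.mem_Icc] at ht ⊢
  omega

/-- The ratio `crossRatio` with the linear process truncated at lag `N`. -/
noncomputable def truncRatio (Ψ : ℕ → Matrix (Fin n) (Fin n) ℝ) (ε : Fin n → ℤ → Ω → ℝ)
    (T : ℕ) (j : Fin n) (k l N : ℕ) (ω : Ω) : ℝ :=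
  (∑ u ∈ Finset.Icc (1 - N : ℤ) T, lagCoef (fun i => Ψ i j j) N T k u * ε j u ω) *
    (∑ u ∈ Finset.Icc (1 - N : ℤ) T, lagCoef (fun i => Ψ i j j) N T l u * ε j u ω) /
    ∑ t ∈ Finset.Icc 1 (T - 1), (sigmaCoef T t / sigmaCoef T 1) ^ 2 *
      (∑ u ∈ Finset.Icc (1 - N : ℤ) T, lagCoef (fun i => Ψ i j j) N T t u * ε j u ω) ^ 2

theorem abs_truncRatio_le {k l : ℕ} (hk : k ∈ Finset.Icc 1 (T - 1)) (hl : l ∈ Finset.Icc 1 (T - 1))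
    (hkl : k ≠ l) (N : ℕ) (ω : Ω) :
    |truncRatio Ψ ε T j k l N ω| ≤
      1 / (2 * (sigmaCoef T k / sigmaCoef T 1) * (sigmaCoef T l / sigmaCoef T 1)) :=
  abs_mul_div_sum_le hk hl hkl (a := fun t => sigmaCoef T t / sigmaCoef T 1)
    (sigmaRatio_pos hk) (sigmaRatio_pos hl)
    fun t => ∑ u ∈ Finset.Icc (1 - N : ℤ) T, lagCoef (fun i => Ψ i j j) N T t u * ε j u ω

variable [MeasurableSpace Ω] {P : Measure Ω}

theorem IsNoise.isStandardized [IsProbabilityMeasure P] (h : IsNoise P ε M κ) (i : Fin n) (t : ℤ) :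
    IsStandardized P (ε i t) (1 + |κ|) := by
  have h8 : Integrable (fun ω => |ε i t ω| ^ 8) P := by
    have := (h.memLp i t).integrable_norm_pow (p := 8) (by norm_num)
    simpa only [Real.norm_eq_abs] using this
  have hbd : ∀ m ≤ 8, ∫ ω, |ε i t ω| ^ m ∂P ≤ 1 + |κ| := by
    intro m hm
    have hp : ∀ x : ℝ, |x| ^ m ≤ 1 + |x| ^ 8 := by
      intro x
      rcases le_total |x| 1 with hx | hx
      · have h1 := pow_le_one₀ (n := m) (abs_nonneg x) hx
        have h2 := pow_nonneg (abs_nonneg x) 8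
        linarith
      · have h1 := pow_le_pow_right₀ hx hm
        linarith
    have h1 : ∫ ω, |ε i t ω| ^ m ∂P ≤ ∫ ω, (1 + |ε i t ω| ^ 8) ∂P :=
      integral_mono_of_nonneg (Filter.Eventually.of_forall fun ω => by positivity)
        ((integrable_const 1).add h8) (Filter.Eventually.of_forall fun ω => hp _)
    rw [integral_add (integrable_const 1) h8] at h1
    simp only [integral_const, probReal_univ, one_smul] at h1
    linarith [h.moment_le i t, le_abs_self κ]
  exact
    { measurable := h.measurable i t
      memLp := (h.memLp i t).mono_exponent (by norm_num)
      mean_zero := h.mean_zero i t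
      var_one := h.var_one i t
      moment_three := hbd 3 (by norm_num)
      moment_four := hbd 4 (by norm_num)
      one_le := by linarith [abs_nonneg κ] }

theorem IsNoise.iIndepFun_row (h : IsNoise P ε M κ) (j : Fin n) : iIndepFun (ε j) P :=
  h.indep.precomp (g := fun u : ℤ => (j, u)) fun _ _ huv => (Prod.mk.inj huv).2

theorem IsLagPolynomial.summable_abs (h : IsLagPolynomial Ψ b B) (j : Fin n) :
    Summable fun k => |Ψ k j j| := by
  refine (h.summable j).of_nonneg_of_le (fun k => abs_nonneg _) fun k => ?_
  have h1 : (0 : ℝ) ≤ k := k.cast_nonneg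
  nlinarith [abs_nonneg (Ψ k j j)]

theorem IsLagPolynomial.sum_range_le (h : IsLagPolynomial Ψ b B) (j : Fin n) (N : ℕ) :
    ∑ i ∈ Finset.range N, (1 + (i : ℝ)) * |Ψ i j j| ≤ B :=
  ((h.summable j).sum_le_tsum _ fun i _ => by positivity).trans (h.upper j)

theorem IsLagPolynomial.exists_ne_zero (h : IsLagPolynomial Ψ b B) (hb : 0 < b) (j : Fin n) :
    ∃ k, Ψ k j j ≠ 0 := by
  by_contra! h0
  have := h.lower j
  simp only [h0, tsum_zero, abs_zero] at this
  linarith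

/-- Partial sums only approach a limit of modulus at least `b`, so half of `b` is retained; `b² / 4`
later serves as `δ₀`. -/
theorem IsLagPolynomial.eventually_le_sq (h : IsLagPolynomial Ψ b B) (hb : 0 < b) (j : Fin n) :
    ∀ᶠ N in Filter.atTop, b ^ 2 / 4 ≤ (∑ i ∈ Finset.range N, Ψ i j j) ^ 2 := by
  have h1 : Summable fun k => Ψ k j j := (h.summable_abs j).of_abs
  have h2 := (h1.hasSum.tendsto_sum_nat.abs).eventually
    (lt_mem_nhds (show b / 2 < |∑' k, Ψ k j j| by linarith [h.lower j]))
  filter_upwards [h2] with N hN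
  rw [← sq_abs (∑ i ∈ Finset.range N, Ψ i j j)]
  nlinarith

theorem ae_tendsto_rowDot [IsProbabilityMeasure P] (hε : IsNoise P ε M κ)
    (hΨ : IsLagPolynomial Ψ b B) (T : ℕ) (j : Fin n) :
    ∀ᵐ ω ∂P, ∀ k, Filter.Tendsto (fun N : ℕ => ∑ u ∈ Finset.Icc (1 - N : ℤ) T,
      lagCoef (fun i => Ψ i j j) N T k u * ε j u ω) Filter.atTop (nhds (rowDot Ψ ε T j k ω)) := by
  filter_upwards [ae_summable_mul (hε.isStandardized j) (hΨ.summable_abs j)] with ω hω k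
  simp only [← sum_lag_mul_vEntry (fun i => Ψ i j j) (fun u => ε j u ω)]
  refine tendsto_finsetSum _ fun t _ => Filter.Tendsto.mul_const _ ?_
  rw [hΨ.linProc_eq]
  exact (hω t).hasSum.tendsto_sum_nat

theorem sineWave_one_ne_zero (hT : 2 ≤ T) : sineWave T 1 T ≠ 0 := by
  have hT0 : (2 : ℝ) ≤ T := by exact_mod_cast hT
  rw [sineWave]
  refine mul_ne_zero (by positivity) (ne_of_gt (Real.sin_pos_of_pos_of_lt_pi ?_ ?_))
  · have := Real.pi_pos
    push_cast
    have h1 : (0 : ℝ) < T - 1 := by linarith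
    positivity
  · rw [div_lt_iff₀ (by linarith)]
    push_cast
    nlinarith [Real.pi_pos]

/-- At time `T - p`, lags beyond `p` point past `T` and lags below `p` have zero coefficient. The
weight of this innovation is therefore the same for every truncation `N > p`. -/
theorem lagCoef_first {ψ : ℕ → ℝ} {p : ℕ} (hp : ∀ i < p, ψ i = 0) (hT : 1 ≤ T) {N : ℕ}
    (hN : p < N) (k : ℕ) : lagCoef ψ N T k ((T : ℤ) - p) = ψ p * sineWave T k T := by
  rw [lagCoef, Finset.sum_eq_single p]
  · rw [vExt, if_pos (by rw [Finset.mem_Icc]; omega)]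
    congr 2
    ring
  · intro i _ hip
    rcases lt_or_gt_of_ne hip with h1 | h1
    · rw [hp i h1, zero_mul]
    · rw [vExt, if_neg (by rw [Finset.mem_Icc]; omega), mul_zero]
  · intro h
    exact absurd (Finset.mem_range.2 hN) h

theorem ae_rowDot_one_ne_zero [IsProbabilityMeasure P] (hε : IsNoise P ε M κ)
    (hΨ : IsLagPolynomial Ψ b B) (hb : 0 < b) (hT : 2 ≤ T) (j : Fin n) :
    ∀ᵐ ω ∂P, rowDot Ψ ε T j 1 ω ≠ 0 := by
  classical
  have hex := hΨ.exists_ne_zero hb j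
  obtain ⟨p, hp, hp'⟩ : ∃ p, Ψ p j j ≠ 0 ∧ ∀ i < p, Ψ i j j = 0 :=
    ⟨Nat.find hex, Nat.find_spec hex, fun i hi => not_not.1 (Nat.find_min hex hi)⟩
  have := hε.hasPDF j ((T : ℤ) - p)
  refine ae_limit_ne_zero (hε.measurable j) (hε.iIndepFun_row j) (u₀ := (T : ℤ) - p)
    (HasPDF.absolutelyContinuous : P.map (ε j ((T : ℤ) - p)) ≪ volume)
    (mul_ne_zero hp (sineWave_one_ne_zero hT))
    -- The index is shifted by `p + 1` so that every truncation includes lag `p`.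
    (s := fun N => Finset.Icc (1 - ((N + (p + 1) : ℕ) : ℤ)) T)
    (w := fun N => lagCoef (fun i => Ψ i j j) (N + (p + 1)) T 1)
    (fun N => by rw [Finset.mem_Icc]; push_cast; omega)
    (fun N => lagCoef_first (ψ := fun i => Ψ i j j) hp' (by omega) (by omega) 1) ?_
  filter_upwards [ae_tendsto_rowDot hε hΨ T j] with ω hω
  exact (hω 1).comp (Filter.tendsto_add_atTop_nat (p + 1))

theorem ae_crossDenom_pos [IsProbabilityMeasure P] (hε : IsNoise P ε M κ)
    (hΨ : IsLagPolynomial Ψ b B) (hb : 0 < b) (hT : 2 ≤ T) (j : Fin n) :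
    ∀ᵐ ω ∂P, 0 < crossDenom Ψ ε T j ω := by
  filter_upwards [ae_rowDot_one_ne_zero hε hΨ hb hT j] with ω hω
  have h1 : 0 < sigmaCoef T 1 := sigmaCoef_pos (by rw [Finset.mem_Icc]; omega)
  refine Finset.sum_pos' (fun t _ => by positivity) ⟨1, by rw [Finset.mem_Icc]; omega, ?_⟩
  positivity

theorem ae_tendsto_truncRatio [IsProbabilityMeasure P] (hε : IsNoise P ε M κ)
    (hΨ : IsLagPolynomial Ψ b B) (hb : 0 < b) (hT : 2 ≤ T) (j : Fin n) (k l : ℕ) :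
    ∀ᵐ ω ∂P, Filter.Tendsto (fun N => truncRatio Ψ ε T j k l N ω) Filter.atTop
      (nhds (crossRatio Ψ ε T j k l ω)) := by
  filter_upwards [ae_tendsto_rowDot hε hΨ T j, ae_crossDenom_pos hε hΨ hb hT j] with ω h1 h2
  exact ((h1 k).mul (h1 l)).div
    (tendsto_finsetSum _ fun t _ => ((h1 t).pow 2).const_mul _) h2.ne'

theorem measurable_truncRatio (hε : IsNoise P ε M κ) (k l N : ℕ) :
    Measurable (truncRatio Ψ ε T j k l N) := by
  have := hε.measurable j
  unfold truncRatio
  fun_prop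

theorem integrable_crossRatio [IsProbabilityMeasure P] (hε : IsNoise P ε M κ)
    (hΨ : IsLagPolynomial Ψ b B) (hb : 0 < b) (hT : 2 ≤ T) {k l : ℕ}
    (hk : k ∈ Finset.Icc 1 (T - 1)) (hl : l ∈ Finset.Icc 1 (T - 1)) (hkl : k ≠ l) :
    Integrable (crossRatio Ψ ε T j k l) P := by
  refine Integrable.of_bound (aestronglyMeasurable_of_tendsto_ae Filter.atTop
    (fun N => (measurable_truncRatio hε k l N).aestronglyMeasurable)
    (ae_tendsto_truncRatio hε hΨ hb hT j k l))
    (1 / (2 * (sigmaCoef T k / sigmaCoef T 1) * (sigmaCoef T l / sigmaCoef T 1)))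
    (Filter.Eventually.of_forall fun ω => ?_)
  exact abs_mul_div_sum_le hk hl hkl (a := fun t => sigmaCoef T t / sigmaCoef T 1)
    (sigmaRatio_pos hk) (sigmaRatio_pos hl) fun t => rowDot Ψ ε T j t ω

theorem tendsto_integral_truncRatio [IsProbabilityMeasure P] (hε : IsNoise P ε M κ)
    (hΨ : IsLagPolynomial Ψ b B) (hb : 0 < b) (hT : 2 ≤ T) {k l : ℕ}
    (hk : k ∈ Finset.Icc 1 (T - 1)) (hl : l ∈ Finset.Icc 1 (T - 1)) (hkl : k ≠ l) :
    Filter.Tendsto (fun N => ∫ ω, truncRatio Ψ ε T j k l N ω ∂P) Filter.atTop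
      (nhds (∫ ω, crossRatio Ψ ε T j k l ω ∂P)) :=
  tendsto_integral_of_dominated_convergence _
    (fun N => (measurable_truncRatio hε k l N).aestronglyMeasurable) (integrable_const _)
    (fun N => Filter.Eventually.of_forall fun ω => abs_truncRatio_le hk hl hkl N ω)
    (ae_tendsto_truncRatio hε hΨ hb hT j k l)

end Noise

/-! ### Conclusion for the full process. -/

theorem exists_forall_abs_integral_crossRatio_le (B M κ : ℝ) {b : ℝ} (hb : 0 < b) :
    ∃ T₀ : ℕ, 2 ≤ T₀ ∧ ∀ (Ω : Type*) [MeasurableSpace Ω] (P : Measure Ω) [IsProbabilityMeasure P]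
      (n : ℕ) (Ψ : ℕ → Matrix (Fin n) (Fin n) ℝ) (ε : Fin n → ℤ → Ω → ℝ),
      IsNoise P ε M κ → IsLagPolynomial Ψ b B → ∀ T : ℕ, T₀ ≤ T → ∀ j : Fin n,
        ∀ k ∈ Finset.Icc 1 (T - 1), ∀ l ∈ Finset.Icc 1 (T - 1), k ≠ l →
          |∫ ω, crossRatio Ψ ε T j k l ω ∂P| ≤ (T : ℝ) ^ (-(1 / 2) : ℝ) := by
  -- A negative `B` contradicts the upper bound at the given `j`.
  by_cases hB : 0 ≤ B
  swap
  · refine ⟨2, le_rfl, fun Ω _ P _ n Ψ ε _ hΨ T _ j => absurd ?_ hB⟩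
    exact (tsum_nonneg fun k => by positivity).trans (hΨ.upper j)
  obtain ⟨T₀, hT₀, h⟩ := exists_forall_abs_integral_ratio_le (K := 1 + |κ|)
    (β := 1 + 6 * B ^ 2 + 2 * B) (δ₀ := b ^ 2 / 4) (by positivity) (by nlinarith) (by positivity)
  refine ⟨T₀, hT₀, fun Ω _ P _ n Ψ ε hε hΨ T hT j k hk l hl hkl => ?_⟩
  -- The bound for the truncated ratio is uniform in `N`, so it is enough to have it for all large
  -- `N`.
  refine le_of_tendsto (tendsto_integral_truncRatio hε hΨ hb (hT₀.trans hT) hk hl hkl).abs ?_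
  filter_upwards [hΨ.eventually_le_sq hb j] with N hN
  have hlow := hΨ.sum_range_le j N
  have h1 := h T hT Ω (Finset.Icc (1 - N : ℤ) T) P (fun u => ε j u)
    (fun t u => lagCoef (fun i => Ψ i j j) N T t u) (fun t => sigmaCoef T t / sigmaCoef T 1)
    (fun u => hε.isStandardized j u) ((hε.iIndepFun_row j).precomp Subtype.val_injective)
    (nearlyOrthogonal_lagCoef hlow (by omega))
    (fun t ht => le_trans (by gcongr) (le_sum_lagCoef_sq hlow ht))
    (fun t ht => sigmaRatio_le (mem_Icc_of_mem_Icc_pred ht))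
    (fun t ht => le_sigmaRatio (mem_Icc_of_mem_Icc_pred ht)) k hk l hl hkl
  have e : ∀ t ω, ∑ u : Finset.Icc (1 - N : ℤ) T, lagCoef (fun i => Ψ i j j) N T t u * ε j u ω =
      ∑ u ∈ Finset.Icc (1 - N : ℤ) T, lagCoef (fun i => Ψ i j j) N T t u * ε j u ω := fun t ω =>
    Finset.sum_coe_sort (Finset.Icc (1 - N : ℤ) T)
      fun u => lagCoef (fun i => Ψ i j j) N T t u * ε j u ω
  simp only [e] at h1
  exact h1

theorem mainTheorem4 (B M κ : ℝ) (hB : 0 < B) (hM : 0 < M) :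
    ∃ C : ℝ, 0 < C ∧ ∀ b : ℝ, 0 < b → ∃ T₀ : ℕ,
      ∀ (Ω : Type*) [MeasurableSpace Ω] (P : Measure Ω) [IsProbabilityMeasure P]
        (n : ℕ) (Ψ : ℕ → Matrix (Fin n) (Fin n) ℝ) (ε : Fin n → ℤ → Ω → ℝ),
        IsNoise P ε M κ → IsLagPolynomial Ψ b B →
        ∀ T : ℕ, T₀ ≤ T → ∀ j : Fin n,
          ∀ k ∈ Finset.Icc 1 (T - 1), ∀ l ∈ Finset.Icc 1 (T - 1), k ≠ l →
            (∀ᵐ ω ∂P, 0 < crossDenom Ψ ε T j ω) ∧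
            Integrable (crossRatio Ψ ε T j k l) P ∧
            |∫ ω, crossRatio Ψ ε T j k l ω ∂P| ≤ C * (T : ℝ) ^ (-(1 / 2) : ℝ) ∧
            Integrable (mEntry Ψ ε T j k l) P ∧
            |∫ ω, mEntry Ψ ε T j k l ω ∂P| ≤ C * ((k : ℝ) * (l : ℝ))⁻¹ := by
  -- The `4` is `2 · 2` from `σ_k / σ_1 ≤ 2/k` and `σ_l / σ_1 ≤ 2/l`; the first bound holds even
  -- with constant `1`.
  refine ⟨4, by norm_num, fun b hb => ?_⟩
  obtain ⟨T₀, hT₀, h⟩ := exists_forall_abs_integral_crossRatio_le B M κ hb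
  refine ⟨T₀, fun Ω _ P _ n Ψ ε hε hΨ T hT j k hk l hl hkl => ?_⟩
  have hT2 : 2 ≤ T := hT₀.trans hT
  have hm : mEntry Ψ ε T j k l = fun ω =>
      sigmaCoef T k / sigmaCoef T 1 * (sigmaCoef T l / sigmaCoef T 1) *
        crossRatio Ψ ε T j k l ω := funext fun ω => mEntry_eq (by omega) Ψ ε j k l ω
  have hint : Integrable (crossRatio Ψ ε T j k l) P :=
    integrable_crossRatio hε hΨ hb hT2 hk hl hkl
  have hle := h Ω P n Ψ ε hε hΨ T hT j k hk l hl hkl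
  have hT1 : (T : ℝ) ^ (-(1 / 2) : ℝ) ≤ 1 :=
    Real.rpow_le_one_of_one_le_of_nonpos (by exact_mod_cast (by omega : 1 ≤ T)) (by norm_num)
  have hT0 : 0 ≤ (T : ℝ) ^ (-(1 / 2) : ℝ) := by positivity
  refine ⟨ae_crossDenom_pos hε hΨ hb hT2 j, hint, by linarith, ?_, ?_⟩
  · rw [hm]
    exact hint.const_mul _
  · have hk0 := sigmaRatio_pos hk
    have hl0 := sigmaRatio_pos hl
    have hk2 := sigmaRatio_le (mem_Icc_of_mem_Icc_pred hk)
    have hl2 := sigmaRatio_le (mem_Icc_of_mem_Icc_pred hl)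
    rw [hm, integral_const_mul, abs_mul, abs_of_pos (mul_pos hk0 hl0)]
    calc _ ≤ 2 / (k : ℝ) * (2 / l) * 1 := by
          gcongr
          exact hle.trans hT1
      _ = 4 * ((k : ℝ) * l)⁻¹ := by
          rw [mul_inv]
          ring
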